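/- Let $\Theta$ be a smooth $p$-dimensional manifold, possibly with boundary (or corners), with a smooth complete Riemannian metric $g$ (closed bounded sets are compact), volume element $\epsilon=\sqrt{|g|}\,d^p\theta$ and covariant derivative $\nabla_a$; repeated indices are summed. Let $\{f(\cdot|\theta)\}$ be probability densities with respect to a measure $\mu$, differentiable in $\theta$, with finite and continuous Fisher information $F_{ab}=\int(\partial_a\ln f)(\partial_b\ln f)f\,d\mu$ in the interior of $\Theta$. Let $n$ be the number of observations, $\beta=(\beta^1,\dots,\beta^q)$ a differentiable vector parameter of interest, $u^j_a=\partial_a\beta^j$, let $\gamma(\theta)$ be a continuous positive-definite $q\times q$ weight matrix with inverse entries $\gamma^{jk}$, and let $\rho$ be a $C^1$ prior probability density with respect to $\epsilon$, nonnegative on $\Theta$ and positive in the interior. A field $v=(v_j^a)$ consists of $q$ vector fields $v_1,\dots,v_q$ of class $C^1$ on $\Theta$ such that $\rho v_j=0$ on $\partial\Theta$ and the three integrals $$\int\gamma^{jk}g_{ab}v_j^av_k^b\,\rho\epsilon,\qquad \langle\mathsf F\rangle=\int\gamma^{jk}v_j^aF_{ab}v_k^b\,\rho\epsilon,\qquad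 \langle\mathsf P\rangle=\int\gamma^{jk}\Bigl[\tfrac1\rho\nabla_a(\rho v_j^a)\Bigr]\Bigl[\tfrac1\rho\nabla_b(\rho v_k^b)\Bigr]\rho\epsilon$$ are finite. For a field $v$ and a family $\omega=(\omega^j_a)$ of $q$ covector fields, put $\langle v,\omega\rangle_\rho=\langle\omega,v\rangle_\rho=\int v_j^a\omega_a^j\,\rho\epsilon$. If $\langle v,u\rangle_\rho$ exists and $n\langle\mathsf F\rangle+\langle\mathsf P\rangle>0$, the generalized Gill-Levit bound is $$\mathsf B(v)=\frac{\langle v,u\rangle_\rho^2}{n\langle\mathsf F\rangle+\langle\mathsf P\rangle}.$$ In the interior of $\Theta$ define $$(Lv)^j_a=n\gamma^{jk}F_{ab}v_k^b-\nabla_a\Bigl[\frac{\gamma^{jk}}{\rho}\nabla_b(\rho v_k^b)\Bigr]$$ on the domain of all fields $v$ for which the brackets $\frac{\gamma^{jk}}{\rho}\nabla_b(\rho v_k^b)$ are $C^1$ in the interior. Then $L$ is linear, self-adjoint in the sense that $\langle v,Lw\rangle_\rho=\langle w,Lv\rangle_\rho$ for all $v,w$ in its domain for which both integrals exist, and positive-semidefinite,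 that is, $\langle v,Lv\rangle_\rho\ge0$ whenever the integral exists. Suppose moreover that $u$ is not identically zero and that $u$ is in the range of $L$, in the sense that some $w$ in the domain satisfies $Lw=u$ and $\langle w,u\rangle_\rho$ exists; write $w=L^{-1}u$ for any such $w$. Then $$\max_v\mathsf B(v)=\langle u,L^{-1}u\rangle_\rho ,$$ the maximum being over all fields $v$ for which $\mathsf B(v)$ is defined and the right-hand side not depending on the choice of $L^{-1}u$. A field $v$ attains the maximum if and only if $v=c\,L^{-1}u$ for some real $c\ne0$ and some choice of $L^{-1}u$. -/

import Mathlib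

open MeasureTheory Manifold Bundle Set
open scoped ContDiff NNReal ENNReal

noncomputable section

namespace GillLevit

section Geometry

variable {p : ℕ} {H : Type*} [TopologicalSpace H]
  (I : ModelWithCorners ℝ (EuclideanSpace ℝ (Fin p)) H)
  {M : Type*} [TopologicalSpace M] [ChartedSpace H M]
  [RiemannianBundle (fun θ : M => TangentSpace I θ)]

/-- The coordinate vector field `∂_a` of the preferred chart at `x`, at the point with
coordinates `y`. -/
def coordVec (x : M) (a : Fin p) (y : EuclideanSpace ℝ (Fin p)) :
    TangentSpace I ((extChartAt I x).symm y) :=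
  mfderivWithin 𝓘(ℝ, EuclideanSpace ℝ (Fin p)) I (extChartAt I x).symm (range I) y
    (EuclideanSpace.single a (1 : ℝ))

/-- The components `g_{ab}` of the Riemannian metric in the preferred chart at `x`. -/
def gram (x : M) (y : EuclideanSpace ℝ (Fin p)) : Matrix (Fin p) (Fin p) ℝ :=
  Matrix.of fun a b => inner ℝ (coordVec I x a y) (coordVec I x b y)

/-- `√|g|` in the preferred chart at `x`. -/
def sqrtDetMetric (x : M) (y : EuclideanSpace ℝ (Fin p)) : ℝ :=
  Real.sqrt (gram I x y).det

/-- The measure `√|g| d^pθ` on the domain of the preferred chart at `x`. -/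
def chartVolume [MeasurableSpace M] (x : M) : Measure M :=
  ((volume.restrict (extChartAt I x).target).withDensity
    fun y => ENNReal.ofReal (sqrtDetMetric I x y)).map (extChartAt I x).symm

/-- The Riemannian volume measure `ε = √|g| d^pθ`: the chart measures agree on overlaps of charts,
and their supremum is the measure that restricts to each of them. -/
def riemannianVolume [MeasurableSpace M] : Measure M :=
  ⨆ x : M, chartVolume I x

/-- The component `X^a` of the vector field `X` in the preferred chart at `x`. -/
def coordComp (x : M) (X : (θ : M) → TangentSpace I θ) (a : Fin p)
    (y : EuclideanSpace ℝ (Fin p)) : ℝ :=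
  let Y : EuclideanSpace ℝ (Fin p) :=
    mfderiv I 𝓘(ℝ, EuclideanSpace ℝ (Fin p)) (extChartAt I x) ((extChartAt I x).symm y)
      (X ((extChartAt I x).symm y))
  Y a

/-- The covariant divergence `∇_a X^a = |g|^{-1/2} ∂_a (|g|^{1/2} X^a)` at `x`, computed in the
preferred chart at `x`. -/
def divergence (X : (θ : M) → TangentSpace I θ) (x : M) : ℝ :=
  (sqrtDetMetric I x (extChartAt I x x))⁻¹ *
    ∑ a : Fin p, fderivWithin ℝ (fun y => sqrtDetMetric I x y * coordComp I x X a y) (range I)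
      (extChartAt I x x) (EuclideanSpace.single a (1 : ℝ))

/-- The derivative `X^a ∂_a φ` of the scalar `φ` at `θ` along the tangent vector `X`. -/
def dirDeriv (φ : M → ℝ) (θ : M) (X : TangentSpace I θ) : ℝ :=
  (mfderiv I 𝓘(ℝ, ℝ) φ θ X : ℝ)

variable (M) in
/-- Completeness of a Riemannian manifold, possibly with boundary, in Heine-Borel form: the closed
balls of the Riemannian distance are compact. -/
def IsCompleteRiemannian : Prop :=
  ∀ (x : M) (r : ℝ≥0), IsCompact {y : M | riemannianEDist I x y ≤ r}

/-- `X` is a continuously differentiable vector field. -/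
def IsC1Field [IsManifold I 1 M] (X : (θ : M) → TangentSpace I θ) : Prop :=
  ContMDiff I I.tangent 1 (fun θ => (⟨θ, X θ⟩ : TangentBundle I M))

/-- The Fisher information `F_{ab} X^a Y^b = ∫ (X^a ∂_a ln f) (Y^b ∂_b ln f) f dμ` at `θ`. -/
def fisherInfo {𝓧 : Type*} [MeasurableSpace 𝓧] (μ : Measure 𝓧) (f : M → 𝓧 → ℝ) (θ : M)
    (X Y : TangentSpace I θ) : ℝ :=
  ∫ x, dirDeriv I (fun τ => Real.log (f τ x)) θ X * dirDeriv I (fun τ => Real.log (f τ x)) θ Y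
    * f θ x ∂μ

end Geometry

/-- A Bayesian estimation problem on the parameter manifold `M`: `n` independent observations with
density `f θ` with respect to `μ`, a parameter of interest `β` with `q` components, a weight matrix
`γ`, and a prior with density `ρ` with respect to the Riemannian volume. -/
structure BayesProblem {p : ℕ} {H : Type*} [TopologicalSpace H]
    (I : ModelWithCorners ℝ (EuclideanSpace ℝ (Fin p)) H)
    (M : Type*) [TopologicalSpace M] [ChartedSpace H M] [IsManifold I 1 M]
    [RiemannianBundle (fun θ : M => TangentSpace I θ)] [MeasurableSpace M]
    (𝓧 : Type*) [MeasurableSpace 𝓧] (q : ℕ) where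
  /-- the reference measure on the observation space -/
  μ : Measure 𝓧
  /-- the probability densities of one observation -/
  f : M → 𝓧 → ℝ
  /-- the number of observations -/
  n : ℕ
  /-- the parameter of interest -/
  β : Fin q → M → ℝ
  /-- the weight matrix `γ_{jk}` -/
  γ : M → Matrix (Fin q) (Fin q) ℝ
  /-- the prior density with respect to the Riemannian volume -/
  ρ : M → ℝ
  f_measurable : ∀ θ ∈ I.interior M, Measurable (f θ)
  f_nonneg : ∀ θ ∈ I.interior M, ∀ x, 0 ≤ f θ x
  f_integral : ∀ θ ∈ I.interior M, ∫ x, f θ x ∂μ = 1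
  f_differentiable : ∀ θ ∈ I.interior M, ∀ᵐ x ∂μ, MDifferentiableAt I 𝓘(ℝ, ℝ) (fun τ => f τ x) θ
  /-- the integrals that define the Fisher information exist -/
  fisher_exists : ∀ θ ∈ I.interior M, ∀ X Y : TangentSpace I θ,
    Integrable (fun x => dirDeriv I (fun τ => Real.log (f τ x)) θ X *
      dirDeriv I (fun τ => Real.log (f τ x)) θ Y * f θ x) μ
  /-- the Fisher information is a continuous tensor field -/
  fisher_continuous : ∀ X Y : (θ : M) → TangentSpace I θ, IsC1Field I X → IsC1Field I Y →
    ContinuousOn (fun θ => fisherInfo I μ f θ (X θ) (Y θ)) (I.interior M)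
  β_differentiable : ∀ j, ∀ θ ∈ I.interior M, MDifferentiableAt I 𝓘(ℝ, ℝ) (β j) θ
  γ_continuous : Continuous γ
  γ_posDef : ∀ θ, (γ θ).PosDef
  ρ_C1 : ContMDiff I 𝓘(ℝ, ℝ) 1 ρ
  ρ_nonneg : ∀ θ, 0 ≤ ρ θ
  ρ_pos : ∀ θ ∈ I.interior M, 0 < ρ θ
  ρ_integral : ∫ θ, ρ θ ∂(riemannianVolume I) = 1

namespace BayesProblem

variable {p : ℕ} {H : Type*} [TopologicalSpace H]
  {I : ModelWithCorners ℝ (EuclideanSpace ℝ (Fin p)) H}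
  {M : Type*} [TopologicalSpace M] [ChartedSpace H M] [IsManifold I 1 M]
  [RiemannianBundle (fun θ : M => TangentSpace I θ)] [MeasurableSpace M]
  {𝓧 : Type*} [MeasurableSpace 𝓧] {q : ℕ} (S : BayesProblem I M 𝓧 q)

/-- `F_{ab} X^a Y^b` at `θ`. -/
def F (θ : M) (X Y : TangentSpace I θ) : ℝ :=
  fisherInfo I S.μ S.f θ X Y

/-- `u^j_a = ∂_a β^j`, as a family of covector fields. -/
def u (j : Fin q) (θ : M) (X : TangentSpace I θ) : ℝ :=
  dirDeriv I (S.β j) θ X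

/-- `(1/ρ) ∇_a (ρ v_j^a)`. -/
def score (v : Fin q → (θ : M) → TangentSpace I θ) (j : Fin q) (θ : M) : ℝ :=
  1 / S.ρ θ * divergence I (fun τ => S.ρ τ • v j τ) θ

/-- `(γ^{jk}/ρ) ∇_b (ρ v_k^b)`, where `γ^{jk}` is the inverse of the weight matrix. -/
def raisedScore (v : Fin q → (θ : M) → TangentSpace I θ) (j : Fin q) (θ : M) : ℝ :=
  ∑ k, (S.γ θ)⁻¹ j k / S.ρ θ * divergence I (fun τ => S.ρ τ • v k τ) θ

/-- The contraction `v_j^a α_a^j` with a family of covector fields; for `α = u` it is `𝖠`. -/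
def contract (v : Fin q → (θ : M) → TangentSpace I θ)
    (α : Fin q → (θ : M) → TangentSpace I θ → ℝ) (θ : M) : ℝ :=
  ∑ j, α j θ (v j θ)

/-- `𝖥 = γ^{jk} v_j^a F_{ab} v_k^b`. -/
def fisherTerm (v : Fin q → (θ : M) → TangentSpace I θ) (θ : M) : ℝ :=
  ∑ j, ∑ k, (S.γ θ)⁻¹ j k * S.F θ (v j θ) (v k θ)

/-- `𝖯 = γ^{jk} [(1/ρ) ∇_a (ρ v_j^a)] [(1/ρ) ∇_b (ρ v_k^b)]`. -/
def priorTerm (v : Fin q → (θ : M) → TangentSpace I θ) (θ : M) : ℝ :=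
  ∑ j, ∑ k, (S.γ θ)⁻¹ j k * S.score v j θ * S.score v k θ

/-- `γ^{jk} g_{ab} v_j^a v_k^b`, the pointwise squared norm of `v`. -/
def sqNorm (v : Fin q → (θ : M) → TangentSpace I θ) (θ : M) : ℝ :=
  ∑ j, ∑ k, (S.γ θ)⁻¹ j k * inner ℝ (v j θ) (v k θ)

/-- The prior expectation `∫ φ ρ ε`. -/
def avg (φ : M → ℝ) : ℝ :=
  ∫ θ, φ θ * S.ρ θ ∂(riemannianVolume I)

/-- The prior expectation of `φ` exists. -/
def HasAvg (φ : M → ℝ) : Prop :=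
  Integrable (fun θ => φ θ * S.ρ θ) (riemannianVolume I)

/-- The pairing `⟨v, α⟩_ρ = ∫ v_j^a α_a^j ρ ε`. -/
def pairing (v : Fin q → (θ : M) → TangentSpace I θ)
    (α : Fin q → (θ : M) → TangentSpace I θ → ℝ) : ℝ :=
  S.avg (contract v α)

/-- The denominator `n ⟨𝖥⟩ + ⟨𝖯⟩`. -/
def information (v : Fin q → (θ : M) → TangentSpace I θ) : ℝ :=
  S.n * S.avg (S.fisherTerm v) + S.avg (S.priorTerm v)

/-- The generalized Gill-Levit bound `𝖡 = ⟨𝖠⟩² / (n ⟨𝖥⟩ + ⟨𝖯⟩)`. -/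
def bound (v : Fin q → (θ : M) → TangentSpace I θ) : ℝ :=
  S.pairing v S.u ^ 2 / S.information v

/-- `(Lv)^j_a = n γ^{jk} F_{ab} v_k^b - ∇_a [(γ^{jk}/ρ) ∇_b (ρ v_k^b)]`, evaluated on the tangent
vector `X^a`. -/
def L (v : Fin q → (θ : M) → TangentSpace I θ) (j : Fin q) (θ : M) (X : TangentSpace I θ) : ℝ :=
  S.n * ∑ k, (S.γ θ)⁻¹ j k * S.F θ X (v k θ) - dirDeriv I (S.raisedScore v j) θ X

/-- The fields over which the bounds range: continuously differentiable, with `ρ v = 0` on the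
boundary of the parameter manifold, of finite norm, and with finite `⟨𝖥⟩` and `⟨𝖯⟩`. -/
structure IsField (v : Fin q → (θ : M) → TangentSpace I θ) : Prop where
  c1 : ∀ j, IsC1Field I (v j)
  boundary : ∀ j, ∀ θ ∈ I.boundary M, S.ρ θ • v j θ = 0
  norm : S.HasAvg (S.sqNorm v)
  fisher : S.HasAvg (S.fisherTerm v)
  prior : S.HasAvg (S.priorTerm v)

/-- The fields `v` for which the bound is defined: `⟨𝖠⟩` exists and the denominator is positive. -/
structure IsAdmissible (v : Fin q → (θ : M) → TangentSpace I θ) : Prop where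
  field : S.IsField v
  pairing : S.HasAvg (contract v S.u)
  information : 0 < S.information v

/-- The domain of `L`: the outer derivative in `L` exists and is continuous in the interior. -/
structure InDomain (v : Fin q → (θ : M) → TangentSpace I θ) : Prop where
  field : S.IsField v
  c1 : ∀ j, ContMDiffOn I 𝓘(ℝ, ℝ) 1 (S.raisedScore v j) (I.interior M)

/-- `w` is a value of `L⁻¹ u` (unique up to the kernel of `L`), and `⟨u, L⁻¹ u⟩_ρ` exists. -/
structure IsInverse (w : Fin q → (θ : M) → TangentSpace I θ) : Prop where
  domain : S.InDomain w
  eq : ∀ j, ∀ θ ∈ I.interior M, S.L w j θ = S.u j θ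
  pairing : S.HasAvg (contract w S.u)

end BayesProblem

end GillLevit

end

set_option linter.unusedSectionVars false

noncomputable section

namespace GillLevit

/-! ### Coordinate frames and the metric determinant -/

section
variable {p : ℕ} {H : Type*} [TopologicalSpace H]
  (I : ModelWithCorners ℝ (EuclideanSpace ℝ (Fin p)) H)
  {M : Type*} [TopologicalSpace M] [ChartedSpace H M] [IsManifold I ∞ M]

/-! Let $Q(v,w)=n\langle\gamma^{jk}v_j^aF_{ab}w_k^b\rangle+\langle\gamma^{jk}s_j(v)s_k(w)\rangle$
with $s_j(v)=\frac1\rho\nabla_a(\rho v_j^a)$; this is `informationPair`, a symmetric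
positive-semidefinite form on fields whose quadratic form is the denominator of the bound.
Everything rests on one integration by parts, $\langle v,Lw\rangle_\rho=Q(v,w)$, valid for every
field $v$ and every $w$ in the domain of $L$ as soon as the left side exists (`pairing_L_eq`).
Self-adjointness and positivity of $L$ are then symmetry and positivity of $Q$.

If $Lw=u$, then $\langle v,u\rangle_\rho=Q(v,w)$ and $\langle w,u\rangle_\rho=Q(w,w)$, so the bound
at $v$ is $Q(v,w)^2/Q(v,v)$, and Cauchy-Schwarz gives the maximum $Q(w,w)$. Here $Q(w,w)>0$: a field
with $Q=0$ has, by continuity and $\rho>0$, vanishing scores and vanishing Fisher contraction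
throughout the interior, so that $Lw$ would be zero while $u$ is not. For the same reason a case of
equality, $Q(v-tw,v-tw)=0$, forces $L(v/t)=u$, so $v/t$ is itself a value of $L^{-1}u$.

The analytic work is in the integration by parts. The difference of its two sides is the integral of
the divergence of the flux $X=\gamma^{jk}s_k(w)\,\rho v_j$ (`divergence_flux`). The brackets need
not extend to the boundary, so $X$ need not vanish there and the classical divergence theorem does
not apply. Instead $\|X\|\le ab$, where $a^2=\gamma^{jk}s_j(w)s_k(w)\rho$ is integrable and
$b^2=\rho\,\gamma^{jk}g_{ab}v_j^av_k^b$. The factor $\rho v$ in $b^2$ is $C^1$ and zero on the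
boundary, so $b^2=O(\delta)$ locally, with $\delta$ the distance to the boundary. A cutoff of slope
$k$ in a strip of width of order $1/k$ costs at most $k(\int a^2)^{1/2}(\int b^2)^{1/2}$ over the
strip. There $\int b^2=O(k^{-2})$ and $\int a^2\to0$, so the cost tends to zero
(`integral_mul_flatDivergence`). The bound on the volume of the strip uses only the convexity of the
model range, which also covers corners.

At infinity, completeness supplies compactly supported cutoffs with Lipschitz constant tending to
zero, and $\|X\|$ is integrable; hence $\int\nabla_aX^a=0$ (`IsStokesField.integral_divergence`).
The passage between charts needs two facts: the densities $\sqrt{|g|}$ define one measure, and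
$\sqrt{|g|}\,\nabla_aX^a=\partial_a(\sqrt{|g|}X^a)$ holds in every chart, although `divergence` uses
at each point only the preferred chart of that point. -/

theorem sum_coordComp_smul_coordVec (x : M) (X : (θ : M) → TangentSpace I θ)
    {y : EuclideanSpace ℝ (Fin p)} (hy : y ∈ (extChartAt I x).target) :
    ∑ a, coordComp I x X a y • coordVec I x a y = X ((extChartAt I x).symm y) := by
  have h := mfderivWithin_extChartAt_symm_comp_mfderiv_extChartAt (I := I) (x := x) hy
  have h2 := DFunLike.congr_fun h (X ((extChartAt I x).symm y))
  set Y : EuclideanSpace ℝ (Fin p) := mfderiv I 𝓘(ℝ, EuclideanSpace ℝ (Fin p)) (extChartAt I x) ((extChartAt I x).symm y)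
      (X ((extChartAt I x).symm y)) with hY
  have h3 : Y = ∑ a, Y a • EuclideanSpace.single a (1:ℝ) := by
    have := (EuclideanSpace.basisFun (Fin p) ℝ).sum_repr Y
    simpa using this.symm
  refine Eq.trans ?_ h2
  refine Eq.trans ?_ (congrArg (fun Y : EuclideanSpace ℝ (Fin p) => mfderivWithin 𝓘(ℝ, EuclideanSpace ℝ (Fin p)) I (extChartAt I x).symm (range I) y Y) h3.symm)
  refine Eq.trans ?_ (map_sum (mfderivWithin 𝓘(ℝ, EuclideanSpace ℝ (Fin p)) I (extChartAt I x).symm (range I) y) _ _).symm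
  exact Finset.sum_congr rfl fun a _ => (map_smul (mfderivWithin 𝓘(ℝ, EuclideanSpace ℝ (Fin p)) I (extChartAt I x).symm (range I) y) _ _).symm

/-- The coordinate vectors are the local frame that the tangent bundle trivialization at `x` induces
from the standard basis, and such a frame is smooth. Smoothness of the Gram matrix and of its
determinant follows. -/
theorem contMDiffOn_coordVec (x : M) (a : Fin p) :
  ContMDiffOn 𝓘(ℝ, EuclideanSpace ℝ (Fin p)) I.tangent ∞
    (fun y => (⟨(extChartAt I x).symm y, coordVec I x a y⟩ : TangentBundle I M)) (extChartAt I x).target := by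
  set e := trivializationAt (EuclideanSpace ℝ (Fin p)) (TangentSpace I) x
  have h1 := e.contMDiffOn_localFrame_baseSet (I := I) (n := ∞) (EuclideanSpace.basisFun (Fin p) ℝ).toBasis a
  have h2 := (contMDiffOn_extChartAt_symm (I := I) (n := ∞) x)
  refine (h1.comp h2 ?_).congr ?_
  · intro y hy
    have := (extChartAt I x).map_target hy
    simpa [e] using this
  · intro y hy
    have hs : (extChartAt I x).symm y ∈ (chartAt H x).source := by
      have := (extChartAt I x).map_target hy
      simpa using this
    have hb : (extChartAt I x).symm y ∈ e.baseSet := by simpa [e] using hs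
    simp only [Function.comp_apply]
    rw [e.localFrame_apply_of_mem_baseSet _ hb]
    congr 1
    have h3 := DFunLike.congr_fun (TangentBundle.symmL_trivializationAt (I := I) (𝕜 := ℝ) hs) (EuclideanSpace.single a 1)
    rw [(extChartAt I x).right_inv hy] at h3
    refine Eq.trans h3.symm ?_
    rw [Trivialization.basisAt, Module.Basis.map_apply, OrthonormalBasis.coe_toBasis,
      EuclideanSpace.basisFun_apply]
    exact (e.symmL_apply hb _).trans rfl

theorem linearIndependent_coordVec (x : M) {y : EuclideanSpace ℝ (Fin p)} (hy : y ∈ (extChartAt I x).target) :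
    LinearIndependent ℝ (fun a => coordVec I x a y) := by
  have h := isInvertible_mfderivWithin_extChartAt_symm (I := I) (x := x) hy
  rw [Fintype.linearIndependent_iff]
  intro c hc
  have h3 : (mfderivWithin 𝓘(ℝ, EuclideanSpace ℝ (Fin p)) I (extChartAt I x).symm (range I) y)
      (∑ a, c a • EuclideanSpace.single a (1 : ℝ) : EuclideanSpace ℝ (Fin p)) = 0 := by
    refine Eq.trans (map_sum (mfderivWithin 𝓘(ℝ, EuclideanSpace ℝ (Fin p)) I
      (extChartAt I x).symm (range I) y) _ _) (Eq.trans ?_ hc)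
    exact Finset.sum_congr rfl fun a _ => map_smul (mfderivWithin 𝓘(ℝ, EuclideanSpace ℝ (Fin p)) I
      (extChartAt I x).symm (range I) y) _ _
  have h4 : (∑ a, c a • EuclideanSpace.single a (1 : ℝ) : EuclideanSpace ℝ (Fin p)) = 0 :=
    h.injective (h3.trans (map_zero _).symm)
  intro i
  simpa [Finset.sum_apply, Pi.single_apply] using congrArg (fun v : EuclideanSpace ℝ (Fin p) => v i) h4

theorem contDiffWithinAt_coordComp (x : M) {X : (θ : M) → TangentSpace I θ} {s : Set M}
    {y : EuclideanSpace ℝ (Fin p)} (hy : y ∈ (extChartAt I x).target)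
    (hX : ContMDiffWithinAt I I.tangent 1 (fun θ => (⟨θ, X θ⟩ : TangentBundle I M)) s ((extChartAt I x).symm y)) (a : Fin p) :
    ContDiffWithinAt ℝ 1 (coordComp I x X a) ((extChartAt I x).target ∩ (extChartAt I x).symm ⁻¹' s) y := by
  set e := trivializationAt (EuclideanSpace ℝ (Fin p)) (TangentSpace I) x
  have hs : (extChartAt I x).symm y ∈ (chartAt H x).source := by
      have := (extChartAt I x).map_target hy
      simpa using this
  have hb : (extChartAt I x).symm y ∈ e.baseSet := by simpa [e] using hs
  have h1 := (Bundle.Trivialization.contMDiffWithinAt_section (e := e) (IB := I) s hb).1 hX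
  have h2 := (contMDiffOn_extChartAt_symm (I := I) (n := 1) x y hy).mono
    (inter_subset_left (t := (extChartAt I x).symm ⁻¹' s))
  have h3 := h1.comp y h2 inter_subset_right
  rw [contMDiffWithinAt_iff_contDiffWithinAt] at h3
  have h4 : ContDiffWithinAt ℝ 1 (fun z => (EuclideanSpace.proj a : EuclideanSpace ℝ (Fin p) →L[ℝ] ℝ)
    (((fun x ↦ (e ⟨x, X x⟩).2) ∘ (extChartAt I x).symm) z)) ((extChartAt I x).target ∩ (extChartAt I x).symm ⁻¹' s) y :=
    (EuclideanSpace.proj a : EuclideanSpace ℝ (Fin p) →L[ℝ] ℝ).contDiff.contDiffAt.comp_contDiffWithinAt y h3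
  have key : ∀ z ∈ (extChartAt I x).target, coordComp I x X a z = (EuclideanSpace.proj a : EuclideanSpace ℝ (Fin p) →L[ℝ] ℝ)
    (((fun x ↦ (e ⟨x, X x⟩).2) ∘ (extChartAt I x).symm) z) := by
    intro z hz
    have hs : (extChartAt I x).symm z ∈ (chartAt H x).source := by
      have := (extChartAt I x).map_target hz
      simpa using this
    have hb : (extChartAt I x).symm z ∈ e.baseSet := by simpa [e] using hs
    have h5 := DFunLike.congr_fun (TangentBundle.continuousLinearMapAt_trivializationAt (I := I) (𝕜 := ℝ) hs) (X ((extChartAt I x).symm z))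
    have h6 := e.continuousLinearMapAt_apply_of_mem (R := ℝ) hb (X ((extChartAt I x).symm z))
    refine congrArg (fun v : EuclideanSpace ℝ (Fin p) => v a) (h5.symm.trans h6)
  exact h4.congr (fun z hz => key z hz.1) (key y hy)

/-- The derivative at `θ` of the preferred chart at `x`, with values in the model space. -/
def chartDeriv (x θ : M) : TangentSpace I θ →L[ℝ] EuclideanSpace ℝ (Fin p) :=
  mfderiv I 𝓘(ℝ, EuclideanSpace ℝ (Fin p)) (extChartAt I x) θ

theorem coordComp_eq (x : M) (X : (θ : M) → TangentSpace I θ) (a : Fin p)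
    (y : EuclideanSpace ℝ (Fin p)) :
    coordComp I x X a y = chartDeriv I x ((extChartAt I x).symm y) (X ((extChartAt I x).symm y)) a :=
  rfl

theorem clm_det_eq (A : EuclideanSpace ℝ (Fin p) →L[ℝ] EuclideanSpace ℝ (Fin p)) :
    A.det = (Matrix.of fun c a => A (EuclideanSpace.single a 1) c).det := by
  rw [ContinuousLinearMap.det, ← LinearMap.det_toMatrix (EuclideanSpace.basisFun (Fin p) ℝ).toBasis]
  congr 1

/-- The change of coordinates from the preferred chart at `x` to that at `x'`. -/
def transition (x x' : M) : EuclideanSpace ℝ (Fin p) → EuclideanSpace ℝ (Fin p) :=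
  extChartAt I x' ∘ (extChartAt I x).symm

theorem chartDeriv_coordVec {x x' : M} {y : EuclideanSpace ℝ (Fin p)} (hy : y ∈ (extChartAt I x).target)
    (hy' : (extChartAt I x).symm y ∈ (extChartAt I x').source) (a : Fin p) :
    chartDeriv I x' ((extChartAt I x).symm y) (coordVec I x a y) =
       fderivWithin ℝ (transition I x x') (range I) y (EuclideanSpace.single a 1) := by
  have U : UniqueMDiffWithinAt 𝓘(ℝ, EuclideanSpace ℝ (Fin p)) (range I) y := by
    rw [uniqueMDiffWithinAt_iff_uniqueDiffWithinAt]
    exact I.uniqueDiffOn _ (extChartAt_target_subset_range x hy)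
  have h1 : MDifferentiableAt I 𝓘(ℝ, EuclideanSpace ℝ (Fin p)) (extChartAt I x') ((extChartAt I x).symm y) :=
    mdifferentiableAt_extChartAt (by simpa using hy')
  have := mfderiv_comp_mfderivWithin (I := 𝓘(ℝ, EuclideanSpace ℝ (Fin p))) (I' := I) y h1 (mdifferentiableWithinAt_extChartAt_symm hy) U
  have h2 := DFunLike.congr_fun this (EuclideanSpace.single a 1 : EuclideanSpace ℝ (Fin p))
  rw [mfderivWithin_eq_fderivWithin] at h2
  exact h2.symm

variable [RiemannianBundle (fun θ : M => TangentSpace I θ)]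
  [IsContMDiffRiemannianBundle I ∞ (EuclideanSpace ℝ (Fin p)) (fun θ : M => TangentSpace I θ)]

theorem inner_eq_sum_gram (x : M) (X Y : (θ : M) → TangentSpace I θ)
    {y : EuclideanSpace ℝ (Fin p)} (hy : y ∈ (extChartAt I x).target) :
    inner ℝ (X ((extChartAt I x).symm y)) (Y ((extChartAt I x).symm y)) =
      ∑ a, ∑ b, gram I x y a b * coordComp I x X a y * coordComp I x Y b y := by
  rw [← sum_coordComp_smul_coordVec I x X hy, ← sum_coordComp_smul_coordVec I x Y hy, sum_inner]
  refine Finset.sum_congr rfl fun a _ => ?_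
  rw [inner_sum]
  refine Finset.sum_congr rfl fun b _ => ?_
  rw [real_inner_smul_left, real_inner_smul_right, gram, Matrix.of_apply]
  ring

theorem contDiffOn_gram (x : M) (a b : Fin p) :
    ContDiffOn ℝ ∞ (fun y => gram I x y a b) (extChartAt I x).target := by
  rw [← contMDiffOn_iff_contDiffOn]
  intro y hy
  exact ContMDiffWithinAt.inner_bundle (contMDiffOn_coordVec I x a y hy) (contMDiffOn_coordVec I x b y hy)

theorem gram_posDef (x : M) {y : EuclideanSpace ℝ (Fin p)} (hy : y ∈ (extChartAt I x).target) :
    (gram I x y).PosDef := by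
  exact Matrix.posDef_gram_of_linearIndependent (𝕜 := ℝ) (linearIndependent_coordVec I x hy)

theorem sqrtDetMetric_pos (x : M) {y : EuclideanSpace ℝ (Fin p)} (hy : y ∈ (extChartAt I x).target) :
    0 < sqrtDetMetric I x y := Real.sqrt_pos.2 (gram_posDef I x hy).det_pos

theorem contDiffOn_sqrtDetMetric (x : M) :
    ContDiffOn ℝ ∞ (sqrtDetMetric I x) (extChartAt I x).target := by
  have : ContDiffOn ℝ ∞ (fun y => (gram I x y).det) (extChartAt I x).target := by
    simp only [Matrix.det_apply]
    refine ContDiffOn.sum fun σ _ => ContDiffOn.const_smul _ ?_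
    exact contDiffOn_prod fun i _ => contDiffOn_gram I x _ _
  exact this.sqrt fun y hy => (gram_posDef I x hy).det_pos.ne'

theorem inner_eq_sum_gram_chart (x : M) {θ : M} (hθ : θ ∈ (extChartAt I x).source) (V W : TangentSpace I θ) :
    inner ℝ V W = ∑ a, ∑ b, gram I x (extChartAt I x θ) a b *
      chartDeriv I x θ V a * chartDeriv I x θ W b := by
  obtain ⟨y, hy, rfl⟩ : ∃ y ∈ (extChartAt I x).target, (extChartAt I x).symm y = θ :=
    ⟨_, (extChartAt I x).map_source hθ, (extChartAt I x).left_inv hθ⟩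
  rw [(extChartAt I x).right_inv hy]
  exact inner_eq_sum_gram I x (fun _ => V) (fun _ => W) hy

/-- With $J$ the Jacobian matrix of the transition map, $g=J^{\mathsf T}g'J$; take determinants and
square roots. -/
theorem sqrtDetMetric_transition {x x' : M} {y : EuclideanSpace ℝ (Fin p)} (hy : y ∈ (extChartAt I x).target)
    (hy' : (extChartAt I x).symm y ∈ (extChartAt I x').source) :
    sqrtDetMetric I x y = |(fderivWithin ℝ (transition I x x') (range I) y).det| *
      sqrtDetMetric I x' (transition I x x' y) := by
  set A := fderivWithin ℝ (transition I x x') (range I) y with hA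
  set J : Matrix (Fin p) (Fin p) ℝ := Matrix.of fun c a => A (EuclideanSpace.single a 1) c
  have hg : gram I x y = J.transpose * gram I x' (transition I x x' y) * J := by
    ext a b
    have h := inner_eq_sum_gram_chart I x' hy' (coordVec I x a y) (coordVec I x b y)
    rw [gram, Matrix.of_apply, h, chartDeriv_coordVec I hy hy', chartDeriv_coordVec I hy hy']
    simp only [Matrix.mul_apply, Matrix.transpose_apply, Finset.sum_mul]
    rw [Finset.sum_comm]
    refine Finset.sum_congr rfl fun c _ => Finset.sum_congr rfl fun d _ => ?_
    simp only [J, Matrix.of_apply, ← hA]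
    rw [transition, Function.comp_apply]
    ring
  rw [sqrtDetMetric, hg, Matrix.det_mul, Matrix.det_mul, Matrix.det_transpose, clm_det_eq, sqrtDetMetric,
    ← Real.sqrt_sq_eq_abs, ← Real.sqrt_mul (sq_nonneg _)]
  congr 1
  ring

end

/-! ### The Riemannian volume in charts -/

section
variable {p : ℕ} {H : Type*} [TopologicalSpace H]
  (I : ModelWithCorners ℝ (EuclideanSpace ℝ (Fin p)) H)
  {M : Type*} [TopologicalSpace M] [ChartedSpace H M] [IsManifold I ∞ M]

theorem measurableSet_extChartAt_target (x : M) : MeasurableSet (extChartAt I x).target := by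
  rw [extChartAt_target]
  exact ((chartAt H x).open_target.preimage I.continuous_symm).measurableSet.inter
    I.isClosed_range.measurableSet

theorem interior_extChartAt_target (x : M) :
    interior (extChartAt I x).target = (extChartAt I x).target ∩ interior (range I) := by
  rw [extChartAt_target, interior_inter,
    ((chartAt H x).open_target.preimage I.continuous_symm).interior_eq, inter_assoc,
    inter_eq_right.2 interior_subset]

theorem mem_interior_target_iff (x : M) {y : EuclideanSpace ℝ (Fin p)}
    (hy : y ∈ (extChartAt I x).target) :
    y ∈ interior (extChartAt I x).target ↔ (extChartAt I x).symm y ∈ I.interior M := by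
  have hs : (extChartAt I x).symm y ∈ (chartAt H x).source := by
    simpa using (extChartAt I x).map_target hy
  have := I.isInteriorPoint_iff_of_mem_atlas (n := ∞) (by simp) (chart_mem_atlas H x) hs
  change I.IsInteriorPoint _ ↔ extChartAt I x _ ∈ interior (extChartAt I x).target at this
  rw [(extChartAt I x).right_inv hy] at this
  exact this.symm

theorem mem_interior_iff_mem_interior_target (x : M) {θ : M} (hθ : θ ∈ (extChartAt I x).source) :
    θ ∈ I.interior M ↔ extChartAt I x θ ∈ interior (extChartAt I x).target := by
  rw [mem_interior_target_iff I x ((extChartAt I x).map_source hθ), (extChartAt I x).left_inv hθ]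

/-- The non-interior points of the target lie on the frontier of the model range, which is convex,
and the frontier of a convex set is null. -/
theorem volume_target_diff_interior (x : M) :
    volume ((extChartAt I x).target \ interior (extChartAt I x).target) = 0 := by
  refine measure_mono_null ?_ (I.convex_range.addHaar_frontier volume)
  rintro y ⟨h1, h2⟩
  rw [interior_extChartAt_target] at h2
  exact ⟨subset_closure (extChartAt_target_subset_range x h1), fun h => h2 ⟨h1, h⟩⟩

theorem contDiffWithinAt_transition {x x' : M} {y : EuclideanSpace ℝ (Fin p)}
    (hy : y ∈ (extChartAt I x).target) (hy' : (extChartAt I x).symm y ∈ (extChartAt I x').source) :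
    ContDiffWithinAt ℝ ∞ (transition I x x') (range I) y := by
  refine contDiffWithinAt_ext_coord_change (I := I) (n := ∞) x' x ?_
  exact ⟨hy, hy'⟩

theorem secondCountableTopology_of_model (M : Type*) [TopologicalSpace M] [ChartedSpace H M]
    [SigmaCompactSpace M] (I : ModelWithCorners ℝ (EuclideanSpace ℝ (Fin p)) H) :
    SecondCountableTopology M := by
  have := I.secondCountableTopology
  exact ChartedSpace.secondCountable_of_sigmaCompact H M

section Measure
variable [T2Space M] [SigmaCompactSpace M] [MeasurableSpace M] [BorelSpace M]

/-- Lusin-Souslin: an injective measurable map from a standard Borel space, here the Borel set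
`target`, is a measurable embedding. -/
theorem measurableEmbedding_symm (x : M) :
    MeasurableEmbedding (fun y : (extChartAt I x).target => (extChartAt I x).symm y) := by
  have := secondCountableTopology_of_model M I
  have : StandardBorelSpace (extChartAt I x).target := (measurableSet_extChartAt_target I x).standardBorel
  refine Measurable.measurableEmbedding ?_ ?_
  · exact (continuousOn_extChartAt_symm x).domRestrict.measurable
  · intro y z h
    exact Subtype.ext ((extChartAt I x).symm.injOn y.2 z.2 h)

theorem aemeasurable_symm (x : M) (μ : Measure (EuclideanSpace ℝ (Fin p))) :
    AEMeasurable (extChartAt I x).symm (μ.restrict (extChartAt I x).target) :=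
  (continuousOn_extChartAt_symm x).aemeasurable (measurableSet_extChartAt_target I x)

theorem measurableSet_inter_preimage_symm (x : M) {B : Set M} (hB : MeasurableSet B) :
    MeasurableSet ((extChartAt I x).target ∩ (extChartAt I x).symm ⁻¹' B) := by
  have h1 : Measurable (fun y : (extChartAt I x).target => (extChartAt I x).symm y) :=
    (continuousOn_extChartAt_symm x).domRestrict.measurable
  have := (measurableSet_extChartAt_target I x).subtype_image (h1 hB)
  convert this using 1
  ext y
  simp only [mem_inter_iff, mem_preimage, mem_image, Subtype.exists, exists_and_left, exists_prop,
    exists_eq_right_right]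
  tauto

variable [RiemannianBundle (fun θ : M => TangentSpace I θ)]
  [IsContMDiffRiemannianBundle I ∞ (EuclideanSpace ℝ (Fin p)) (fun θ : M => TangentSpace I θ)]

theorem chartVolume_apply (x : M) {B : Set M} (hB : MeasurableSet B) :
    chartVolume I x B = ∫⁻ y in (extChartAt I x).target ∩ (extChartAt I x).symm ⁻¹' B,
      ENNReal.ofReal (sqrtDetMetric I x y) := by
  have hm : AEMeasurable (extChartAt I x).symm ((volume.restrict (extChartAt I x).target).withDensity
    fun y => ENNReal.ofReal (sqrtDetMetric I x y)) :=
    (aemeasurable_symm I x volume).mono_ac (withDensity_absolutelyContinuous _ _)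
  rw [chartVolume, Measure.map_apply_of_aemeasurable hm hB, withDensity_apply',
    Measure.restrict_restrict' (measurableSet_extChartAt_target I x), inter_comm]

/-- The change of variables formula for the transition map, whose Jacobian determinant is absorbed
by the two densities. -/
theorem chartVolume_eq_of_subset (x x' : M) {B : Set M} (hB : MeasurableSet B)
    (h : B ⊆ (extChartAt I x).source) (h' : B ⊆ (extChartAt I x').source) :
    chartVolume I x' B = chartVolume I x B := by
  rw [chartVolume_apply I x hB, chartVolume_apply I x' hB]
  set s := (extChartAt I x).target ∩ (extChartAt I x).symm ⁻¹' B with hs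
  have himg : (extChartAt I x').target ∩ (extChartAt I x').symm ⁻¹' B = transition I x x' '' s := by
    ext z
    constructor
    · rintro ⟨hz, hzB⟩
      refine ⟨transition I x' x z, ⟨(extChartAt I x).map_source (h hzB), ?_⟩, ?_⟩
      · simp only [transition, Function.comp_apply, mem_preimage]
        rwa [(extChartAt I x).left_inv (h hzB)]
      · simp only [transition, Function.comp_apply]
        rw [(extChartAt I x).left_inv (h hzB), (extChartAt I x').right_inv hz]
    · rintro ⟨y, ⟨hy, hyB⟩, rfl⟩
      refine ⟨(extChartAt I x').map_source (h' hyB), ?_⟩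
      simp only [transition, Function.comp_apply, mem_preimage]
      rw [(extChartAt I x').left_inv (h' hyB)]
      exact hyB
  have hinj : InjOn (transition I x x') s := by
    intro y hy z hz hyz
    have := (extChartAt I x').injOn (h' hy.2) (h' hz.2) hyz
    exact (extChartAt I x).symm.injOn hy.1 hz.1 this
  have hd : ∀ y ∈ s, HasFDerivWithinAt (transition I x x')
      (fderivWithin ℝ (transition I x x') (range I) y) s y := fun y hy =>
    (((contDiffWithinAt_transition I hy.1 (h' hy.2)).differentiableWithinAt (by simp)).hasFDerivWithinAt).mono
      (inter_subset_left.trans (extChartAt_target_subset_range x))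
  rw [himg, lintegral_image_eq_lintegral_abs_det_fderiv_mul volume
    (measurableSet_inter_preimage_symm I x hB) hd hinj]
  refine setLIntegral_congr_fun (measurableSet_inter_preimage_symm I x hB) fun y hy => ?_
  rw [← ENNReal.ofReal_mul (abs_nonneg _), sqrtDetMetric_transition I hy.1 (h' hy.2)]

theorem chartVolume_compl_source (x : M) : chartVolume I x (extChartAt I x).sourceᶜ = 0 := by
  rw [chartVolume_apply I x (isOpen_extChartAt_source x).measurableSet.compl]
  convert setLIntegral_empty _
  ext y
  simp only [mem_inter_iff, mem_preimage, mem_compl_iff, mem_empty_iff_false, iff_false, not_and, not_not]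
  exact fun hy => (extChartAt I x).map_target hy

theorem chartVolume_inter_source (x : M) {B : Set M} :
    chartVolume I x (B ∩ (extChartAt I x).source) = chartVolume I x B :=
  measure_inter_conull (chartVolume_compl_source I x)

/-- A supremum of measures is awkward to evaluate, so a competitor `N` is glued from the chart
measures on disjoint pieces of a countable cover by chart domains. By agreement on overlaps, `N`
coincides with each chart measure on the domain of that chart. Hence `N` dominates every chart
measure and so their supremum, and on a chart domain the supremum is squeezed between the chart
measure and `N`. -/
theorem riemannianVolume_restrict_source (x : M) :
    (riemannianVolume I).restrict (extChartAt I x).source = chartVolume I x := by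
  have := secondCountableTopology_of_model M I
  obtain ⟨t, htc, ht⟩ := TopologicalSpace.countable_cover_nhds
    (fun z : M => extChartAt_source_mem_nhds (I := I) z)
  have hne : t.Nonempty := by
    by_contra h
    rw [not_nonempty_iff_eq_empty.1 h] at ht
    simp at ht
    exact (ht.symm ▸ mem_univ x : x ∈ (∅ : Set M))
  obtain ⟨u, rfl⟩ := htc.exists_eq_range hne
  rw [biUnion_range] at ht
  have hsm : ∀ z : M, MeasurableSet (extChartAt I z).source := fun z =>
    (isOpen_extChartAt_source z).measurableSet
  set A : ℕ → Set M := disjointed fun i => (extChartAt I (u i)).source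
  have hA : ∀ i, MeasurableSet (A i) := fun i => MeasurableSet.disjointed (fun i => hsm (u i)) i
  have hAs : ∀ i, A i ⊆ (extChartAt I (u i)).source := fun i => disjointed_subset _ i
  have hAd : Pairwise (Function.onFun Disjoint A) := disjoint_disjointed _
  have hAu : ⋃ i, A i = univ := by rw [iUnion_disjointed, ht]
  set N : Measure M := Measure.sum fun i => (chartVolume I (u i)).restrict (A i)
  have key : ∀ (z : M) (B : Set M), MeasurableSet B →
      N (B ∩ (extChartAt I z).source) = chartVolume I z B := by
    intro z B hB
    have hBz := hB.inter (hsm z)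
    rw [← chartVolume_inter_source I z, Measure.sum_apply _ hBz]
    have : chartVolume I z (B ∩ (extChartAt I z).source) =
        ∑' i, chartVolume I z (B ∩ (extChartAt I z).source ∩ A i) := by
      rw [← measure_iUnion, ← inter_iUnion, hAu, inter_univ]
      · exact fun i j hij => (hAd hij).mono inter_subset_right inter_subset_right
      · exact fun i => hBz.inter (hA i)
    rw [this]
    refine tsum_congr fun i => ?_
    rw [Measure.restrict_apply hBz]
    exact chartVolume_eq_of_subset I z (u i) (hBz.inter (hA i))
      (inter_subset_left.trans inter_subset_right) (inter_subset_right.trans (hAs i))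
  have hle : riemannianVolume I ≤ N := by
    refine iSup_le fun z => Measure.le_iff.2 fun B hB => ?_
    rw [← key z B hB]
    exact measure_mono inter_subset_left
  ext B hB
  rw [Measure.restrict_apply hB]
  refine le_antisymm ((hle _).trans_eq (key x B hB)) ?_
  rw [← chartVolume_inter_source]
  exact (le_iSup (fun z => chartVolume I z) x : chartVolume I x ≤ riemannianVolume I) _

theorem aemeasurable_ofReal_sqrtDetMetric (x : M) :
    AEMeasurable (fun y => ENNReal.ofReal (sqrtDetMetric I x y))
      (volume.restrict (extChartAt I x).target) :=
  ((contDiffOn_sqrtDetMetric I x).continuousOn.aemeasurable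
    (measurableSet_extChartAt_target I x)).ennreal_ofReal

/-- The inverse chart is a measurable embedding only as a map on the subtype `target`. Factoring
through the subtype permits the transfer of integrals without any measurability assumption on the
integrand. -/
theorem chartVolume_eq_map (x : M) :
    chartVolume I x = Measure.map (fun y : (extChartAt I x).target => (extChartAt I x).symm y)
      (Measure.comap Subtype.val ((volume.restrict (extChartAt I x).target).withDensity
        fun y => ENNReal.ofReal (sqrtDetMetric I x y))) := by
  set ν := (volume.restrict (extChartAt I x).target).withDensity
    fun y => ENNReal.ofReal (sqrtDetMetric I x y) with hν
  have hT := measurableSet_extChartAt_target I x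
  have hr : ν.restrict (extChartAt I x).target = ν := by
    rw [hν, restrict_withDensity hT, Measure.restrict_restrict hT, inter_self]
  have hm : AEMeasurable (extChartAt I x).symm ν :=
    (aemeasurable_symm I x volume).mono_ac (withDensity_absolutelyContinuous _ _)
  have h1 : Measure.map Subtype.val (Measure.comap (Subtype.val : (extChartAt I x).target → _) ν) = ν := by
    rw [(MeasurableEmbedding.subtype_coe hT).map_comap, Subtype.range_coe, hr]
  rw [chartVolume, ← hν]
  conv_lhs => rw [← h1]
  rw [AEMeasurable.map_map_of_aemeasurable (by rwa [h1]) measurable_subtype_coe.aemeasurable]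
  rfl

theorem integrableOn_source_iff (x : M) (f : M → ℝ) :
    IntegrableOn f (extChartAt I x).source (riemannianVolume I) ↔
      IntegrableOn (fun y => sqrtDetMetric I x y * f ((extChartAt I x).symm y))
        (extChartAt I x).target := by
  have hT := measurableSet_extChartAt_target I x
  rw [IntegrableOn, riemannianVolume_restrict_source, chartVolume_eq_map,
    (measurableEmbedding_symm I x).integrable_map_iff]
  change Integrable ((fun y => f ((extChartAt I x).symm y)) ∘ Subtype.val) _ ↔ _
  rw [← (MeasurableEmbedding.subtype_coe hT).integrable_map_iff,
    (MeasurableEmbedding.subtype_coe hT).map_comap, Subtype.range_coe,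
    restrict_withDensity hT, Measure.restrict_restrict hT, inter_self,
    integrable_withDensity_iff_integrable_smul₀' (aemeasurable_ofReal_sqrtDetMetric I x) (by simp)]
  refine integrable_congr ?_
  filter_upwards [ae_restrict_mem hT] with y hy
  rw [ENNReal.toReal_ofReal (sqrtDetMetric_pos I x hy).le, smul_eq_mul]

theorem setIntegral_source (x : M) (f : M → ℝ) :
    ∫ θ in (extChartAt I x).source, f θ ∂(riemannianVolume I) =
      ∫ y in (extChartAt I x).target, sqrtDetMetric I x y * f ((extChartAt I x).symm y) := by
  have hT := measurableSet_extChartAt_target I x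
  rw [riemannianVolume_restrict_source, chartVolume_eq_map,
    (measurableEmbedding_symm I x).integral_map]
  have := (MeasurableEmbedding.subtype_coe hT).integral_map (μ := (Measure.comap Subtype.val
    ((volume.restrict (extChartAt I x).target).withDensity
        fun y => ENNReal.ofReal (sqrtDetMetric I x y)))) (fun y => f ((extChartAt I x).symm y))
  rw [← this, (MeasurableEmbedding.subtype_coe hT).map_comap, Subtype.range_coe,
    restrict_withDensity hT, Measure.restrict_restrict hT, inter_self,
    integral_withDensity_eq_integral_toReal_smul₀ (aemeasurable_ofReal_sqrtDetMetric I x) (by simp)]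
  refine setIntegral_congr_fun hT fun y hy => ?_
  simp only [ENNReal.toReal_ofReal (sqrtDetMetric_pos I x hy).le, smul_eq_mul]

theorem riemannianVolume_null_iff (x : M) {B : Set M} (hB : MeasurableSet B)
    (hBs : B ⊆ (extChartAt I x).source) :
    riemannianVolume I B = 0 ↔
      volume ((extChartAt I x).target ∩ (extChartAt I x).symm ⁻¹' B) = 0 := by
  have h1 : riemannianVolume I B = chartVolume I x B := by
    rw [← riemannianVolume_restrict_source, Measure.restrict_apply hB, inter_eq_left.2 hBs]
  have hm := measurableSet_inter_preimage_symm I x hB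
  rw [h1, chartVolume_apply I x hB, lintegral_eq_zero_iff' (((aemeasurable_ofReal_sqrtDetMetric I x).mono_measure
    (Measure.restrict_mono inter_subset_left le_rfl)))]
  rw [Filter.EventuallyEq, ae_restrict_iff' hm]
  rw [measure_eq_zero_iff_ae_notMem]
  refine ⟨fun h => ?_, fun h => ?_⟩
  · filter_upwards [h] with y hy hyB
    have := hy hyB
    simp only [Pi.zero_apply, ENNReal.ofReal_eq_zero] at this
    exact absurd this (not_le.2 (sqrtDetMetric_pos I x hyB.1))
  · filter_upwards [h] with y hy hyB
    exact absurd hyB hy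

theorem riemannianVolume_eq_zero_of_source {B : Set M}
    (h : ∀ x : M, riemannianVolume I (B ∩ (extChartAt I x).source) = 0) :
    riemannianVolume I B = 0 := by
  have := secondCountableTopology_of_model M I
  obtain ⟨t, htc, ht⟩ := TopologicalSpace.countable_cover_nhds
    (fun z : M => extChartAt_source_mem_nhds (I := I) z)
  have : B = ⋃ x ∈ t, B ∩ (extChartAt I x).source := by
    rw [← inter_iUnion₂, ht, inter_univ]
  rw [this, measure_biUnion_null_iff htc]
  exact fun x _ => h x

theorem riemannianVolume_boundary : riemannianVolume I (I.boundary M) = 0 := by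
  refine riemannianVolume_eq_zero_of_source I fun x => ?_
  have hb : MeasurableSet (I.boundary M) := (I.isClosed_boundary (n := ∞) (by simp)).measurableSet
  rw [riemannianVolume_null_iff I x (hb.inter (isOpen_extChartAt_source x).measurableSet) inter_subset_right]
  refine measure_mono_null ?_ (volume_target_diff_interior I x)
  rintro y ⟨hy, hyB, -⟩
  refine ⟨hy, fun h => ?_⟩
  rw [mem_interior_target_iff I x hy, ← I.compl_boundary] at h
  exact h hyB

theorem ae_mem_interior : ∀ᵐ θ ∂(riemannianVolume I), θ ∈ I.interior M := by
  rw [← I.compl_boundary]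
  exact measure_eq_zero_iff_ae_notMem.1 (riemannianVolume_boundary I)

/-- The volume charges every nonempty open subset of the interior. This later turns equalities
almost everywhere between continuous functions into equalities at every interior point. -/
theorem eq_empty_of_riemannianVolume_eq_zero {U : Set M} (hU : IsOpen U) (hUi : U ⊆ I.interior M)
    (h0 : riemannianVolume I U = 0) : U = ∅ := by
  by_contra hne
  obtain ⟨x, hx⟩ := nonempty_iff_ne_empty.2 hne
  have h1 : riemannianVolume I (U ∩ (extChartAt I x).source) = 0 := measure_mono_null inter_subset_left h0
  rw [riemannianVolume_null_iff I x (hU.inter (isOpen_extChartAt_source x)).measurableSet inter_subset_right] at h1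
  have hxi := (mem_interior_iff_mem_interior_target I x (mem_extChartAt_source x)).1 (hUi hx)
  have hV : IsOpen (interior (extChartAt I x).target ∩ (extChartAt I x).symm ⁻¹' U) :=
    ((continuousOn_extChartAt_symm x).mono interior_subset).isOpen_inter_preimage isOpen_interior hU
  refine (hV.measure_pos volume ⟨extChartAt I x x, hxi, ?_⟩).ne' (measure_mono_null ?_ h1)
  · simpa using hx
  · rintro y ⟨hy, hyU⟩
    exact ⟨interior_subset hy, hyU, (extChartAt I x).map_target (interior_subset hy)⟩

end Measure
end

/-! ### Jacobi's formula and the algebra of the Piola identity -/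

section

/-- Jacobi's formula. The product rule replaces one column at a time by its derivative, and Cramer's
rule expresses each determinant so obtained through the adjugate. -/
theorem hasFDerivAt_det {E : Type*} [NormedAddCommGroup E] [NormedSpace ℝ E] {ι : Type*} [Fintype ι]
    [DecidableEq ι] {N : E → Matrix ι ι ℝ} {N' : ι → ι → E →L[ℝ] ℝ} {y : E}
    (h : ∀ i j, HasFDerivAt (fun z => N z i j) (N' i j) y) :
    HasFDerivAt (fun z => (N z).det) (∑ i, ∑ j, (N y).adjugate j i • N' i j) y := by
  have h1 : HasFDerivAt (fun z => (N z).det) (∑ σ : Equiv.Perm ι, (Equiv.Perm.sign σ : ℤ) •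
      ∑ k, (∏ l ∈ Finset.univ.erase k, N y (σ l) l) • N' (σ k) k) y := by
    simp only [Matrix.det_apply]
    refine HasFDerivAt.fun_sum fun σ _ => ?_
    exact (HasFDerivAt.finsetProd fun k _ => h (σ k) k).const_smul _
  convert h1 using 1
  ext v
  simp only [sum_apply, smul_apply, smul_eq_mul, Finset.smul_sum]
  rw [Finset.sum_comm, Finset.sum_comm (s := (Finset.univ : Finset (Equiv.Perm ι)))]
  refine Finset.sum_congr rfl fun k _ => ?_
  have h2 : ∑ i, (N y).adjugate k i * N' i k v = ((N y).updateCol k fun i => N' i k v).det := by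
    rw [← Matrix.cramer_apply, Matrix.cramer_eq_adjugate_mulVec]
    rfl
  rw [h2, Matrix.det_apply]
  refine Finset.sum_congr rfl fun σ _ => ?_
  congr 1
  rw [← Finset.mul_prod_erase _ _ (Finset.mem_univ k), mul_comm]
  congr 1
  · refine Finset.prod_congr rfl fun l hl => ?_
    rw [Matrix.updateCol_ne (Finset.ne_of_mem_erase hl)]
  · simp

/-- The linear algebra behind the invariance of the divergence. Here `n` is a Jacobian matrix and
`dN` its derivative, symmetric as a second derivative (`hs`); `h1` is the derivative of the
transformation law `h3` of vector densities, `h2` is Jacobi's formula, and `σ` is the sign of the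
determinant. -/
theorem divergence_change_aux {ι : Type*} [Fintype ι] [DecidableEq ι] (n : Matrix ι ι ℝ) (hn : n.det ≠ 0)
    (σ : ℝ) (dN : ι → ι → ι → ℝ) (hs : ∀ a b c, dN a c b = dN b c a)
    (dW dW' : ι → ι → ℝ) (w w' dD : ι → ℝ)
    (h1 : ∀ a c, ∑ b, (dN a c b * w b + n c b * dW a b) =
      σ * (dD a * w' c + n.det * ∑ d, dW' d c * n d a))
    (h2 : ∀ a, dD a = ∑ i, ∑ j, n.adjugate j i * dN a i j)
    (h3 : ∀ c, ∑ b, n c b * w b = σ * n.det * w' c) :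
    ∑ a, dW a a = σ * n.det * ∑ c, dW' c c := by
  have hw : ∀ a, n.det * w a = σ * n.det * ∑ c, n.adjugate a c * w' c := by
    intro a
    have : ∑ c, n.adjugate a c * ∑ b, n c b * w b = n.det * w a := by
      have := congrFun (congrArg (fun A => A.mulVec w) n.adjugate_mul) a
      rw [← Matrix.mulVec_mulVec] at this
      simpa [Matrix.mulVec, dotProduct, Matrix.smul_apply, Matrix.one_apply] using this
    rw [← this, Finset.mul_sum]
    refine Finset.sum_congr rfl fun c _ => ?_
    rw [h3]; ring
  have hw' : ∀ a, w a = σ * ∑ c, n.adjugate a c * w' c := fun a =>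
    mul_left_cancel₀ hn (by rw [hw]; ring)
  have hadj : ∀ a b, ∑ c, n.adjugate a c * n c b = if a = b then n.det else 0 := by
    intro a b
    have := congrFun (congrFun n.adjugate_mul a) b
    simpa [Matrix.mul_apply, Matrix.smul_apply, Matrix.one_apply] using this
  have hadj' : ∀ a b, ∑ c, n a c * n.adjugate c b = if a = b then n.det else 0 := by
    intro a b
    have := congrFun (congrFun n.mul_adjugate a) b
    simpa [Matrix.mul_apply, Matrix.smul_apply, Matrix.one_apply] using this
  -- Contract the differentiated law with the adjugate. The terms with `dW` and `dW'` become
  -- divergences; the remaining terms, `dN` on the left and `dD` on the right, cancel by Jacobi's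
  -- formula and the symmetry of second derivatives.
  have e : ∑ a, ∑ c, n.adjugate a c * ∑ b, (dN a c b * w b + n c b * dW a b) =
      ∑ a, ∑ c, n.adjugate a c * (σ * (dD a * w' c + n.det * ∑ d, dW' d c * n d a)) := by
    simp only [h1]
  have eL : ∑ a, ∑ c, n.adjugate a c * ∑ b, (dN a c b * w b + n c b * dW a b) =
      (∑ a, ∑ c, ∑ b, n.adjugate a c * dN a c b * w b) + n.det * ∑ a, dW a a := by
    simp only [Finset.sum_add_distrib, mul_add, Finset.mul_sum]
    congr 1
    · simp only [mul_assoc]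
    · refine Finset.sum_congr rfl fun a _ => ?_
      rw [Finset.sum_comm]
      have : ∀ b, ∑ c, n.adjugate a c * (n c b * dW a b) = (if a = b then n.det else 0) * dW a b := by
        intro b
        rw [← hadj, Finset.sum_mul]
        exact Finset.sum_congr rfl fun c _ => by ring
      simp only [this]
      simp
  have eR : ∑ a, ∑ c, n.adjugate a c * (σ * (dD a * w' c + n.det * ∑ d, dW' d c * n d a)) =
      (∑ a, dD a * w a) + σ * n.det * (n.det * ∑ c, dW' c c) := by
    simp only [Finset.sum_add_distrib, mul_add]
    congr 1
    · refine Finset.sum_congr rfl fun a _ => ?_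
      rw [hw', Finset.mul_sum, Finset.mul_sum]
      exact Finset.sum_congr rfl fun c _ => by ring
    · rw [Finset.sum_comm]
      simp only [Finset.mul_sum]
      refine Finset.sum_congr rfl fun c _ => ?_
      rw [Finset.sum_comm]
      have : ∀ d, ∑ a, n.adjugate a c * (σ * (n.det * (dW' d c * n d a))) =
          (if d = c then n.det else 0) * (σ * n.det * dW' d c) := by
        intro d
        rw [← hadj', Finset.sum_mul]
        exact Finset.sum_congr rfl fun a _ => by ring
      simp only [this]
      simp
      ring
  have eD : ∑ a, dD a * w a = ∑ a, ∑ c, ∑ b, n.adjugate a c * dN a c b * w b := by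
    simp only [h2, Finset.sum_mul]
    calc ∑ a, ∑ i, ∑ j, n.adjugate j i * dN a i j * w a
        = ∑ a, ∑ j, ∑ i, n.adjugate j i * dN j i a * w a := by
          refine Finset.sum_congr rfl fun a _ => ?_
          rw [Finset.sum_comm]
          refine Finset.sum_congr rfl fun j _ => Finset.sum_congr rfl fun i _ => ?_
          rw [hs]
      _ = ∑ j, ∑ a, ∑ i, n.adjugate j i * dN j i a * w a := Finset.sum_comm
      _ = _ := Finset.sum_congr rfl fun j _ => Finset.sum_comm
  rw [eL, eR, eD] at e
  have e2 := add_left_cancel e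
  refine mul_left_cancel₀ hn ?_
  rw [e2]; ring

end
-- The divergence in an arbitrary chart
section
variable {p : ℕ}

theorem clm_apply_eq_sum (L : EuclideanSpace ℝ (Fin p) →L[ℝ] ℝ) (v : EuclideanSpace ℝ (Fin p)) :
    L v = ∑ a, L (EuclideanSpace.single a 1) * v a := by
  have h3 : v = ∑ a, v a • EuclideanSpace.single a (1:ℝ) := by
    have := (EuclideanSpace.basisFun (Fin p) ℝ).sum_repr v
    simpa using this.symm
  conv_lhs => rw [h3]
  simp [mul_comm]

/-- A vector density transforms by $DF\,W=|\det DF|\,W'\circ F$, and its coordinate divergence is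
then multiplied by $|\det DF|$ alone, because the second derivatives of $F$ cancel. -/
theorem sum_fderiv_change_of_variables {F W W' : EuclideanSpace ℝ (Fin p) → EuclideanSpace ℝ (Fin p)}
    {y : EuclideanSpace ℝ (Fin p)} (hF : ContDiffAt ℝ 2 F y) (hdet : (fderiv ℝ F y).det ≠ 0)
    (hW : DifferentiableAt ℝ W y) (hW' : DifferentiableAt ℝ W' (F y))
    (h : ∀ᶠ z in nhds y, fderiv ℝ F z (W z) = |(fderiv ℝ F z).det| • W' (F z)) :
    ∑ a, fderiv ℝ (fun z => W z a) y (EuclideanSpace.single a 1) =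
      |(fderiv ℝ F y).det| * ∑ a, fderiv ℝ (fun z => W' z a) (F y) (EuclideanSpace.single a 1) := by
  have hJ : ContDiffAt ℝ 1 (fderiv ℝ F) y := hF.fderiv_right (by norm_num)
  have hJd : HasFDerivAt (fderiv ℝ F) (fderiv ℝ (fderiv ℝ F) y) y :=
    (hJ.differentiableAt (by norm_num)).hasFDerivAt
  set N : EuclideanSpace ℝ (Fin p) → Matrix (Fin p) (Fin p) ℝ := fun z =>
    Matrix.of fun c a => fderiv ℝ F z (EuclideanSpace.single a 1) c with hN
  have hdetN : ∀ z, (fderiv ℝ F z).det = (N z).det := fun z => clm_det_eq _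
  have hNd : ∀ c b, HasFDerivAt (fun z => N z c b)
      ((EuclideanSpace.proj c : EuclideanSpace ℝ (Fin p) →L[ℝ] ℝ) ∘L
        ((ContinuousLinearMap.apply ℝ (EuclideanSpace ℝ (Fin p)) (EuclideanSpace.single b 1)) ∘L
          (fderiv ℝ (fderiv ℝ F) y))) y := by
    intro c b
    have h1 : HasFDerivAt (fun z => fderiv ℝ F z (EuclideanSpace.single b 1))
        ((ContinuousLinearMap.apply ℝ (EuclideanSpace ℝ (Fin p)) (EuclideanSpace.single b 1)) ∘L
          (fderiv ℝ (fderiv ℝ F) y)) y :=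
      (ContinuousLinearMap.apply ℝ (EuclideanSpace ℝ (Fin p))
        (EuclideanSpace.single b (1 : ℝ))).hasFDerivAt.comp y hJd
    exact (EuclideanSpace.proj c : EuclideanSpace ℝ (Fin p) →L[ℝ] ℝ).hasFDerivAt.comp y h1
  have hdetd := hasFDerivAt_det hNd
  have hWd : ∀ b, HasFDerivAt (fun z => W z b) (fderiv ℝ (fun z => W z b) y) y := fun b =>
    ((EuclideanSpace.proj b : EuclideanSpace ℝ (Fin p) →L[ℝ] ℝ).differentiableAt.comp y hW).hasFDerivAt
  have hW'd : ∀ b, HasFDerivAt (fun z => W' z b) (fderiv ℝ (fun z => W' z b) (F y)) (F y) := fun b =>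
    ((EuclideanSpace.proj b : EuclideanSpace ℝ (Fin p) →L[ℝ] ℝ).differentiableAt.comp (F y) hW').hasFDerivAt
  have hFd : HasFDerivAt F (fderiv ℝ F y) y := (hF.differentiableAt (by norm_num)).hasFDerivAt
  have hsymm : IsSymmSndFDerivAt ℝ F y := hF.isSymmSndFDerivAt (by simp)
  -- The determinant is nonzero and continuous, so its sign is constant near `y` and the absolute
  -- value can be differentiated as `σ` times the determinant.
  obtain ⟨σ, hσe⟩ : ∃ σ : ℝ, ∀ᶠ z in nhds y, |(N z).det| = σ * (N z).det := by
    rcases lt_or_gt_of_ne (hdetN y ▸ hdet) with h0 | h0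
    · refine ⟨-1, ?_⟩
      filter_upwards [hdetd.continuousAt.eventually_lt continuousAt_const h0] with z hz
      rw [abs_of_neg hz]; ring
    · refine ⟨1, ?_⟩
      filter_upwards [hdetd.continuousAt.eventually_const_lt h0] with z hz
      rw [abs_of_pos hz]; ring
  have hexp : ∀ z c, fderiv ℝ F z (W z) c = ∑ b, N z c b * W z b := by
    intro z c
    have h3 : W z = ∑ a, W z a • EuclideanSpace.single a (1:ℝ) := by
      have := (EuclideanSpace.basisFun (Fin p) ℝ).sum_repr (W z)
      simpa using this.symm
    conv_lhs => rw [h3]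
    simp [hN, mul_comm]
  have heq : ∀ c, (fun z => ∑ b, N z c b * W z b) =ᶠ[nhds y] fun z => σ * ((N z).det * W' (F z) c) := by
    intro c
    filter_upwards [h, hσe] with z hz hz2
    rw [← hexp, hz, hdetN, hz2]
    simp [mul_assoc]
  rw [hdetN, hσe.self_of_nhds]
  refine divergence_change_aux (N y) (hdetN y ▸ hdet) σ
    (fun a c b => fderiv ℝ (fderiv ℝ F) y (EuclideanSpace.single a 1) (EuclideanSpace.single b 1) c)
    (fun a b c => by rw [hsymm.eq])
    (fun a b => fderiv ℝ (fun z => W z b) y (EuclideanSpace.single a 1))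
    (fun a b => fderiv ℝ (fun z => W' z b) (F y) (EuclideanSpace.single a 1)) (W y) (W' (F y))
    (fun a => (∑ i, ∑ j, (N y).adjugate j i • ((EuclideanSpace.proj i : EuclideanSpace ℝ (Fin p) →L[ℝ] ℝ) ∘L
        ((ContinuousLinearMap.apply ℝ (EuclideanSpace ℝ (Fin p)) (EuclideanSpace.single j 1)) ∘L
          (fderiv ℝ (fderiv ℝ F) y)))) (EuclideanSpace.single a 1)) ?_ ?_ ?_
  · intro a c
    have hl := HasFDerivAt.fun_sum (u := Finset.univ) fun b _ => (hNd c b).mul (hWd b)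
    have hr := (hdetd.mul ((hW'd c).comp y hFd)).const_mul σ
    have := (hl.congr_of_eventuallyEq (heq c).symm).unique hr
    have := DFunLike.congr_fun this (EuclideanSpace.single a 1)
    simp only [sum_apply, add_apply, smul_apply, ContinuousLinearMap.comp_apply] at this
    refine Eq.trans (Finset.sum_congr rfl fun b _ => ?_) (this.trans ?_)
    · simp only [smul_eq_mul, ContinuousLinearMap.apply_apply]
      rw [add_comm, mul_comm ((W y) b)]
      rfl
    · rw [clm_apply_eq_sum _ (fderiv ℝ F y (EuclideanSpace.single a 1))]
      simp only [sum_apply, smul_apply, ContinuousLinearMap.comp_apply, smul_eq_mul,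
        Function.comp_apply]
      simp only [hN, Matrix.of_apply]
      ring
  · intro a
    simp
  · intro c
    have := (heq c).self_of_nhds
    simp only at this
    rw [this]; ring


variable {H : Type*} [TopologicalSpace H]
  (I : ModelWithCorners ℝ (EuclideanSpace ℝ (Fin p)) H)
  {M : Type*} [TopologicalSpace M] [ChartedSpace H M] [IsManifold I ∞ M]

theorem chartDeriv_transition {x x' : M} {y : EuclideanSpace ℝ (Fin p)} (hy : y ∈ (extChartAt I x).target)
    (hy' : (extChartAt I x).symm y ∈ (extChartAt I x').source)
    (V : TangentSpace I ((extChartAt I x).symm y)) :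
    chartDeriv I x' ((extChartAt I x).symm y) V =
      fderivWithin ℝ (transition I x x') (range I) y (chartDeriv I x ((extChartAt I x).symm y) V) := by
  have h : ∑ a, chartDeriv I x ((extChartAt I x).symm y) V a • coordVec I x a y = V :=
    sum_coordComp_smul_coordVec I x (fun _ => V) hy
  have h3 : chartDeriv I x ((extChartAt I x).symm y) V =
      ∑ a, chartDeriv I x ((extChartAt I x).symm y) V a • EuclideanSpace.single a (1:ℝ) := by
    have := (EuclideanSpace.basisFun (Fin p) ℝ).sum_repr (chartDeriv I x ((extChartAt I x).symm y) V)
    simpa using this.symm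
  conv_lhs => rw [← h]
  conv_rhs => rw [h3]
  rw [map_sum, map_sum]
  refine Finset.sum_congr rfl fun a _ => ?_
  rw [map_smul, map_smul, chartDeriv_coordVec I hy hy']

theorem dirDeriv_eq_fderiv {φ : M → ℝ} (x : M) {y : EuclideanSpace ℝ (Fin p)}
    (hy : y ∈ interior (extChartAt I x).target)
    (hφ : MDifferentiableAt I 𝓘(ℝ, ℝ) φ ((extChartAt I x).symm y))
    (V : TangentSpace I ((extChartAt I x).symm y)) :
    dirDeriv I φ ((extChartAt I x).symm y) V =
      fderiv ℝ (φ ∘ (extChartAt I x).symm) y (chartDeriv I x ((extChartAt I x).symm y) V) := by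
  have hyT := interior_subset hy
  have hr : range I ∈ nhds y := Filter.mem_of_superset (mem_interior_iff_mem_nhds.1 hy)
    (extChartAt_target_subset_range x)
  have h2 := mdifferentiableWithinAt_extChartAt_symm (I := I) hyT
  have h3 : MDifferentiableAt 𝓘(ℝ, EuclideanSpace ℝ (Fin p)) I (extChartAt I x).symm y :=
    h2.mdifferentiableAt hr
  have h4 := mfderiv_comp (I := 𝓘(ℝ, EuclideanSpace ℝ (Fin p))) (I' := I) y hφ h3
  rw [mfderiv_eq_fderiv] at h4
  have h5 := DFunLike.congr_fun h4 (chartDeriv I x ((extChartAt I x).symm y) V)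
  refine Eq.trans ?_ h5.symm
  have h6 := DFunLike.congr_fun (mfderivWithin_extChartAt_symm_comp_mfderiv_extChartAt (I := I) hyT) V
  rw [mfderivWithin_of_mem_nhds hr] at h6
  exact congrArg (fun v => mfderiv I 𝓘(ℝ, ℝ) φ ((extChartAt I x).symm y) v) h6.symm

theorem mdifferentiableAt_symm_iff {φ : M → ℝ} (x : M) {y : EuclideanSpace ℝ (Fin p)}
    (hy : y ∈ interior (extChartAt I x).target) :
    MDifferentiableAt I 𝓘(ℝ, ℝ) φ ((extChartAt I x).symm y) ↔
      DifferentiableAt ℝ (φ ∘ (extChartAt I x).symm) y := by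
  have hyT := interior_subset hy
  have hr : range I ∈ nhds y := Filter.mem_of_superset (mem_interior_iff_mem_nhds.1 hy)
    (extChartAt_target_subset_range x)
  have h3 : MDifferentiableAt 𝓘(ℝ, EuclideanSpace ℝ (Fin p)) I (extChartAt I x).symm y :=
    (mdifferentiableWithinAt_extChartAt_symm (I := I) hyT).mdifferentiableAt hr
  have hs := (extChartAt I x).map_target hyT
  constructor
  · intro h
    exact (h.comp y h3).differentiableAt
  · intro h
    have h5 : MDifferentiableAt I 𝓘(ℝ, EuclideanSpace ℝ (Fin p)) (extChartAt I x) ((extChartAt I x).symm y) :=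
      mdifferentiableAt_extChartAt (by simpa using hs)
    have h6 : MDifferentiableAt 𝓘(ℝ, EuclideanSpace ℝ (Fin p)) 𝓘(ℝ, ℝ) (φ ∘ (extChartAt I x).symm)
        (extChartAt I x ((extChartAt I x).symm y)) := by
      rw [(extChartAt I x).right_inv hyT]
      exact h.mdifferentiableAt
    refine (h6.comp _ h5).congr_of_eventuallyEq ?_
    filter_upwards [(isOpen_extChartAt_source x).mem_nhds hs] with τ hτ
    simp only [Function.comp_apply]
    rw [(extChartAt I x).left_inv hτ]

variable [RiemannianBundle (fun θ : M => TangentSpace I θ)]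
  [IsContMDiffRiemannianBundle I ∞ (EuclideanSpace ℝ (Fin p)) (fun θ : M => TangentSpace I θ)]

/-- The coordinate representation of `X` in the preferred chart at `x`, as a vector. -/
def coordField (x : M) (X : (θ : M) → TangentSpace I θ) (y : EuclideanSpace ℝ (Fin p)) :
    EuclideanSpace ℝ (Fin p) :=
  chartDeriv I x ((extChartAt I x).symm y) (X ((extChartAt I x).symm y))

/-- The coordinate divergence `∂_a (√|g| X^a)` in the preferred chart at `x`. -/
def chartDivergence (x : M) (X : (θ : M) → TangentSpace I θ) (y : EuclideanSpace ℝ (Fin p)) : ℝ :=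
  ∑ a, fderiv ℝ (fun z => (sqrtDetMetric I x z • coordField I x X z) a) y (EuclideanSpace.single a 1)

theorem contDiffWithinAt_coordField (x : M) {X : (θ : M) → TangentSpace I θ} {s : Set M}
    {y : EuclideanSpace ℝ (Fin p)} (hy : y ∈ (extChartAt I x).target)
    (hX : ContMDiffWithinAt I I.tangent 1 (fun θ => (⟨θ, X θ⟩ : TangentBundle I M)) s ((extChartAt I x).symm y)) :
    ContDiffWithinAt ℝ 1 (coordField I x X) ((extChartAt I x).target ∩ (extChartAt I x).symm ⁻¹' s) y := by
  rw [contDiffWithinAt_euclidean]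
  exact fun a => contDiffWithinAt_coordComp I x hy hX a

theorem contDiffAt_coordField (x : M) {X : (θ : M) → TangentSpace I θ}
    {y : EuclideanSpace ℝ (Fin p)} (hy : y ∈ interior (extChartAt I x).target)
    (hX : ContMDiffAt I I.tangent 1 (fun θ => (⟨θ, X θ⟩ : TangentBundle I M)) ((extChartAt I x).symm y)) :
    ContDiffAt ℝ 1 (coordField I x X) y := by
  have := contDiffWithinAt_coordField I x (interior_subset hy) (hX.contMDiffWithinAt (s := univ))
  rw [preimage_univ, inter_univ] at this
  exact this.contDiffAt (mem_interior_iff_mem_nhds.1 hy)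

theorem contDiffAt_sqrtDetMetric (x : M) {y : EuclideanSpace ℝ (Fin p)}
    (hy : y ∈ interior (extChartAt I x).target) : ContDiffAt ℝ ∞ (sqrtDetMetric I x) y :=
  (contDiffOn_sqrtDetMetric I x).contDiffAt (mem_interior_iff_mem_nhds.1 hy)

theorem divergence_eq_chartDivergence (X : (θ : M) → TangentSpace I θ) {θ : M} (hθ : θ ∈ I.interior M) :
    sqrtDetMetric I θ (extChartAt I θ θ) * divergence I X θ = chartDivergence I θ X (extChartAt I θ θ) := by
  have hy := mem_extChartAt_target (I := I) θ
  have hr : range I ∈ nhds (extChartAt I θ θ) := range_mem_nhds_isInteriorPoint hθ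
  rw [divergence, mul_inv_cancel_left₀ (sqrtDetMetric_pos I θ hy).ne', chartDivergence]
  refine Finset.sum_congr rfl fun a _ => ?_
  rw [fderivWithin_of_mem_nhds hr]
  rfl

theorem det_fderiv_transition_ne_zero {x x' : M} {y : EuclideanSpace ℝ (Fin p)}
    (hy : y ∈ (extChartAt I x).target) (hy' : (extChartAt I x).symm y ∈ (extChartAt I x').source) :
    (fderivWithin ℝ (transition I x x') (range I) y).det ≠ 0 := by
  intro h
  have := sqrtDetMetric_transition I hy hy'
  rw [h, abs_zero, zero_mul] at this
  exact (sqrtDetMetric_pos I x hy).ne' this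

/-- Compare the chart at `x` with the preferred chart of the point itself, the one used by
`divergence`: $\sqrt{|g|}X$ is a vector density, and `sum_fderiv_change_of_variables` applies to the
transition map. -/
theorem sqrtDetMetric_mul_divergence (x : M) {X : (θ : M) → TangentSpace I θ}
    {y : EuclideanSpace ℝ (Fin p)} (hy : y ∈ interior (extChartAt I x).target)
    (hX : ContMDiffAt I I.tangent 1 (fun θ => (⟨θ, X θ⟩ : TangentBundle I M)) ((extChartAt I x).symm y)) :
    sqrtDetMetric I x y * divergence I X ((extChartAt I x).symm y) = chartDivergence I x X y := by
  have hyT := interior_subset hy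
  set θ := (extChartAt I x).symm y with hθ
  have hθi : θ ∈ I.interior M := (mem_interior_target_iff I x hyT).1 hy
  have hθs : θ ∈ (extChartAt I θ).source := mem_extChartAt_source θ
  have hFy : transition I x θ y = extChartAt I θ θ := rfl
  have hFi : transition I x θ y ∈ interior (extChartAt I θ).target :=
    (mem_interior_iff_mem_interior_target I θ hθs).1 hθi
  have hr : ∀ z ∈ interior (extChartAt I x).target, range I ∈ nhds z := fun z hz =>
    Filter.mem_of_superset (mem_interior_iff_mem_nhds.1 hz) (extChartAt_target_subset_range x)
  have hs : ∀ᶠ z in nhds y, z ∈ interior (extChartAt I x).target ∧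
      (extChartAt I x).symm z ∈ (extChartAt I θ).source := by
    refine Filter.Eventually.and (isOpen_interior.mem_nhds hy) ?_
    exact (continuousAt_extChartAt_symm'' hyT).eventually_mem ((isOpen_extChartAt_source θ).mem_nhds hθs)
  have e1 := sqrtDetMetric_transition I hyT hθs
  have hX' : ContMDiffAt I I.tangent 1 (fun θ => (⟨θ, X θ⟩ : TangentBundle I M))
      ((extChartAt I θ).symm (transition I x θ y)) := by
    rw [hFy, (extChartAt I θ).left_inv hθs]; exact hX
  have key := sum_fderiv_change_of_variables (F := transition I x θ) (y := y)
    (W := fun z => sqrtDetMetric I x z • coordField I x X z)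
    (W' := fun z => sqrtDetMetric I θ z • coordField I θ X z)
    (((contDiffWithinAt_transition I hyT hθs).contDiffAt (hr y hy)).of_le (by norm_cast))
    (by rw [← fderivWithin_of_mem_nhds (hr y hy)]; exact det_fderiv_transition_ne_zero I hyT hθs)
    (((contDiffAt_sqrtDetMetric I x hy).differentiableAt (by simp)).smul
      ((contDiffAt_coordField I x hy hX).differentiableAt (by simp)))
    (((contDiffAt_sqrtDetMetric I θ hFi).differentiableAt (by simp)).smul
      ((contDiffAt_coordField I θ hFi hX').differentiableAt (by simp)))
    (by
      filter_upwards [hs] with z ⟨hz, hz'⟩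
      have hzT := interior_subset hz
      rw [map_smul, sqrtDetMetric_transition I hzT hz', fderivWithin_of_mem_nhds (hr z hz), smul_smul]
      congr 1
      rw [coordField, ← fderivWithin_of_mem_nhds (hr z hz), ← chartDeriv_transition I hzT hz', coordField,
        transition, Function.comp_apply, (extChartAt I θ).left_inv hz'])
  rw [chartDivergence, key, e1, fderivWithin_of_mem_nhds (hr y hy), mul_assoc]
  congr 1
  exact divergence_eq_chartDivergence I X hθi


theorem contDiffAt_smul_coordField (x : M) {X : (θ : M) → TangentSpace I θ}
    {y : EuclideanSpace ℝ (Fin p)} (hy : y ∈ interior (extChartAt I x).target)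
    (hX : ContMDiffAt I I.tangent 1 (fun θ => (⟨θ, X θ⟩ : TangentBundle I M)) ((extChartAt I x).symm y)) :
    ContDiffAt ℝ 1 (fun z => sqrtDetMetric I x z • coordField I x X z) y :=
  ((contDiffAt_sqrtDetMetric I x hy).of_le (by simp)).smul (contDiffAt_coordField I x hy hX)

theorem divergence_eq_inv_mul (X : (θ : M) → TangentSpace I θ) {θ : M} (hθ : θ ∈ I.interior M) :
    divergence I X θ = (sqrtDetMetric I θ (extChartAt I θ θ))⁻¹ * chartDivergence I θ X (extChartAt I θ θ) := by
  rw [← divergence_eq_chartDivergence I X hθ,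
    inv_mul_cancel_left₀ (sqrtDetMetric_pos I θ (mem_extChartAt_target θ)).ne']

theorem mem_interior_target_self {θ : M} (hθ : θ ∈ I.interior M) :
    extChartAt I θ θ ∈ interior (extChartAt I θ).target :=
  (mem_interior_iff_mem_interior_target I θ (mem_extChartAt_source θ)).1 hθ

theorem differentiableAt_smul_coordField_self {X : (θ : M) → TangentSpace I θ} {θ : M} (hθ : θ ∈ I.interior M)
    (hX : ContMDiffAt I I.tangent 1 (fun θ => (⟨θ, X θ⟩ : TangentBundle I M)) θ) (a : Fin p) :
    DifferentiableAt ℝ (fun z => (sqrtDetMetric I θ z • coordField I θ X z) a) (extChartAt I θ θ) := by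
  have h := (contDiffAt_smul_coordField I θ (mem_interior_target_self I hθ)
    (X := X) (by rwa [extChartAt_to_inv])).differentiableAt (by simp)
  exact (EuclideanSpace.proj a : EuclideanSpace ℝ (Fin p) →L[ℝ] ℝ).differentiableAt.comp _ h

theorem divergence_add {X Y : (θ : M) → TangentSpace I θ} {θ : M} (hθ : θ ∈ I.interior M)
    (hX : ContMDiffAt I I.tangent 1 (fun θ => (⟨θ, X θ⟩ : TangentBundle I M)) θ)
    (hY : ContMDiffAt I I.tangent 1 (fun θ => (⟨θ, Y θ⟩ : TangentBundle I M)) θ) :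
    divergence I (fun τ => X τ + Y τ) θ = divergence I X θ + divergence I Y θ := by
  simp only [divergence_eq_inv_mul I _ hθ, ← mul_add, chartDivergence, ← Finset.sum_add_distrib]
  congr 1
  refine Finset.sum_congr rfl fun a _ => ?_
  rw [← add_apply, ← fderiv_fun_add (differentiableAt_smul_coordField_self I hθ hX a)
    (differentiableAt_smul_coordField_self I hθ hY a)]
  congr 2
  ext z
  have h : coordField I θ (fun τ => X τ + Y τ) z = coordField I θ X z + coordField I θ Y z :=
    map_add _ _ _
  rw [h, smul_add, PiLp.add_apply]

theorem divergence_smul {φ : M → ℝ} {X : (θ : M) → TangentSpace I θ} {θ : M} (hθ : θ ∈ I.interior M)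
    (hφ : MDifferentiableAt I 𝓘(ℝ, ℝ) φ θ)
    (hX : ContMDiffAt I I.tangent 1 (fun θ => (⟨θ, X θ⟩ : TangentBundle I M)) θ) :
    divergence I (fun τ => φ τ • X τ) θ = φ θ * divergence I X θ + dirDeriv I φ θ (X θ) := by
  have hy := mem_interior_target_self I hθ
  have hθe : (extChartAt I θ).symm (extChartAt I θ θ) = θ := extChartAt_to_inv θ
  have hφd : DifferentiableAt ℝ (φ ∘ (extChartAt I θ).symm) (extChartAt I θ θ) :=
    (mdifferentiableAt_symm_iff I θ hy).1 (by rwa [hθe])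
  have hs := sqrtDetMetric_pos I θ (mem_extChartAt_target (I := I) θ)
  have hD : dirDeriv I φ θ (X θ) =
      fderiv ℝ (φ ∘ (extChartAt I θ).symm) (extChartAt I θ θ) (coordField I θ X (extChartAt I θ θ)) := by
    have := dirDeriv_eq_fderiv I θ hy (by rwa [hθe]) (X ((extChartAt I θ).symm (extChartAt I θ θ))) (φ := φ)
    rw [← coordField] at this
    rw [← this, hθe]
  rw [divergence_eq_inv_mul I _ hθ, divergence_eq_inv_mul I _ hθ, hD, chartDivergence, chartDivergence]
  have h1 : ∀ a, fderiv ℝ (fun z => (sqrtDetMetric I θ z • coordField I θ (fun τ => φ τ • X τ) z) a)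
      (extChartAt I θ θ) (EuclideanSpace.single a 1) =
      φ θ * fderiv ℝ (fun z => (sqrtDetMetric I θ z • coordField I θ X z) a)
        (extChartAt I θ θ) (EuclideanSpace.single a 1) +
      sqrtDetMetric I θ (extChartAt I θ θ) * (fderiv ℝ (φ ∘ (extChartAt I θ).symm) (extChartAt I θ θ)
        (EuclideanSpace.single a 1) * coordField I θ X (extChartAt I θ θ) a) := by
    intro a
    have h2 : (fun z => (sqrtDetMetric I θ z • coordField I θ (fun τ => φ τ • X τ) z) a) =
        fun z => (φ ∘ (extChartAt I θ).symm) z * (sqrtDetMetric I θ z • coordField I θ X z) a := by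
      ext z
      simp only [coordField, map_smul, PiLp.smul_apply, smul_eq_mul, Function.comp_apply]
      ring
    rw [h2, fderiv_fun_mul hφd (differentiableAt_smul_coordField_self I hθ hX a)]
    simp only [add_apply, smul_apply, smul_eq_mul, Function.comp_apply, hθe, PiLp.smul_apply]
    ring
  simp only [h1]
  rw [Finset.sum_add_distrib, ← Finset.mul_sum, ← Finset.mul_sum, ← clm_apply_eq_sum]
  field_simp

/-- Not immediate from the definition, in which the chart varies with the point; near a given point
the divergence is first rewritten in one fixed chart. -/
theorem continuousOn_divergence {X : (θ : M) → TangentSpace I θ}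
    (hX : ∀ θ ∈ I.interior M, ContMDiffAt I I.tangent 1 (fun θ => (⟨θ, X θ⟩ : TangentBundle I M)) θ) :
    ContinuousOn (divergence I X) (I.interior M) := by
  intro θ hθ
  refine ContinuousAt.continuousWithinAt ?_
  have hy := mem_interior_target_self I hθ
  have hXy : ∀ y ∈ interior (extChartAt I θ).target, ContMDiffAt I I.tangent 1
      (fun θ => (⟨θ, X θ⟩ : TangentBundle I M)) ((extChartAt I θ).symm y) := fun y hy =>
    hX _ ((mem_interior_target_iff I θ (interior_subset hy)).1 hy)
  have h1 : ContinuousOn (fun y => (sqrtDetMetric I θ y)⁻¹ * chartDivergence I θ X y)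
      (interior (extChartAt I θ).target) := by
    intro y hy
    refine ContinuousAt.continuousWithinAt ?_
    refine ((contDiffAt_sqrtDetMetric I θ hy).continuousAt.inv₀
      (sqrtDetMetric_pos I θ (interior_subset hy)).ne').mul ?_
    refine tendsto_finsetSum _ fun a _ => ?_
    have h2 : ContDiffAt ℝ 1 (fun z => (sqrtDetMetric I θ z • coordField I θ X z) a) y :=
      (EuclideanSpace.proj a : EuclideanSpace ℝ (Fin p) →L[ℝ] ℝ).contDiff.contDiffAt.comp y
        (contDiffAt_smul_coordField I θ hy (hXy y hy))
    exact ((h2.fderiv_right (m := 0) (by simp)).continuousAt).clm_apply continuousAt_const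
  have h3 : ContinuousAt (fun y => (sqrtDetMetric I θ y)⁻¹ * chartDivergence I θ X y) (extChartAt I θ θ) :=
    h1.continuousAt (isOpen_interior.mem_nhds hy)
  refine (ContinuousAt.comp (f := extChartAt I θ) h3 (continuousAt_extChartAt θ)).congr ?_
  filter_upwards [(I.isOpen_interior (n := ∞) (by simp)).mem_nhds hθ,
    extChartAt_source_mem_nhds (I := I) θ] with τ hτ hτs
  have hτy := (mem_interior_iff_mem_interior_target I θ hτs).1 hτ
  have h4 := sqrtDetMetric_mul_divergence I θ hτy (hXy _ hτy)
  rw [(extChartAt I θ).left_inv hτs] at h4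
  rw [Function.comp_apply, ← h4,
    inv_mul_cancel_left₀ (sqrtDetMetric_pos I θ ((extChartAt I θ).map_source hτs)).ne']

end

/-! ### Integration by parts in Euclidean space, away from the boundary -/

section
variable {p : ℕ}

/-- The divergence `∂_a Y^a` of a vector field on Euclidean space. -/
def flatDivergence (Y : EuclideanSpace ℝ (Fin p) → EuclideanSpace ℝ (Fin p))
    (y : EuclideanSpace ℝ (Fin p)) : ℝ :=
  ∑ a, fderiv ℝ (fun z => Y z a) y (EuclideanSpace.single a 1)

/-- The test function is only Lipschitz because the cutoffs are built from Riemannian distances and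
distances to the boundary. The identity reduces to integration by parts for pairs of Lipschitz
functions, one direction at a time. -/
theorem integral_mul_flatDivergence_of_compact {U : Set (EuclideanSpace ℝ (Fin p))} (hU : IsOpen U)
    {Y : EuclideanSpace ℝ (Fin p) → EuclideanSpace ℝ (Fin p)} (hY : ContDiffOn ℝ 1 Y U)
    {ζ : EuclideanSpace ℝ (Fin p) → ℝ} {C : ℝ≥0} (hζ : LipschitzWith C ζ)
    (hc : HasCompactSupport ζ) (hs : tsupport ζ ⊆ U) :
    ∫ y, ζ y * flatDivergence Y y = -∫ y, fderiv ℝ ζ y (Y y) := by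
  obtain ⟨K, hK, hsK, hKU⟩ := exists_compact_between hc.isCompact hU hs
  -- A plateau equal to 1 near the support of `ζ` and vanishing off `K`: the components of `φ • Y`
  -- are globally `C¹` with compact support, hence Lipschitz, and agree with those of `Y` wherever
  -- `ζ` matters.
  obtain ⟨φ, hφ0, hφ1, -⟩ := exists_contMDiffMap_zero_one_nhds_of_isClosed
    (𝓘(ℝ, EuclideanSpace ℝ (Fin p))) (n := 1) (s := (interior K)ᶜ) (t := tsupport ζ)
    isOpen_interior.isClosed_compl (isClosed_tsupport ζ)
    (disjoint_compl_left_iff_subset.2 hsK)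
  have hφc : ContDiff ℝ 1 φ := contMDiff_iff_contDiff.1 φ.contMDiff
  have hφ0' : ∀ y ∉ K, φ y = 0 := fun y hy =>
    hφ0.self_of_nhdsSet y fun h => hy (interior_subset h)
  set g : Fin p → EuclideanSpace ℝ (Fin p) → ℝ := fun a y => φ y * Y y a with hg
  have hgc : ∀ a, ContDiff ℝ 1 (g a) := by
    intro a
    rw [contDiff_iff_contDiffAt]
    intro y
    by_cases hy : y ∈ interior K
    · have h1 : ContDiffAt ℝ 1 Y y := hY.contDiffAt (hU.mem_nhds (hKU (interior_subset hy)))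
      exact hφc.contDiffAt.mul ((EuclideanSpace.proj a : EuclideanSpace ℝ (Fin p) →L[ℝ] ℝ).contDiff.contDiffAt.comp y h1)
    · have h2 : ∀ᶠ z in nhds y, φ z = 0 := hφ0.filter_mono (nhds_le_nhdsSet hy)
      refine (contDiffAt_const (c := (0:ℝ))).congr_of_eventuallyEq ?_
      filter_upwards [h2] with z hz
      simp [hg, hz]
  have hgs : ∀ a, HasCompactSupport (g a) := fun a =>
    HasCompactSupport.intro hK fun y hy => by simp [hg, hφ0' y hy]
  have hgl : ∀ a, ∃ D, LipschitzWith D (g a) := fun a =>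
    ContDiff.lipschitzWith_of_hasCompactSupport (hgs a) (hgc a) (by simp)
  have key : ∀ a, ∫ y, lineDeriv ℝ (g a) y (EuclideanSpace.single a 1) * ζ y =
      ∫ y, lineDeriv ℝ ζ y (-EuclideanSpace.single a 1) * g a y := by
    intro a
    obtain ⟨D, hD⟩ := hgl a
    exact LipschitzWith.integral_lineDeriv_mul_eq hD hζ hc _
  have hnt : ∀ y ∈ tsupport ζ, ∀ᶠ z in nhds y, φ z = 1 := fun y hy =>
    hφ1.filter_mono (nhds_le_nhdsSet hy)
  have hL : ∫ y, ζ y * flatDivergence Y y =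
      ∑ a, ∫ y, lineDeriv ℝ (g a) y (EuclideanSpace.single a 1) * ζ y := by
    rw [← integral_finsetSum]
    · refine integral_congr_ae (Filter.Eventually.of_forall fun y => ?_)
      simp only [flatDivergence, Finset.mul_sum]
      refine Finset.sum_congr rfl fun a _ => ?_
      by_cases hy : y ∈ tsupport ζ
      · rw [mul_comm, ((hgc a).differentiable (by simp) y).lineDeriv_eq_fderiv]
        congr 2
        refine Filter.EventuallyEq.fderiv_eq ?_
        filter_upwards [hnt y hy] with z hz
        simp [hg, hz]
      · simp [image_eq_zero_of_notMem_tsupport hy]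
    · intro a _
      have : (fun y => lineDeriv ℝ (g a) y (EuclideanSpace.single a 1) * ζ y) =
          fun y => fderiv ℝ (g a) y (EuclideanSpace.single a 1) * ζ y := by
        ext y
        rw [((hgc a).differentiable (by simp) y).lineDeriv_eq_fderiv]
      rw [this]
      exact ((((hgc a).continuous_fderiv (by simp)).clm_apply continuous_const).mul
        hζ.continuous).integrable_of_hasCompactSupport hc.mul_left
  have hR : ∫ y, fderiv ℝ ζ y (Y y) =
      ∑ a, -∫ y, lineDeriv ℝ ζ y (-EuclideanSpace.single a 1) * g a y := by
    simp only [← integral_neg]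
    rw [← integral_finsetSum]
    · refine integral_congr_ae ?_
      filter_upwards [hζ.ae_differentiableAt (μ := volume)] with y hy
      simp only [hy.lineDeriv_eq_fderiv, map_neg, neg_mul, neg_neg]
      by_cases hys : y ∈ tsupport ζ
      · rw [clm_apply_eq_sum]
        simp [hg, (hnt y hys).self_of_nhds]
      · have h0 : fderiv ℝ ζ y = 0 := by
          by_contra h
          exact hys (support_fderiv_subset ℝ h)
        simp [h0]
    · intro a _
      exact ((hζ.locallyIntegrable_lineDeriv _).integrable_smul_right_of_hasCompactSupport
        (hgc a).continuous (hgs a)).neg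
  rw [hL, hR, Finset.sum_neg_distrib, neg_neg]
  exact Finset.sum_congr rfl fun a _ => key a

theorem ae_differentiableAt_of_locallyLipschitzOn {U : Set (EuclideanSpace ℝ (Fin p))} (hU : IsOpen U)
    {ζ : EuclideanSpace ℝ (Fin p) → ℝ} (hζ : LocallyLipschitzOn U ζ) :
    ∀ᵐ y, y ∈ U → DifferentiableAt ℝ ζ y := by
  have : volume {y | y ∈ U ∧ ¬ DifferentiableAt ℝ ζ y} = 0 := by
    refine measure_null_of_locally_null _ fun y hy => ?_
    obtain ⟨K, t, ht, hK⟩ := hζ hy.1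
    rw [hU.nhdsWithin_eq hy.1] at ht
    refine ⟨interior t ∩ {y | ¬ DifferentiableAt ℝ ζ y},
      mem_nhdsWithin.2 ⟨interior t, isOpen_interior, mem_interior_iff_mem_nhds.2 ht, fun z hz => ⟨hz.1, hz.2.2⟩⟩, ?_⟩
    have h1 := hK.ae_differentiableWithinAt_of_mem (μ := volume)
    rw [measure_eq_zero_iff_ae_notMem]
    filter_upwards [h1] with z hz hz2
    exact hz2.2 ((hz (interior_subset hz2.1)).differentiableAt (mem_interior_iff_mem_nhds.1 hz2.1))
  rw [measure_eq_zero_iff_ae_notMem] at this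
  filter_upwards [this] with y hy hyU
  by_contra h
  exact hy ⟨hyU, h⟩

/-- On a ball of radius `R + 1` compactness gives a uniform constant. A point outside that ball is
at distance at least 1 from the support, where the bound `B` serves as a Lipschitz constant. -/
theorem exists_lipschitzWith_of_locallyLipschitz {ζ : EuclideanSpace ℝ (Fin p) → ℝ}
    (hζ : LocallyLipschitz ζ) {B R : ℝ} (hB : ∀ y, |ζ y| ≤ B) (hR : ∀ y, ζ y ≠ 0 → ‖y‖ ≤ R) :
    ∃ C, LipschitzWith C ζ := by
  obtain ⟨K, hK⟩ := ((hζ.locallyLipschitzOn (s := Metric.closedBall 0 (R + 1))).exists_lipschitzOnWith_of_compact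
    (isCompact_closedBall _ _))
  have hB0 : 0 ≤ B := (abs_nonneg _).trans (hB 0)
  have aux : ∀ y z, ζ y ≠ 0 → |ζ y - ζ z| ≤ (K + B) * dist y z := by
    intro y z hy
    by_cases hz : ‖z‖ ≤ R + 1
    · have := hK.dist_le_mul y (by simpa using (hR y hy).trans (by linarith)) z (by simpa using hz)
      rw [Real.dist_eq] at this
      refine this.trans (mul_le_mul_of_nonneg_right (by linarith) dist_nonneg)
    · have hz0 : ζ z = 0 := by
        by_contra h
        exact hz ((hR z h).trans (by linarith))
      rw [hz0, sub_zero]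
      have h1 : 1 ≤ dist y z := by
        have := norm_sub_norm_le z y
        rw [← dist_eq_norm, dist_comm] at this
        push Not at hz
        linarith [hR y hy]
      have hK0 := K.2
      calc |ζ y| ≤ B := hB y
        _ ≤ (K + B) * 1 := by simp
        _ ≤ _ := mul_le_mul_of_nonneg_left h1 (by positivity)
  refine ⟨K + ⟨B, hB0⟩, LipschitzWith.of_dist_le_mul fun y z => ?_⟩
  rw [Real.dist_eq]
  change _ ≤ (K + B) * dist y z
  by_cases hy : ζ y = 0
  · by_cases hz : ζ z = 0
    · rw [hy, hz]
      have hK0 := K.2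
      simpa using mul_nonneg (add_nonneg K.2 hB0) dist_nonneg
    · rw [abs_sub_comm, dist_comm]
      exact aux z y hz
  · exact aux y z hy
end

/-! ### Integration by parts up to the boundary -/

section
variable {p : ℕ}

/-- The ramp that vanishes up to `1 / k` and equals `1` from `2 / k` on. -/
def ramp (k t : ℝ) : ℝ := max 0 (min 1 (k * t - 1))

theorem ramp_nonneg (k t : ℝ) : 0 ≤ ramp k t := le_max_left _ _

theorem ramp_le_one (k t : ℝ) : ramp k t ≤ 1 := max_le zero_le_one (min_le_left _ _)

theorem abs_ramp_le_one (k t : ℝ) : |ramp k t| ≤ 1 := by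
  rw [abs_of_nonneg (ramp_nonneg k t)]; exact ramp_le_one k t

theorem ramp_eq_zero {k t : ℝ} (h : k * t ≤ 1) : ramp k t = 0 :=
  max_eq_left ((min_le_right _ _).trans (by linarith))

theorem ramp_eq_one {k t : ℝ} (h : 2 ≤ k * t) : ramp k t = 1 := by
  rw [ramp, min_eq_left (by linarith), max_eq_right zero_le_one]

theorem lipschitzWith_ramp (k : ℝ≥0) : LipschitzWith k (ramp k) := by
  have h1 : LipschitzWith k (fun t : ℝ => (k : ℝ) * t - 1) :=
    LipschitzWith.of_dist_le_mul fun s t => by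
      rw [Real.dist_eq, Real.dist_eq, show (k:ℝ) * s - 1 - (k * t - 1) = k * (s - t) by ring, abs_mul, NNReal.abs_eq]
  exact (h1.const_min 1).const_max 0

/-- No boundary term appears although `Y` may fail to vanish, or even to stay bounded, at the
boundary of `U`. Insert the cutoff `ramp k ∘ δ` and let `k → ∞`. The only new term is the integral
of `ζ` times the derivative of the cutoff along `Y`, which lives in the strip `δ ≤ 2 / k` and is at
most a multiple of `k * a * b` there. The strip has volume of order `1 / k` and `b ^ 2` is of order
`1 / k` on it, while the integral of `a ^ 2` over the strip tends to zero. -/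
theorem integral_mul_flatDivergence {U C : Set (EuclideanSpace ℝ (Fin p))} (hU : IsOpen U)
    (hC : IsCompact C) {δ : EuclideanSpace ℝ (Fin p) → ℝ} (hδ : LipschitzWith 1 δ)
    (hδU : ∀ y ∈ U, 0 < δ y) (hδC : ∀ y ∈ C, 0 < δ y → y ∈ U)
    {A : ℝ} (hA : 0 ≤ A) (hstrip : ∀ t, 0 < t → t < 1 → volume.real (U ∩ C ∩ {y | δ y ≤ t}) ≤ A * t)
    {Y : EuclideanSpace ℝ (Fin p) → EuclideanSpace ℝ (Fin p)} (hY : ContDiffOn ℝ 1 Y U)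
    {ζ : EuclideanSpace ℝ (Fin p) → ℝ} (hζL : LocallyLipschitzOn U ζ) {B : ℝ}
    (hB : ∀ y, |ζ y| ≤ B) (hζ0 : ∀ y ∈ U, y ∉ C → ζ y = 0)
    {a b : EuclideanSpace ℝ (Fin p) → ℝ} {D : ℝ} (hD : 0 ≤ D)
    (hab : ∀ y ∈ U ∩ C, ‖Y y‖ ≤ a y * b y) (hb : ∀ y ∈ U ∩ C, b y ^ 2 ≤ D * δ y)
    (ha : IntegrableOn (fun y => a y ^ 2) (U ∩ C))
    (hi1 : IntegrableOn (fun y => ζ y * flatDivergence Y y) U)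
    (hi2 : IntegrableOn (fun y => fderiv ℝ ζ y (Y y)) U) :
    ∫ y in U, ζ y * flatDivergence Y y = -∫ y in U, fderiv ℝ ζ y (Y y) := by
  have hUm := hU.measurableSet
  have hB0 : 0 ≤ B := (abs_nonneg _).trans (hB 0)
  obtain ⟨R, hR⟩ := hC.isBounded.exists_norm_le
  -- Starting at 3 keeps the strip width `2 / k m` below 1, as `hstrip` requires.
  set k : ℕ → ℝ≥0 := fun m => m + 3 with hk
  have hkpos : ∀ m, (0:ℝ) < k m := fun m => by simp only [hk]; push_cast; positivity
  set κ : ℕ → EuclideanSpace ℝ (Fin p) → ℝ := fun m y => ramp (k m) (δ y) with hκ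
  have hκL : ∀ m, LipschitzWith (k m) (κ m) := fun m => by
    have := (lipschitzWith_ramp (k m)).comp hδ
    rwa [mul_one] at this
  -- The truncated test function is supported in the compact set where `1 ≤ k m * δ y` within `C`.
  -- This set lies in `U`, so the compactly supported case applies.
  set ζ' : ℕ → EuclideanSpace ℝ (Fin p) → ℝ := fun m => U.indicator fun y => ζ y * κ m y with hζ'
  have hin : ∀ m, ∀ y ∈ U, ζ' m y = ζ y * κ m y := fun m y hy => indicator_of_mem hy _
  have hout : ∀ m, ∀ y ∉ U, ζ' m y = 0 := fun m y hy => indicator_of_notMem hy _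
  have hsupp : ∀ m y, y ∉ C ∩ {y | 1 ≤ k m * δ y} → ζ' m y = 0 := by
    intro m y hy
    by_cases hyU : y ∈ U
    · rw [hin m y hyU]
      by_cases hyC : y ∈ C
      · have : ¬ (1 ≤ k m * δ y) := fun h => hy ⟨hyC, h⟩
        simp [hκ, ramp_eq_zero (not_le.1 this).le]
      · simp [hζ0 y hyU hyC]
    · exact hout m y hyU
  have hclosed : ∀ m, IsCompact (C ∩ {y | 1 ≤ k m * δ y}) := fun m =>
    hC.inter_right (isClosed_le continuous_const (continuous_const.mul hδ.continuous))
  have hsub : ∀ m, C ∩ {y | 1 ≤ k m * δ y} ⊆ U := by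
    rintro m y ⟨hyC, hy⟩
    refine hδC y hyC ?_
    by_contra h
    have : (k m : ℝ) * δ y ≤ 0 := mul_nonpos_of_nonneg_of_nonpos (hkpos m).le (not_lt.1 h)
    have hy' : (1:ℝ) ≤ k m * δ y := hy
    linarith
  have hc : ∀ m, HasCompactSupport (ζ' m) := fun m =>
    HasCompactSupport.intro (hclosed m) (hsupp m)
  have hts : ∀ m, tsupport (ζ' m) ⊆ U := fun m =>
    (closure_minimal (fun y (hy : ζ' m y ≠ 0) => by_contra fun h => hy (hsupp m y h)) (hclosed m).isClosed).trans (hsub m)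
  have hloc : ∀ m, LocallyLipschitz (ζ' m) := by
    intro m y
    by_cases hy : y ∈ C ∩ {y | 1 ≤ k m * δ y}
    · obtain ⟨K, t, ht, hK⟩ := hζL (hsub m hy)
      rw [hU.nhdsWithin_eq (hsub m hy)] at ht
      refine ⟨K + B.toNNReal * k m, t ∩ U, Filter.inter_mem ht (hU.mem_nhds (hsub m hy)), ?_⟩
      refine LipschitzOnWith.of_dist_le_mul fun x hx z hz => ?_
      rw [hin m x hx.2, hin m z hz.2, Real.dist_eq]
      have h1 := hK.dist_le_mul x hx.1 z hz.1
      have h2 := (hκL m).dist_le_mul x z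
      rw [Real.dist_eq] at h1 h2
      rw [NNReal.coe_add, NNReal.coe_mul, Real.coe_toNNReal _ hB0]
      calc |ζ x * κ m x - ζ z * κ m z| = |ζ z * (κ m x - κ m z) + κ m x * (ζ x - ζ z)| := by ring_nf
        _ ≤ |ζ z * (κ m x - κ m z)| + |κ m x * (ζ x - ζ z)| := abs_add_le _ _
        _ = |ζ z| * |κ m x - κ m z| + |κ m x| * |ζ x - ζ z| := by rw [abs_mul, abs_mul]
        _ ≤ B * (k m * dist x z) + 1 * (K * dist x z) := by
          gcongr
          · exact hB z
          · exact abs_ramp_le_one _ _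
        _ = _ := by ring
    · refine ⟨0, (C ∩ {y | 1 ≤ k m * δ y})ᶜ, (hclosed m).isClosed.isOpen_compl.mem_nhds hy, ?_⟩
      refine LipschitzOnWith.of_dist_le_mul fun x hx z hz => ?_
      simp [hsupp m x hx, hsupp m z hz]
  have hLip : ∀ m, ∃ L, LipschitzWith L (ζ' m) := fun m => by
    refine exists_lipschitzWith_of_locallyLipschitz (hloc m) (B := B) (R := R) (fun y => ?_) (fun y hy => ?_)
    · by_cases hyU : y ∈ U
      · rw [hin m y hyU, abs_mul]
        calc |ζ y| * |κ m y| ≤ B * 1 := mul_le_mul (hB y) (abs_ramp_le_one _ _) (abs_nonneg _) hB0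
          _ = B := mul_one B
      · rw [hout m y hyU, abs_zero]; exact hB0
    · by_contra h
      exact hy (hsupp m y fun h2 => h (hR y h2.1))
  have hbase : ∀ m, ∫ y in U, ζ y * flatDivergence Y y * κ m y = -∫ y in U, fderiv ℝ (ζ' m) y (Y y) := by
    intro m
    obtain ⟨L, hL⟩ := hLip m
    have h1 := integral_mul_flatDivergence_of_compact hU hY hL (hc m) (hts m)
    have h2 : ∫ y in U, fderiv ℝ (ζ' m) y (Y y) = ∫ y, fderiv ℝ (ζ' m) y (Y y) := by
      refine setIntegral_eq_integral_of_forall_compl_eq_zero fun y hy => ?_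
      have h0 : fderiv ℝ (ζ' m) y = 0 := by
        by_contra h
        exact hy (hts m (support_fderiv_subset ℝ h))
      simp [h0]
    rw [h2, ← h1, ← integral_indicator hUm]
    refine integral_congr_ae (Filter.Eventually.of_forall fun y => ?_)
    by_cases hyU : y ∈ U
    · simp only [indicator_of_mem hyU, hin m y hyU]; ring
    · simp only [indicator_of_notMem hyU, hout m y hyU, zero_mul]
  have hdiff := ae_differentiableAt_of_locallyLipschitzOn hU hζL
  have hsplit : ∀ m, ∀ᵐ y, y ∈ U → fderiv ℝ (ζ' m) y (Y y) =
      fderiv ℝ ζ y (Y y) * κ m y + ζ y * fderiv ℝ (κ m) y (Y y) := by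
    intro m
    filter_upwards [hdiff, (hκL m).ae_differentiableAt (μ := volume)] with y hy1 hy2 hyU
    have he : ζ' m =ᶠ[nhds y] fun z => ζ z * κ m z := by
      filter_upwards [hU.mem_nhds hyU] with z hz
      exact hin m z hz
    rw [he.fderiv_eq, fderiv_fun_mul (hy1 hyU) hy2]
    simp only [add_apply, smul_apply, smul_eq_mul]
    ring
  have hκm : ∀ m, AEStronglyMeasurable (κ m) (volume.restrict U) := fun m =>
    (hκL m).continuous.aestronglyMeasurable
  have hκb : ∀ m, ∀ᵐ y ∂(volume.restrict U), ‖κ m y‖ ≤ 1 := fun m =>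
    Filter.Eventually.of_forall fun y => abs_ramp_le_one _ _
  have hκlim : ∀ y ∈ U, Filter.Tendsto (fun m => κ m y) Filter.atTop (nhds 1) := by
    intro y hy
    refine tendsto_const_nhds.congr' ?_
    obtain ⟨N, hN⟩ := exists_nat_gt (2 / δ y)
    filter_upwards [Filter.eventually_ge_atTop N] with m hm
    refine (ramp_eq_one ?_).symm
    have h1 : 2 < N * δ y := by rwa [div_lt_iff₀ (hδU y hy)] at hN
    have h2 : (N : ℝ) ≤ k m := by
      simp only [hk]; push_cast
      have : (N:ℝ) ≤ m := by exact_mod_cast hm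
      linarith
    nlinarith [hδU y hy]
  have hlim1 : Filter.Tendsto (fun m => ∫ y in U, ζ y * flatDivergence Y y * κ m y) Filter.atTop
      (nhds (∫ y in U, ζ y * flatDivergence Y y)) := by
    refine tendsto_integral_of_dominated_convergence (fun y => |ζ y * flatDivergence Y y|)
      (fun m => hi1.aestronglyMeasurable.mul (hκm m)) hi1.abs (fun m => ?_) ?_
    · refine Filter.Eventually.of_forall fun y => ?_
      rw [Real.norm_eq_abs, abs_mul]
      exact mul_le_of_le_one_right (abs_nonneg _) (abs_ramp_le_one _ _)
    · filter_upwards [ae_restrict_mem hUm] with y hy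
      simpa using (hκlim y hy).const_mul (ζ y * flatDivergence Y y)
  have hlim2 : Filter.Tendsto (fun m => ∫ y in U, fderiv ℝ ζ y (Y y) * κ m y) Filter.atTop
      (nhds (∫ y in U, fderiv ℝ ζ y (Y y))) := by
    refine tendsto_integral_of_dominated_convergence (fun y => |fderiv ℝ ζ y (Y y)|)
      (fun m => hi2.aestronglyMeasurable.mul (hκm m)) hi2.abs (fun m => ?_) ?_
    · refine Filter.Eventually.of_forall fun y => ?_
      rw [Real.norm_eq_abs, abs_mul]
      exact mul_le_of_le_one_right (abs_nonneg _) (abs_ramp_le_one _ _)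
    · filter_upwards [ae_restrict_mem hUm] with y hy
      simpa using (hκlim y hy).const_mul (fderiv ℝ ζ y (Y y))
  -- the boundary layer
  set S : ℕ → Set (EuclideanSpace ℝ (Fin p)) := fun m => U ∩ C ∩ {y | δ y ≤ 2 / k m} with hS
  have hSm : ∀ m, MeasurableSet (S m) := fun m =>
    (hUm.inter hC.measurableSet).inter (isClosed_le hδ.continuous continuous_const).measurableSet
  have hSfin : ∀ m, volume (S m) < ⊤ := fun m =>
    (measure_mono (inter_subset_left.trans inter_subset_right)).trans_lt hC.measure_lt_top
  have hYm : AEStronglyMeasurable Y (volume.restrict U) := hY.continuousOn.aestronglyMeasurable hUm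
  have hmeas : ∀ φ : EuclideanSpace ℝ (Fin p) → ℝ,
      AEStronglyMeasurable (fun y => fderiv ℝ φ y (Y y)) (volume.restrict U) := fun φ =>
    isBoundedBilinearMap_apply.continuous.comp_aestronglyMeasurable
      ((measurable_fderiv ℝ φ).stronglyMeasurable.aestronglyMeasurable.prodMk hYm)
  have hTi : ∀ m, IntegrableOn (fun y => fderiv ℝ (ζ' m) y (Y y)) U := by
    intro m
    obtain ⟨L, hL⟩ := hLip m
    obtain ⟨N, hN⟩ := (hclosed m).exists_bound_of_continuousOn (hY.continuousOn.mono (hsub m))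
    have hi : Integrable ((C ∩ {y | 1 ≤ k m * δ y}).indicator fun _ => (L : ℝ) * N) :=
      (integrable_indicator_iff (hclosed m).measurableSet).2
        (integrableOn_const (hclosed m).measure_lt_top.ne)
    refine hi.integrableOn.mono' (hmeas _) (Filter.Eventually.of_forall fun y => ?_)
    by_cases hy : y ∈ C ∩ {y | 1 ≤ k m * δ y}
    · rw [indicator_of_mem hy]
      exact (ContinuousLinearMap.le_opNorm _ _).trans (mul_le_mul (norm_fderiv_le_of_lipschitz ℝ hL)
        (hN y hy) (norm_nonneg _) L.2)
    · rw [indicator_of_notMem hy]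
      have : fderiv ℝ (ζ' m) y = 0 := by
        by_contra h
        exact hy (closure_minimal (fun y (hy : ζ' m y ≠ 0) => by_contra fun h => hy (hsupp m y h))
          (hclosed m).isClosed (support_fderiv_subset ℝ h))
      simp [this]
  have hi3 : ∀ m, IntegrableOn (fun y => fderiv ℝ ζ y (Y y) * κ m y) U := fun m =>
    hi2.mul_bdd (hκm m) (hκb m)
  have hsplit' : ∀ m, (fun y => ζ y * fderiv ℝ (κ m) y (Y y)) =ᵐ[volume.restrict U]
      fun y => fderiv ℝ (ζ' m) y (Y y) - fderiv ℝ ζ y (Y y) * κ m y := by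
    intro m
    rw [Filter.EventuallyEq, ae_restrict_iff' hUm]
    filter_upwards [hsplit m] with y hy hyU
    rw [hy hyU]; ring
  have hi4 : ∀ m, IntegrableOn (fun y => ζ y * fderiv ℝ (κ m) y (Y y)) U := fun m =>
    ((hTi m).sub (hi3 m)).congr (hsplit' m).symm
  have hJ : Filter.Tendsto (fun m => ∫ y in S m, a y ^ 2) Filter.atTop (nhds 0) := by
    have hanti : Antitone S := by
      rintro m n hmn y ⟨hy, hy2⟩
      refine ⟨hy, le_trans (b := 2 / (k n : ℝ)) hy2 ?_⟩
      have : (k m : ℝ) ≤ k n := by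
        simp only [hk]; push_cast
        have : (m:ℝ) ≤ n := by exact_mod_cast hmn
        linarith
      exact div_le_div_of_nonneg_left zero_le_two (hkpos m) this
    have hempty : ⋂ m, S m = ∅ := by
      refine eq_empty_of_forall_notMem fun y hy => ?_
      rw [mem_iInter] at hy
      have hyU := (hy 0).1.1
      obtain ⟨N, hN⟩ := exists_nat_gt (2 / δ y)
      have h1 : 2 < N * δ y := by rwa [div_lt_iff₀ (hδU y hyU)] at hN
      have h2 : δ y ≤ 2 / k N := (hy N).2
      rw [le_div_iff₀ (hkpos N)] at h2
      simp only [hk] at h2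
      push_cast at h2
      nlinarith [hδU y hyU]
    have := tendsto_setIntegral_of_antitone (μ := volume) (f := fun y => a y ^ 2) hSm hanti
      ⟨0, ha.mono_set inter_subset_left⟩
    rwa [hempty, setIntegral_empty] at this
  -- Young's inequality with a free parameter `s` in place of Cauchy-Schwarz: `k * a * b ≤ (s * a ^
  -- 2 + (k * b) ^ 2 / s) / 2`. On the strip `(k * b) ^ 2 ≤ 2 * D * k` and the volume is at most `2
  -- * A / k`, so the second summand contributes `4 * D * A / s`, uniformly in `m`.
  have hTb : ∀ m, ∀ s : ℝ, 0 < s → |∫ y in U, ζ y * fderiv ℝ (κ m) y (Y y)| ≤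
      B / 2 * (s * (∫ y in S m, a y ^ 2) + 4 * D * A / s) := by
    intro m s hs
    have hkm := hkpos m
    have hnn : ∀ y, 0 ≤ B / 2 * (s * a y ^ 2 + 2 * D * k m / s) := fun y => by
      have := (k m).2
      positivity
    have hIon : IntegrableOn (fun y => B / 2 * (s * a y ^ 2 + 2 * D * k m / s)) (S m) :=
      (((ha.mono_set inter_subset_left).const_mul s).add
        (integrableOn_const (hSfin m).ne)).const_mul _
    have hpt : ∀ y ∈ U, |ζ y * fderiv ℝ (κ m) y (Y y)| ≤
        (S m).indicator (fun y => B / 2 * (s * a y ^ 2 + 2 * D * k m / s)) y := by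
      intro y hyU
      by_cases hyC : y ∈ C
      · by_cases hyd : δ y ≤ 2 / k m
        · rw [indicator_of_mem (show y ∈ S m from ⟨⟨hyU, hyC⟩, hyd⟩), abs_mul]
          have h1 : |fderiv ℝ (κ m) y (Y y)| ≤ k m * (a y * b y) :=
            (ContinuousLinearMap.le_opNorm _ _).trans (mul_le_mul
              (norm_fderiv_le_of_lipschitz ℝ (hκL m)) (hab y ⟨hyU, hyC⟩) (norm_nonneg _) (k m).2)
          have h2 : b y ^ 2 ≤ D * (2 / k m) :=
            (hb y ⟨hyU, hyC⟩).trans (mul_le_mul_of_nonneg_left hyd hD)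
          have h3 : k m * (a y * b y) ≤ 1 / 2 * (s * a y ^ 2 + 2 * D * k m / s) := by
            have h4 : (k m * b y) ^ 2 ≤ 2 * D * k m := by
              rw [mul_pow]
              calc (k m : ℝ) ^ 2 * b y ^ 2 ≤ k m ^ 2 * (D * (2 / k m)) := by gcongr
                _ = 2 * D * k m := by field_simp
            have h5 : (k m * b y) ^ 2 / s ≤ 2 * D * k m / s := by gcongr
            have h6 : 0 ≤ (s * a y - k m * b y) ^ 2 / s := by positivity
            have h7 : (s * a y - k m * b y) ^ 2 / s =
                s * a y ^ 2 - 2 * (k m * (a y * b y)) + (k m * b y) ^ 2 / s := by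
              field_simp; ring
            linarith
          calc |ζ y| * |fderiv ℝ (κ m) y (Y y)| ≤ B * (1 / 2 * (s * a y ^ 2 + 2 * D * k m / s)) :=
                mul_le_mul (hB y) (h1.trans h3) (abs_nonneg _) hB0
            _ = _ := by ring
        · rw [indicator_of_notMem (fun h : y ∈ S m => hyd h.2)]
          have : fderiv ℝ (κ m) y = 0 := by
            have he : κ m =ᶠ[nhds y] fun _ => 1 := by
              filter_upwards [(isOpen_lt continuous_const hδ.continuous).mem_nhds (not_le.1 hyd)] with z hz
              refine ramp_eq_one ?_
              have hz' : 2 / (k m : ℝ) < δ z := hz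
              rw [div_lt_iff₀ hkm] at hz'
              linarith
            rw [he.fderiv_eq]; simp
          simp [this]
      · rw [hζ0 y hyU hyC, zero_mul, abs_zero]
        exact indicator_nonneg (fun y _ => hnn y) y
    have hvol : volume.real (S m) ≤ A * (2 / k m) := by
      refine hstrip _ (by positivity) ?_
      rw [div_lt_one hkm]
      simp only [hk]; push_cast
      have : (0:ℝ) ≤ m := Nat.cast_nonneg m
      linarith
    calc |∫ y in U, ζ y * fderiv ℝ (κ m) y (Y y)|
        ≤ ∫ y in U, |ζ y * fderiv ℝ (κ m) y (Y y)| := abs_integral_le_integral_abs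
      _ ≤ ∫ y in U, (S m).indicator (fun y => B / 2 * (s * a y ^ 2 + 2 * D * k m / s)) y :=
          setIntegral_mono_on (hi4 m).abs ((integrable_indicator_iff (hSm m)).2 hIon).integrableOn hUm hpt
      _ = ∫ y in S m, B / 2 * (s * a y ^ 2 + 2 * D * k m / s) := by
          rw [setIntegral_indicator (hSm m), inter_eq_self_of_subset_right]
          exact fun y hy => hy.1.1
      _ = B / 2 * (s * (∫ y in S m, a y ^ 2) + volume.real (S m) * (2 * D * k m / s)) := by
          rw [integral_const_mul, integral_add ((ha.mono_set inter_subset_left).const_mul s)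
            (integrableOn_const (hSfin m).ne), integral_const_mul, setIntegral_const, smul_eq_mul]
      _ ≤ B / 2 * (s * (∫ y in S m, a y ^ 2) + A * (2 / k m) * (2 * D * k m / s)) := by gcongr
      _ = _ := by field_simp; ring
  have hT0 : Filter.Tendsto (fun m => ∫ y in U, ζ y * fderiv ℝ (κ m) y (Y y)) Filter.atTop (nhds 0) := by
    rw [Metric.tendsto_nhds]
    intro ε hε
    -- Large enough that the part independent of `m` is at most `ε / 2`; with `s` fixed, the other
    -- part tends to zero by `hJ`.
    set s : ℝ := (4 * B * D * A + 1) / ε with hs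
    have hspos : 0 < s := by positivity
    have h1 := ((hJ.const_mul (B / 2 * s)))
    rw [mul_zero] at h1
    filter_upwards [h1.eventually (gt_mem_nhds (half_pos hε))] with m hm
    rw [Real.dist_0_eq_abs]
    have h2 : B / 2 * (4 * D * A / s) ≤ ε / 2 := by
      rw [hs]
      field_simp
      nlinarith [mul_nonneg (mul_nonneg hB0 hD) hA]
    have h3 := hTb m s hspos
    rw [mul_add, ← mul_assoc] at h3
    linarith
  have hsum : ∀ m, ∫ y in U, ζ y * flatDivergence Y y * κ m y =
      -(∫ y in U, fderiv ℝ ζ y (Y y) * κ m y) - ∫ y in U, ζ y * fderiv ℝ (κ m) y (Y y) := by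
    intro m
    rw [hbase, integral_congr_ae (hsplit' m), integral_sub (hTi m) (hi3 m)]
    ring
  have := (hlim2.neg.sub hT0).congr fun m => (hsum m).symm
  rw [sub_zero] at this
  exact tendsto_nhds_unique hlim1 this

/-- Contracting towards `c` by the factor `1 - l` leaves room for a ball of radius `l * r`: each of
its points is a convex combination of `d` and a point of the ball about `c`. -/
theorem ball_subset_of_convex {K : Set (EuclideanSpace ℝ (Fin p))} (hK : Convex ℝ K)
    {c : EuclideanSpace ℝ (Fin p)} {r l : ℝ} (hr : Metric.ball c r ⊆ K) (hl0 : 0 < l) (hl1 : l ≤ 1)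
    {d : EuclideanSpace ℝ (Fin p)} (hd : d ∈ K) :
    Metric.ball (AffineMap.homothety c (1 - l) d) (l * r) ⊆ K := by
  intro z hz
  set e := c + l⁻¹ • (z - AffineMap.homothety c (1 - l) d) with he
  have h1 : e ∈ K := by
    apply hr
    rw [Metric.mem_ball, dist_eq_norm] at hz ⊢
    rw [he, add_sub_cancel_left, norm_smul, norm_inv, Real.norm_of_nonneg hl0.le,
      inv_mul_lt_iff₀ hl0]
    exact hz
  have h2 := hK hd h1 (sub_nonneg.2 hl1) hl0.le (by ring)
  convert h2 using 1
  rw [he, smul_add, smul_smul, mul_inv_cancel₀ hl0.ne', AffineMap.homothety_apply]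
  simp only [vsub_eq_sub, vadd_eq_add, smul_sub, sub_smul, one_smul]
  abel

/-- `δ` is the distance to the complement of the interior. The strip estimate compares a bounded
piece of `K` with its contraction towards an interior point: the contraction avoids the strip and
loses only volume of order `t`. When `K` is the whole space there is no boundary, and `δ = 1` makes
the last two clauses vacuous thanks to the restrictions `t < 1` and `δ y < 1`. -/
theorem exists_boundary_function {K : Set (EuclideanSpace ℝ (Fin p))} (hK : Convex ℝ K)
    (hKc : IsClosed K) (hne : (interior K).Nonempty) :
    ∃ δ : EuclideanSpace ℝ (Fin p) → ℝ, LipschitzWith 1 δ ∧ (∀ y, 0 < δ y ↔ y ∈ interior K) ∧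
      (∀ R, ∃ A, 0 ≤ A ∧ ∀ t, 0 < t → t < 1 →
        volume.real (interior K ∩ Metric.closedBall 0 R ∩ {y | δ y ≤ t}) ≤ A * t) ∧
      ∀ y ∈ interior K, δ y < 1 → ∃ z ∈ K, z ∉ interior K ∧ ‖y - z‖ ≤ δ y := by
  by_cases huniv : interior K = univ
  · refine ⟨fun _ => 1, LipschitzWith.const' 1, fun y => ⟨fun _ => huniv ▸ mem_univ y, fun _ => one_pos⟩,
      fun R => ⟨0, le_rfl, ?_⟩,
      fun y _ h => absurd h (lt_irrefl _)⟩
    intro t _ ht1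
    have : {y : EuclideanSpace ℝ (Fin p) | (1:ℝ) ≤ t} = ∅ :=
      eq_empty_of_forall_notMem fun y hy => absurd (show (1:ℝ) ≤ t from hy) (not_le.2 ht1)
    rw [this, inter_empty, measureReal_empty, zero_mul]
  have hcne : (interior K)ᶜ.Nonempty := nonempty_compl.2 huniv
  have hcc : IsClosed (interior K)ᶜ := isOpen_interior.isClosed_compl
  refine ⟨fun y => Metric.infDist y (interior K)ᶜ, Metric.lipschitz_infDist_pt _, fun y => ?_,
    fun R => ?_, fun y hy _ => ?_⟩
  · rw [← hcc.notMem_iff_infDist_pos hcne, notMem_compl_iff]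
  · obtain ⟨c, hc⟩ := hne
    obtain ⟨r, hr, hrK⟩ := Metric.isOpen_iff.1 isOpen_interior c hc
    have hrK' := hrK.trans interior_subset
    set D := K ∩ Metric.closedBall c (R + ‖c‖) with hD
    have hDc : IsCompact D := (isCompact_closedBall _ _).inter_left hKc
    have hsub : ∀ t, interior K ∩ Metric.closedBall 0 R ∩ {y | Metric.infDist y (interior K)ᶜ ≤ t} ⊆ D := by
      rintro t y ⟨⟨hy, hyR⟩, -⟩
      refine ⟨interior_subset hy, ?_⟩
      rw [Metric.mem_closedBall, dist_eq_norm] at hyR ⊢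
      rw [sub_zero] at hyR
      exact (norm_sub_le _ _).trans (by linarith)
    have hV : 0 ≤ volume.real D := measureReal_nonneg
    -- For `t > r / 2` the factor `(2 * p + 2) / r * t` exceeds 1 and the trivial bound suffices;
    -- for smaller `t` the contraction argument needs `2 * p / r`.
    refine ⟨(2 * p + 2) / r * volume.real D, by positivity, fun t ht0 _ => ?_⟩
    by_cases htr : r / 2 < t
    · calc _ ≤ volume.real D := measureReal_mono (hsub t) hDc.measure_lt_top.ne
        _ ≤ (2 * p + 2) / r * volume.real D * t := by
          have : 1 ≤ (2 * p + 2) / r * t := by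
            rw [div_mul_eq_mul_div, le_div_iff₀ hr]
            have : (0:ℝ) ≤ p * t := by positivity
            nlinarith
          nlinarith
    -- With this ratio, contracted points are at distance at least `l * r = 2 * t > t` from the
    -- complement, hence outside the strip. The volume lost is `1 - (1 - l) ^ p ≤ p * l` times that
    -- of `D`, by Bernoulli's inequality.
    · set l := 2 * t / r with hl
      have hl0 : 0 < l := by positivity
      have hl1 : l ≤ 1 := by rw [hl, div_le_one hr]; linarith
      have hlr : l * r = 2 * t := by rw [hl]; field_simp
      have himc : IsCompact (AffineMap.homothety c (1 - l) '' D) :=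
        hDc.image (AffineMap.homothety c (1 - l)).continuous_of_finiteDimensional
      have hDconv : Convex ℝ D := hK.inter (convex_closedBall _ _)
      have himD : AffineMap.homothety c (1 - l) '' D ⊆ D := by
        rintro _ ⟨d, hd, rfl⟩
        have hcD : c ∈ D := ⟨interior_subset hc, Metric.mem_closedBall_self
          (by
            have h0 : ‖d - c‖ ≤ R + ‖c‖ := by simpa [dist_eq_norm] using hd.2
            exact (norm_nonneg _).trans h0)⟩
        have := hDconv hd hcD (sub_nonneg.2 hl1) hl0.le (by ring)
        convert this using 1
        rw [AffineMap.homothety_apply]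
        simp only [vsub_eq_sub, vadd_eq_add, smul_sub, sub_smul, one_smul]
        abel
      have hsub2 : interior K ∩ Metric.closedBall 0 R ∩ {y | Metric.infDist y (interior K)ᶜ ≤ t} ⊆
          D \ (AffineMap.homothety c (1 - l) '' D) := by
        intro y hy
        refine ⟨hsub t hy, ?_⟩
        rintro ⟨d, hd, rfl⟩
        have h1 : Metric.ball (AffineMap.homothety c (1 - l) d) (l * r) ⊆ interior K :=
          interior_maximal (ball_subset_of_convex hK hrK' hl0 hl1 hd.1) Metric.isOpen_ball
        have h2 : l * r ≤ Metric.infDist (AffineMap.homothety c (1 - l) d) (interior K)ᶜ := by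
          rw [Metric.le_infDist hcne]
          intro z hz
          by_contra h
          exact hz (h1 (by rw [Metric.mem_ball, dist_comm]; exact not_le.1 h))
        have h3 := hy.2
        rw [mem_ofPred_eq] at h3
        linarith
      calc _ ≤ volume.real (D \ (AffineMap.homothety c (1 - l) '' D)) :=
            measureReal_mono hsub2 (measure_mono sdiff_subset |>.trans_lt hDc.measure_lt_top).ne
        _ = volume.real D - (1 - l) ^ p * volume.real D := by
            rw [measureReal_sdiff himD himc.measurableSet hDc.measure_lt_top.ne]
            congr 1
            rw [measureReal_def, Measure.addHaar_image_homothety, finrank_euclideanSpace_fin,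
              ENNReal.toReal_mul, ENNReal.toReal_ofReal (abs_nonneg _),
              abs_of_nonneg (pow_nonneg (sub_nonneg.2 hl1) p)]
            rfl
        _ ≤ (p * l) * volume.real D := by
            have := one_add_mul_le_pow (a := -l) (by linarith) p
            rw [← sub_eq_add_neg] at this
            nlinarith
        _ ≤ (2 * p + 2) / r * volume.real D * t := by
            rw [hl]
            have : (2 * p + 2) / r * volume.real D * t - p * (2 * t / r) * volume.real D =
              2 / r * volume.real D * t := by ring
            have h2 : 0 ≤ 2 / r * volume.real D * t := by positivity
            linarith
  · obtain ⟨z, hz, hyz⟩ := hcc.exists_infDist_eq_dist hcne y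
    refine ⟨z, ?_, hz, (dist_eq_norm y z ▸ hyz).ge⟩
    have hpos : 0 < Metric.infDist y (interior K)ᶜ :=
      (hcc.notMem_iff_infDist_pos hcne).1 (by simpa using hy)
    have h1 : Metric.ball y (Metric.infDist y (interior K)ᶜ) ⊆ K := by
      intro x hx
      by_contra h
      have := Metric.infDist_le_dist_of_mem (x := y) (show x ∈ (interior K)ᶜ from fun h' => h (interior_subset h'))
      rw [Metric.mem_ball, dist_comm] at hx
      linarith
    have h2 := closure_minimal h1 hKc
    rw [closure_ball y hpos.ne'] at h2
    exact h2 (by rw [Metric.mem_closedBall, dist_comm, hyz])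

end

/-! ### Functions that are Lipschitz for the Riemannian distance -/

section
variable {p : ℕ} {H : Type*} [TopologicalSpace H]
  (I : ModelWithCorners ℝ (EuclideanSpace ℝ (Fin p)) H)
  {M : Type*} [TopologicalSpace M] [ChartedSpace H M] [IsManifold I ∞ M]
  [RiemannianBundle (fun θ : M => TangentSpace I θ)]
  [IsContMDiffRiemannianBundle I ∞ (EuclideanSpace ℝ (Fin p)) (fun θ : M => TangentSpace I θ)]

/-- The distance is at most the length of the coordinate segment, whose speed is the Gram quadratic
form of the constant coordinate velocity `v`. -/
theorem riemannianEDist_symm_le (x : M) {y v : EuclideanSpace ℝ (Fin p)} {t N : ℝ} (ht : 0 ≤ t)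
    (hN : 0 ≤ N)
    (hsub : ∀ s ∈ Icc 0 t, y + s • v ∈ interior (extChartAt I x).target)
    (hb : ∀ s ∈ Icc 0 t, ∑ a, ∑ b, gram I x (y + s • v) a b * v a * v b ≤ N ^ 2) :
    riemannianEDist I ((extChartAt I x).symm y) ((extChartAt I x).symm (y + t • v)) ≤
      ENNReal.ofReal (t * N) := by
  have hI1 : IsManifold I 1 M := IsManifold.of_le (n := ∞) (by simp)
  set η : ℝ → EuclideanSpace ℝ (Fin p) := fun s => y + s • v with hη
  have hηd : ∀ s, HasFDerivAt η (ContinuousLinearMap.toSpanSingleton ℝ v) s := fun s => by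
    have := ((hasDerivAt_id s).smul_const v).const_add y
    rw [one_smul] at this
    exact this.hasFDerivAt
  have hηs : ContDiff ℝ 1 η := contDiff_const.add (contDiff_id.smul contDiff_const)
  have hγ : ContMDiffOn 𝓘(ℝ, ℝ) I 1 ((extChartAt I x).symm ∘ η) (Icc 0 t) :=
    (contMDiffOn_extChartAt_symm x).comp hηs.contMDiff.contMDiffOn
      fun s hs => (interior_subset (hsub s hs) : η s ∈ (extChartAt I x).target)
  refine (riemannianEDist_le_pathELength (a := 0) (b := t) hγ (by simp [hη]) rfl ht).trans ?_
  rw [Manifold.pathELength_eq_lintegral_mfderiv_Ioo]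
  calc ∫⁻ s in Ioo 0 t, ‖mfderiv 𝓘(ℝ, ℝ) I ((extChartAt I x).symm ∘ η) s 1‖ₑ
      ≤ ∫⁻ s in Ioo 0 t, ENNReal.ofReal N := by
        refine setLIntegral_mono' measurableSet_Ioo fun s hs => ?_
        have hs' := Ioo_subset_Icc_self hs
        have hyi := hsub s hs'
        have hy := interior_subset hyi
        set θ := (extChartAt I x).symm (η s) with hθ
        have hθs : θ ∈ (extChartAt I x).source := (extChartAt I x).map_target hy
        set V : TangentSpace I θ := mfderiv 𝓘(ℝ, ℝ) I ((extChartAt I x).symm ∘ η) s 1 with hV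
        have hch : chartDeriv I x θ V = v := by
          have h1 : MDifferentiableAt I 𝓘(ℝ, EuclideanSpace ℝ (Fin p)) (extChartAt I x) θ :=
            mdifferentiableAt_extChartAt (by simpa using hθs)
          have h2 : MDifferentiableAt 𝓘(ℝ, ℝ) I ((extChartAt I x).symm ∘ η) s :=
            (hγ.contMDiffAt (Icc_mem_nhds hs.1 hs.2)).mdifferentiableAt one_ne_zero
          have h3 := mfderiv_comp s h1 h2
          have h4 : mfderiv 𝓘(ℝ, ℝ) 𝓘(ℝ, EuclideanSpace ℝ (Fin p))
              (extChartAt I x ∘ (extChartAt I x).symm ∘ η) s = mfderiv 𝓘(ℝ, ℝ) 𝓘(ℝ, EuclideanSpace ℝ (Fin p)) η s := by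
            refine Filter.EventuallyEq.mfderiv_eq ?_
            filter_upwards [Icc_mem_nhds hs.1 hs.2] with r hr
            exact (extChartAt I x).right_inv (interior_subset (hsub r hr))
          rw [h4, mfderiv_eq_fderiv, (hηd s).fderiv] at h3
          have h5 := congrArg (fun L => L (1:ℝ)) h3
          have h6 : (ContinuousLinearMap.toSpanSingleton ℝ v) (1:ℝ) = v := by simp
          exact h5.symm.trans h6
        have h7 := inner_eq_sum_gram_chart I x hθs V V
        rw [hch, real_inner_self_eq_norm_sq, (extChartAt I x).right_inv hy] at h7
        have h8 : ‖V‖ ≤ N := by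
          have := hb s hs'
          rw [← h7] at this
          exact abs_le_of_sq_le_sq' this hN |>.2
        rw [← ofReal_norm]
        exact ENNReal.ofReal_le_ofReal h8
    _ = ENNReal.ofReal (t * N) := by
        rw [setLIntegral_const, Real.volume_Ioo, sub_zero, mul_comm, ENNReal.ofReal_mul ht]

variable {I}

/-- `χ` is Lipschitz with constant `C` for the Riemannian distance. -/
def IsRiemannianLipschitz (C : ℝ≥0) (χ : M → ℝ) : Prop :=
  ∀ x y, ENNReal.ofReal |χ x - χ y| ≤ C * riemannianEDist I x y

theorem IsRiemannianLipschitz.abs_sub_le {C : ℝ≥0} {χ : M → ℝ} (hχ : IsRiemannianLipschitz (I := I) C χ)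
    {x y : M} {N : ℝ} (hN : 0 ≤ N) (h : riemannianEDist I x y ≤ ENNReal.ofReal N) :
    |χ x - χ y| ≤ C * N := by
  have h1 := (hχ x y).trans (mul_le_mul_right h _)
  rw [← ENNReal.ofReal_coe_nnreal, ← ENNReal.ofReal_mul C.coe_nonneg] at h1
  exact (ENNReal.ofReal_le_ofReal_iff (mul_nonneg C.coe_nonneg hN)).1 h1

variable (I)

theorem continuousAt_gram_form (x : M) {y : EuclideanSpace ℝ (Fin p)}
    (hy : y ∈ interior (extChartAt I x).target) (a b : Fin p) :
    ContinuousAt (fun z => gram I x z a b) y :=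
  (contDiffOn_gram I x a b).continuousOn.continuousAt (mem_interior_iff_mem_nhds.1 hy)

/-- On a small coordinate ball the metric coefficients are bounded, so coordinate segments have
Riemannian length at most a constant times their Euclidean length. -/
theorem locallyLipschitzOn_comp_symm {C : ℝ≥0} {χ : M → ℝ}
    (hχ : IsRiemannianLipschitz (I := I) C χ) (x : M) :
    LocallyLipschitzOn (interior (extChartAt I x).target) (χ ∘ (extChartAt I x).symm) := by
  intro y hy
  have hc : ContinuousAt (fun z => ∑ a, ∑ b, |gram I x z a b|) y := by
    refine tendsto_finsetSum _ fun a _ => tendsto_finsetSum _ fun b _ => ?_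
    exact (continuousAt_gram_form I x hy a b).abs
  set G := ∑ a, ∑ b, |gram I x y a b| + 1 with hG
  have hG0 : 0 < G := by positivity
  have h1 : ∀ᶠ z in nhds y, ∑ a, ∑ b, |gram I x z a b| < G :=
    hc.eventually (gt_mem_nhds (by rw [hG]; linarith))
  obtain ⟨r, hr, hball⟩ := Metric.eventually_nhds_iff_ball.1
    (h1.and (isOpen_interior.mem_nhds hy))
  refine ⟨C * (Real.sqrt G).toNNReal, Metric.ball y r,
    mem_nhdsWithin_of_mem_nhds (Metric.ball_mem_nhds y hr), ?_⟩
  refine LipschitzOnWith.of_dist_le_mul fun z hz z' hz' => ?_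
  have hseg : ∀ s ∈ Icc (0:ℝ) 1, z + s • (z' - z) ∈ Metric.ball y r := fun s hs => by
    have := (convex_ball y r).add_smul_sub_mem hz hz' hs
    exact this
  have h2 := riemannianEDist_symm_le I x (y := z) (v := z' - z) (t := 1)
    (N := Real.sqrt G * dist z z') zero_le_one (by positivity)
    (fun s hs => (hball _ (hseg s hs)).2) (fun s hs => ?_)
  · have h3 := hχ.abs_sub_le (by positivity) h2
    rw [one_smul, add_sub_cancel, one_mul] at h3
    rw [NNReal.coe_mul, Real.coe_toNNReal _ (Real.sqrt_nonneg _), mul_assoc, Real.dist_eq]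
    exact h3
  · rw [mul_pow, Real.sq_sqrt hG0.le]
    have h4 := (hball _ (hseg s hs)).1
    have hcomp : ∀ a, |(z' - z) a| ≤ dist z z' := fun a => by
      rw [dist_comm, dist_eq_norm]
      exact PiLp.norm_apply_le (z' - z) a
    calc ∑ a, ∑ b, gram I x (z + s • (z' - z)) a b * (z' - z) a * (z' - z) b
        ≤ ∑ a, ∑ b, |gram I x (z + s • (z' - z)) a b| * dist z z' ^ 2 := by
          refine Finset.sum_le_sum fun a _ => Finset.sum_le_sum fun b _ => ?_
          refine (le_abs_self _).trans ?_
          rw [abs_mul, abs_mul, mul_assoc, sq]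
          exact mul_le_mul_of_nonneg_left (mul_le_mul (hcomp a) (hcomp b) (abs_nonneg _) dist_nonneg) (abs_nonneg _)
      _ = (∑ a, ∑ b, |gram I x (z + s • (z' - z)) a b|) * dist z z' ^ 2 := by
          simp only [Finset.sum_mul]
      _ ≤ G * dist z z' ^ 2 := by gcongr

/-- Follow the coordinate line with initial velocity `V`. By continuity of the metric its length up
to time `t` is at most `t * (‖V‖ + ε')` for small `t`, which bounds the difference quotients. -/
theorem abs_dirDeriv_le {C : ℝ≥0} {χ : M → ℝ} (hχ : IsRiemannianLipschitz (I := I) C χ) {θ : M}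
    (hθ : θ ∈ I.interior M) (hd : MDifferentiableAt I 𝓘(ℝ, ℝ) χ θ) (V : TangentSpace I θ) :
    |dirDeriv I χ θ V| ≤ C * ‖V‖ := by
  set y := extChartAt I θ θ with hy
  have hyi : y ∈ interior (extChartAt I θ).target := mem_interior_target_self I hθ
  have hsy : (extChartAt I θ).symm y = θ := extChartAt_to_inv θ
  set v := chartDeriv I θ θ V with hv
  have hd' : MDifferentiableAt I 𝓘(ℝ, ℝ) χ ((extChartAt I θ).symm y) := by rwa [hsy]
  have hDχ : DifferentiableAt ℝ (χ ∘ (extChartAt I θ).symm) y :=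
    (mdifferentiableAt_symm_iff I θ hyi).1 hd'
  have heq : dirDeriv I χ θ V = fderiv ℝ (χ ∘ (extChartAt I θ).symm) y v := by
    have h1 := fun V' => dirDeriv_eq_fderiv I θ hyi hd' V'
    rw [hsy] at h1
    exact h1 V
  have hnorm : ∑ a, ∑ b, gram I θ y a b * v a * v b = ‖V‖ ^ 2 := by
    rw [← real_inner_self_eq_norm_sq, inner_eq_sum_gram_chart I θ (mem_extChartAt_source θ) V V]
  rw [heq]
  refine le_of_forall_pos_le_add fun ε hε => ?_
  obtain ⟨ε', hε', hε'C⟩ : ∃ ε' > 0, C * ε' ≤ ε := by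
    refine ⟨ε / (C + 1), div_pos hε (by positivity), ?_⟩
    have h0 := C.coe_nonneg
    rw [mul_div_assoc', div_le_iff₀ (by positivity)]
    nlinarith
  have hline : ContinuousAt (fun s : ℝ => y + s • v) 0 := by fun_prop
  have hline0 : (fun s : ℝ => y + s • v) 0 = y := by simp
  have hc : ContinuousAt (fun s : ℝ => ∑ a, ∑ b, gram I θ (y + s • v) a b * v a * v b) 0 := by
    refine tendsto_finsetSum _ fun a _ => tendsto_finsetSum _ fun b _ => ?_
    refine (ContinuousAt.mul (ContinuousAt.mul ?_ continuousAt_const) continuousAt_const)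
    exact ContinuousAt.comp (f := fun s : ℝ => y + s • v) (g := fun z => gram I θ z a b)
      (by simp only [zero_smul, add_zero]; exact continuousAt_gram_form I θ hyi a b) hline
  have h1 : ∀ᶠ s in nhds (0:ℝ), ∑ a, ∑ b, gram I θ (y + s • v) a b * v a * v b < (‖V‖ + ε') ^ 2 := by
    refine hc.eventually (gt_mem_nhds ?_)
    simp only [zero_smul, add_zero]
    rw [hnorm]
    nlinarith [norm_nonneg V]
  have h2 : ∀ᶠ s in nhds (0:ℝ), y + s • v ∈ interior (extChartAt I θ).target :=
    hline.eventually (by rw [hline0]; exact isOpen_interior.mem_nhds hyi)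
  obtain ⟨r, hr, hball⟩ := Metric.eventually_nhds_iff_ball.1 (h1.and h2)
  have hderiv : HasDerivAt (fun s : ℝ => (χ ∘ (extChartAt I θ).symm) (y + s • v))
      (fderiv ℝ (χ ∘ (extChartAt I θ).symm) y v) 0 := by
    have h3 : HasDerivAt (fun s : ℝ => y + s • v) v 0 := by
      have := ((hasDerivAt_id (0:ℝ)).smul_const v).const_add y
      rwa [one_smul] at this
    have h4 : HasFDerivAt (χ ∘ (extChartAt I θ).symm) (fderiv ℝ (χ ∘ (extChartAt I θ).symm) y)
      ((fun s : ℝ => y + s • v) 0) := by rw [hline0]; exact hDχ.hasFDerivAt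
    exact h4.comp_hasDerivAt 0 h3
  have hlim := hderiv.tendsto_slope_zero_right.abs
  have hle : ∀ᶠ t in nhdsWithin (0:ℝ) (Ioi 0),
      |t⁻¹ • ((χ ∘ (extChartAt I θ).symm) (y + (0 + t) • v) - (χ ∘ (extChartAt I θ).symm) (y + (0:ℝ) • v))| ≤
        C * (‖V‖ + ε') := by
    filter_upwards [Ioo_mem_nhdsGT hr] with t ht
    have hs : ∀ s ∈ Icc 0 t, s ∈ Metric.ball (0:ℝ) r := fun s hs => by
      rw [Metric.mem_ball, Real.dist_0_eq_abs, abs_of_nonneg hs.1]; linarith [hs.2, ht.2]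
    have h5 := riemannianEDist_symm_le I θ (y := y) (v := v) (t := t) (N := ‖V‖ + ε') ht.1.le
      (by positivity) (fun s hst => (hball s (hs s hst)).2) (fun s hst => (hball s (hs s hst)).1.le)
    have h6 := hχ.abs_sub_le (mul_nonneg ht.1.le (by positivity)) h5
    rw [smul_eq_mul, abs_mul, abs_inv, abs_of_pos ht.1, inv_mul_le_iff₀ ht.1, zero_add, zero_smul, add_zero,
      abs_sub_comm]
    refine h6.trans (le_of_eq (by ring))
  have := le_of_tendsto hlim hle
  linarith

end

/-! ### Decay at the boundary and null sets in charts -/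

section
variable {p : ℕ} {H : Type*} [TopologicalSpace H]
  (I : ModelWithCorners ℝ (EuclideanSpace ℝ (Fin p)) H)
  {M : Type*} [TopologicalSpace M] [ChartedSpace H M] [IsManifold I ∞ M]
  [RiemannianBundle (fun θ : M => TangentSpace I θ)]
  [IsContMDiffRiemannianBundle I ∞ (EuclideanSpace ℝ (Fin p)) (fun θ : M => TangentSpace I θ)]

/-- Unlike `dirDeriv_eq_fderiv` this needs no differentiability: where it fails, both derivatives
take the default value zero. -/
theorem dirDeriv_symm {φ : M → ℝ} (x : M) {y : EuclideanSpace ℝ (Fin p)}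
    (hy : y ∈ interior (extChartAt I x).target)
    (V : TangentSpace I ((extChartAt I x).symm y)) :
    dirDeriv I φ ((extChartAt I x).symm y) V =
      fderiv ℝ (φ ∘ (extChartAt I x).symm) y (chartDeriv I x ((extChartAt I x).symm y) V) := by
  by_cases h : MDifferentiableAt I 𝓘(ℝ, ℝ) φ ((extChartAt I x).symm y)
  · exact dirDeriv_eq_fderiv I x hy h V
  · have h' := mt (mdifferentiableAt_symm_iff I x hy).2 h
    rw [dirDeriv, mfderiv_zero_of_not_mdifferentiableAt h, fderiv_zero_of_not_differentiableAt h']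
    rfl

/-- The Gram form is positive on the compact product of `C` with the unit sphere, hence bounded
below there by some `m > 0`; the constant is $m^{-1/2}$. -/
theorem exists_norm_chartDeriv_le (x : M) {C : Set (EuclideanSpace ℝ (Fin p))} (hC : IsCompact C)
    (hCT : C ⊆ (extChartAt I x).target) :
    ∃ c : ℝ, 0 ≤ c ∧ ∀ y ∈ C, ∀ V : TangentSpace I ((extChartAt I x).symm y),
      ‖chartDeriv I x ((extChartAt I x).symm y) V‖ ≤ c * ‖V‖ := by
  set G : EuclideanSpace ℝ (Fin p) × EuclideanSpace ℝ (Fin p) → ℝ :=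
    fun z => ∑ a, ∑ b, gram I x z.1 a b * z.2 a * z.2 b with hG
  have hGc : ContinuousOn G (C ×ˢ Metric.sphere 0 1) := by
    refine continuousOn_finsetSum _ fun a _ => continuousOn_finsetSum _ fun b _ => ?_
    have h1 : ContinuousOn (fun z : EuclideanSpace ℝ (Fin p) × EuclideanSpace ℝ (Fin p) => gram I x z.1 a b)
        (C ×ˢ Metric.sphere 0 1) :=
      ((contDiffOn_gram I x a b).continuousOn.mono hCT).comp continuousOn_fst fun z hz => hz.1
    have h2 : ∀ a, ContinuousOn (fun z : EuclideanSpace ℝ (Fin p) × EuclideanSpace ℝ (Fin p) => z.2 a)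
        (C ×ˢ Metric.sphere 0 1) := fun a => by fun_prop
    exact (h1.mul (h2 a)).mul (h2 b)
  have hpos : ∀ y ∈ (extChartAt I x).target, ∀ v, v ≠ 0 → 0 < G (y, v) := by
    intro y hy v hv
    have := (gram_posDef I x hy).dotProduct_mulVec_pos (x := fun a => v a) (fun h => hv (by
      ext a; exact congrFun h a))
    simp only [dotProduct, Matrix.mulVec, star_trivial, Pi.star_apply, Finset.mul_sum] at this
    simp only [hG]
    calc 0 < _ := this
      _ = _ := Finset.sum_congr rfl fun a _ => Finset.sum_congr rfl fun b _ => by ring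
  obtain ⟨m, hm, hmG⟩ : ∃ m, 0 < m ∧ ∀ z ∈ C ×ˢ Metric.sphere (0 : EuclideanSpace ℝ (Fin p)) 1, m ≤ G z := by
    rcases (C ×ˢ Metric.sphere (0 : EuclideanSpace ℝ (Fin p)) 1).eq_empty_or_nonempty with he | hne
    · exact ⟨1, one_pos, fun z hz => by simp [he] at hz⟩
    · obtain ⟨z, hz, hmin⟩ := (hC.prod (isCompact_sphere _ _)).exists_isMinOn hne hGc
      refine ⟨G z, hpos z.1 (hCT hz.1) z.2 ?_, fun w hw => hmin hw⟩
      intro h0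
      have := hz.2
      simp [h0] at this
  refine ⟨(Real.sqrt m)⁻¹, by positivity, fun y hy V => ?_⟩
  have hyT := hCT hy
  set v := chartDeriv I x ((extChartAt I x).symm y) V with hv
  have h1 : ‖V‖ ^ 2 = G (y, v) := by
    have h := inner_eq_sum_gram_chart I x ((extChartAt I x).map_target hyT) V V
    rwa [real_inner_self_eq_norm_sq, (extChartAt I x).right_inv hyT] at h
  by_cases hv0 : v = 0
  · rw [hv0, norm_zero]; positivity
  have hvn : 0 < ‖v‖ := norm_pos_iff.2 hv0
  have h2 := hmG (y, ‖v‖⁻¹ • v) ⟨hy, by simp [norm_smul, hvn.ne']⟩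
  have h3 : G (y, ‖v‖⁻¹ • v) = (‖v‖⁻¹) ^ 2 * G (y, v) := by
    simp only [hG, PiLp.smul_apply, smul_eq_mul, Finset.mul_sum]
    exact Finset.sum_congr rfl fun a _ => Finset.sum_congr rfl fun b _ => by ring
  rw [h3, ← h1, inv_pow, inv_mul_eq_div, le_div_iff₀ (by positivity)] at h2
  rw [inv_mul_eq_div, le_div_iff₀ (Real.sqrt_pos.2 hm)]
  refine abs_le_of_sq_le_sq' ?_ (norm_nonneg _) |>.2
  rw [mul_pow, Real.sq_sqrt hm.le]
  linarith

variable {I} in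
/-- In each chart, `b²` is dominated by a Lipschitz function that vanishes on the boundary. -/
def HasBoundaryDecay (b : M → ℝ) : Prop :=
  ∀ (x : M) (C : Set (EuclideanSpace ℝ (Fin p))), IsCompact C → C ⊆ (extChartAt I x).target →
    ∃ (L : ℝ≥0) (h : EuclideanSpace ℝ (Fin p) → ℝ), LipschitzOnWith L h C ∧
      (∀ y ∈ C, b ((extChartAt I x).symm y) ^ 2 ≤ h y) ∧
      ∀ y ∈ C, y ∉ interior (extChartAt I x).target → h y = 0

/-- Close to the boundary, compare `y` with a boundary point `z` at distance at most `δ y`, where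
`h` vanishes, and use the Lipschitz bound. Elsewhere `δ` is bounded below and boundedness of `h`
suffices. -/
theorem HasBoundaryDecay.exists_le {b : M → ℝ} (hb : HasBoundaryDecay (I := I) b) (x : M)
    {δ : EuclideanSpace ℝ (Fin p) → ℝ}
    (hδ : ∀ y ∈ interior (range I), δ y < 1 → ∃ z ∈ range I, z ∉ interior (range I) ∧ ‖y - z‖ ≤ δ y)
    {C : Set (EuclideanSpace ℝ (Fin p))} (hC : IsCompact C) (hCT : C ⊆ (extChartAt I x).target) :
    ∃ D, 0 ≤ D ∧ ∀ y ∈ interior (extChartAt I x).target ∩ C,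
      b ((extChartAt I x).symm y) ^ 2 ≤ D * δ y := by
  obtain ⟨O, hO, hOT⟩ : ∃ O, IsOpen O ∧ (extChartAt I x).target = O ∩ range I := by
    refine ⟨I.symm ⁻¹' (chartAt H x).target, (chartAt H x).open_target.preimage I.continuous_symm, ?_⟩
    rw [extChartAt_target]
  -- The nearby boundary point may leave `C`, so the decay hypothesis is applied on a thickening of
  -- `C` that still lies in the chart target.
  obtain ⟨ε, hε, hεO⟩ := hC.exists_cthickening_subset_open hO
    (fun y hy => (hOT ▸ hCT hy : y ∈ O ∩ range I).1)
  set C' := Metric.cthickening ε C ∩ range I with hC'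
  have hC'c : IsCompact C' := hC.cthickening.inter_right I.isClosed_range
  have hC'T : C' ⊆ (extChartAt I x).target := by
    rw [hOT]; exact inter_subset_inter_left _ hεO
  have hCC' : C ⊆ C' := fun y hy =>
    ⟨Metric.self_subset_cthickening C hy, extChartAt_target_subset_range x (hCT hy)⟩
  obtain ⟨L, h, hL, hbh, h0⟩ := hb x C' hC'c hC'T
  obtain ⟨B, hB⟩ := hC.exists_bound_of_continuousOn (hL.continuousOn.mono hCC')
  have hm : 0 < min ε 1 := lt_min hε one_pos
  refine ⟨max L (max B 0 / min ε 1), le_max_of_le_left L.coe_nonneg, fun y hy => ?_⟩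
  have hyK : y ∈ interior (range I) := interior_mono (extChartAt_target_subset_range x) hy.1
  refine (hbh y (hCC' hy.2)).trans ?_
  by_cases hd : δ y < min ε 1
  · obtain ⟨z, hzK, hzi, hyz⟩ := hδ y hyK (hd.trans_le (min_le_right _ _))
    have hzC : z ∈ C' := by
      refine ⟨Metric.mem_cthickening_of_dist_le z y ε C hy.2 ?_, hzK⟩
      rw [dist_comm, dist_eq_norm]
      exact hyz.trans (hd.le.trans (min_le_left _ _))
    have hz0 := h0 z hzC fun hz => hzi (interior_mono (extChartAt_target_subset_range x) hz)
    have h1 := hL.dist_le_mul y (hCC' hy.2) z hzC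
    rw [hz0, Real.dist_eq, sub_zero, dist_eq_norm] at h1
    have h2 : 0 ≤ δ y := (norm_nonneg _).trans hyz
    calc h y ≤ |h y| := le_abs_self _
      _ ≤ L * ‖y - z‖ := h1
      _ ≤ L * δ y := mul_le_mul_of_nonneg_left hyz L.coe_nonneg
      _ ≤ _ := mul_le_mul_of_nonneg_right (le_max_left _ _) h2
  · push Not at hd
    calc h y ≤ |h y| := le_abs_self _
      _ ≤ max B 0 := (hB y hy.2).trans (le_max_left _ _)
      _ = max B 0 / min ε 1 * min ε 1 := by field_simp
      _ ≤ max B 0 / min ε 1 * δ y := mul_le_mul_of_nonneg_left hd (by positivity)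
      _ ≤ _ := mul_le_mul_of_nonneg_right (le_max_right _ _) (hm.le.trans hd)

variable [T2Space M] [SigmaCompactSpace M] [MeasurableSpace M] [BorelSpace M]

theorem ae_of_charts {P : M → Prop}
    (h : ∀ x : M, ∀ᵐ y, y ∈ interior (extChartAt I x).target → P ((extChartAt I x).symm y)) :
    ∀ᵐ θ ∂(riemannianVolume I), P θ := by
  rw [ae_iff]
  refine riemannianVolume_eq_zero_of_source I fun x => ?_
  have hT := measurableSet_extChartAt_target I x
  set N : Set (EuclideanSpace ℝ (Fin p)) :=
    (extChartAt I x).target ∩ {y | ¬ P ((extChartAt I x).symm y)} with hN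
  have hN0 : volume N = 0 := by
    rw [measure_eq_zero_iff_ae_notMem]
    have h2 := volume_target_diff_interior I x
    rw [measure_eq_zero_iff_ae_notMem] at h2
    filter_upwards [h x, h2] with y hy hy2 hyN
    exact hyN.2 (hy (by_contra fun h => hy2 ⟨hyN.1, h⟩))
  -- `P` is arbitrary, so the exceptional set need not be measurable and is replaced by a measurable
  -- hull before it is carried to the manifold.
  set N' := (extChartAt I x).target ∩ toMeasurable volume N with hN'
  have hN'm : MeasurableSet N' := hT.inter (measurableSet_toMeasurable _ _)
  have hB : MeasurableSet ((extChartAt I x).symm '' N') := by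
    have := (measurableEmbedding_symm I x).measurableSet_image.2 (hN'm.preimage measurable_subtype_coe)
    convert this using 1
    ext θ
    constructor
    · rintro ⟨y, hy, rfl⟩
      exact ⟨⟨y, hy.1⟩, hy, rfl⟩
    · rintro ⟨y, hy, rfl⟩
      exact ⟨y, hy, rfl⟩
  have hBs : (extChartAt I x).symm '' N' ⊆ (extChartAt I x).source := by
    rintro _ ⟨y, hy, rfl⟩
    exact (extChartAt I x).map_target hy.1
  refine measure_mono_null ?_ ((riemannianVolume_null_iff I x hB hBs).2 ?_)
  · rintro θ ⟨hθ, hθs⟩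
    refine ⟨extChartAt I x θ, ⟨(extChartAt I x).map_source hθs, subset_toMeasurable _ _ ⟨(extChartAt I x).map_source hθs, ?_⟩⟩,
      (extChartAt I x).left_inv hθs⟩
    rw [mem_ofPred_eq, (extChartAt I x).left_inv hθs]
    exact hθ
  · refine measure_mono_null ?_ (measure_toMeasurable (μ := volume) N ▸ hN0)
    rintro y ⟨hy, z, hz, hzy⟩
    rw [← (extChartAt I x).symm.injOn hz.1 hy hzy]
    exact hz.2

theorem ae_mdifferentiableAt {C : ℝ≥0} {χ : M → ℝ} (hχ : IsRiemannianLipschitz (I := I) C χ) :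
    ∀ᵐ θ ∂(riemannianVolume I), MDifferentiableAt I 𝓘(ℝ, ℝ) χ θ :=
  ae_of_charts I fun x => by
    filter_upwards [ae_differentiableAt_of_locallyLipschitzOn isOpen_interior
      (locallyLipschitzOn_comp_symm I hχ x)] with y hy hyi
    exact (mdifferentiableAt_symm_iff I x hyi).2 (hy hyi)

theorem IsRiemannianLipschitz.continuous {C : ℝ≥0} {χ : M → ℝ}
    (hχ : IsRiemannianLipschitz (I := I) C χ) : Continuous χ := by
  have hI1 : IsManifold I 1 M := IsManifold.of_le (n := ∞) (by simp)
  have : IsContinuousRiemannianBundle (EuclideanSpace ℝ (Fin p)) (fun θ : M => TangentSpace I θ) := by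
    obtain ⟨g, hg, h⟩ := IsContMDiffRiemannianBundle.exists_contMDiff (IB := I) (n := ∞)
      (F := EuclideanSpace ℝ (Fin p)) (E := fun θ : M => TangentSpace I θ)
    exact ⟨g, hg.continuous, h⟩
  rw [continuous_iff_continuousAt]
  intro x
  rw [ContinuousAt, Metric.tendsto_nhds]
  intro ε hε
  have hC : 0 < ε / (C + 1) := div_pos hε (by positivity)
  filter_upwards [eventually_riemannianEDist_lt I x (ENNReal.ofReal_pos.2 hC)] with y hy
  have := hχ.abs_sub_le hC.le hy.le
  rw [dist_comm, Real.dist_eq]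
  refine this.trans_lt ?_
  rw [mul_div_assoc', div_lt_iff₀ (by positivity)]
  nlinarith

end

/-! ### Stokes fields: integration by parts in one chart -/

section
variable {p : ℕ} {H : Type*} [TopologicalSpace H]
  (I : ModelWithCorners ℝ (EuclideanSpace ℝ (Fin p)) H)
  {M : Type*} [TopologicalSpace M] [ChartedSpace H M] [IsManifold I ∞ M]
  [RiemannianBundle (fun θ : M => TangentSpace I θ)]
  [IsContMDiffRiemannianBundle I ∞ (EuclideanSpace ℝ (Fin p)) (fun θ : M => TangentSpace I θ)]
  [T2Space M] [SigmaCompactSpace M] [MeasurableSpace M] [BorelSpace M]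

/-- The hypotheses on a vector field `X` under which its divergence integrates to zero: `X` is `C¹`
in the interior, `X` and its divergence are integrable, and `‖X‖` is dominated by a product of two
functions, the first square integrable and the second decaying at the boundary. -/
structure IsStokesField (X : (θ : M) → TangentSpace I θ) : Prop where
  c1 : ∀ θ ∈ I.interior M, ContMDiffAt I I.tangent 1 (fun θ => (⟨θ, X θ⟩ : TangentBundle I M)) θ
  integrable_norm : Integrable (fun θ => ‖X θ‖) (riemannianVolume I)
  integrable_divergence : Integrable (divergence I X) (riemannianVolume I)
  exists_le : ∃ a b : M → ℝ, (∀ θ ∈ I.interior M, ‖X θ‖ ≤ a θ * b θ) ∧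
    Integrable (fun θ => a θ ^ 2) (riemannianVolume I) ∧ HasBoundaryDecay (I := I) b

variable {I}

theorem dirDeriv_eq_zero_of_notMem_tsupport {φ : M → ℝ} {θ : M} (h : θ ∉ tsupport φ)
    (V : TangentSpace I θ) : dirDeriv I φ θ V = 0 := by
  have h1 : φ =ᶠ[nhds θ] fun _ => 0 := notMem_tsupport_iff_eventuallyEq.1 h
  rw [dirDeriv, h1.mfderiv_eq, mfderiv_const]
  rfl

/-- In the chart this is `integral_mul_flatDivergence` for the vector density $\sqrt{|g|}X$ and the
test function $\psi\chi$. The factor `ψ` localizes to the chart and comes from a partition of unity;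
`χ` is a distance cutoff and so only Lipschitz. -/
theorem IsStokesField.integral_mul_divergence_of_chart {X : (θ : M) → TangentSpace I θ}
    (hX : IsStokesField I X) (x : M) {C : ℝ≥0} {χ : M → ℝ} (hχ : IsRiemannianLipschitz (I := I) C χ)
    (hχ1 : ∀ θ, |χ θ| ≤ 1) {ψ : M → ℝ} (hψ : ContMDiff I 𝓘(ℝ, ℝ) ∞ ψ) (hψ1 : ∀ θ, |ψ θ| ≤ 1)
    (hψc : IsCompact (tsupport ψ)) (hψs : tsupport ψ ⊆ (extChartAt I x).source) :
    Integrable (fun θ => dirDeriv I (fun τ => ψ τ * χ τ) θ (X θ)) (riemannianVolume I) ∧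
      ∫ θ, ψ θ * χ θ * divergence I X θ ∂(riemannianVolume I) =
        -∫ θ, dirDeriv I (fun τ => ψ τ * χ τ) θ (X θ) ∂(riemannianVolume I) := by
  obtain ⟨a, b, hab, ha, hb⟩ := hX.exists_le
  obtain ⟨δ, hδL, hδpos, hδstrip, hδz⟩ := exists_boundary_function I.convex_range I.isClosed_range
    I.nonempty_interior
  set T := (extChartAt I x).target with hT
  set U := interior T with hU
  have hUo : IsOpen U := isOpen_interior
  have hUT : U ⊆ T := interior_subset
  have hTm : MeasurableSet T := measurableSet_extChartAt_target I x
  have hUae : volume.restrict U = volume.restrict T :=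
    Measure.restrict_congr_set (ae_eq_set.2 ⟨by simp [sdiff_eq_empty.2 hUT], volume_target_diff_interior I x⟩)
  set φ := (extChartAt I x).symm with hφ
  set K := extChartAt I x '' tsupport ψ with hK
  have hKc : IsCompact K := hψc.image_of_continuousOn ((continuousOn_extChartAt x).mono hψs)
  have hKT : K ⊆ T := by
    rintro _ ⟨θ, hθ, rfl⟩
    exact (extChartAt I x).map_source (hψs hθ)
  have hφK : ∀ y ∈ T, y ∉ K → φ y ∉ tsupport ψ := fun y hy hyK h =>
    hyK ⟨φ y, h, (extChartAt I x).right_inv hy⟩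
  obtain ⟨c, hc0, hc⟩ := exists_norm_chartDeriv_le I x hKc hKT
  obtain ⟨D, hD0, hD⟩ := hb.exists_le I x hδz hKc hKT
  obtain ⟨R, hR⟩ := hKc.isBounded.subset_closedBall 0
  obtain ⟨A, hA0, hA⟩ := hδstrip R
  have hsd : ContinuousOn (sqrtDetMetric I x) T := (contDiffOn_sqrtDetMetric I x).continuousOn
  set Y : EuclideanSpace ℝ (Fin p) → EuclideanSpace ℝ (Fin p) :=
    fun y => sqrtDetMetric I x y • coordField I x X y with hY
  have hφi : ∀ y ∈ U, φ y ∈ I.interior M := fun y hy => (mem_interior_target_iff I x (hUT hy)).1 hy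
  have hYc : ContDiffOn ℝ 1 Y U := fun y hy =>
    (contDiffAt_smul_coordField I x hy (hX.c1 _ (hφi y hy))).contDiffWithinAt
  have hYn : ∀ y ∈ U ∩ K, ‖Y y‖ ≤ sqrtDetMetric I x y * (c * ‖X (φ y)‖) := fun y hy => by
    rw [hY, norm_smul, Real.norm_of_nonneg (sqrtDetMetric_pos I x (hUT hy.1)).le]
    exact mul_le_mul_of_nonneg_left (hc y hy.2 _) (sqrtDetMetric_pos I x (hUT hy.1)).le
  have hdiv : ∀ y ∈ U, flatDivergence Y y = sqrtDetMetric I x y * divergence I X (φ y) := fun y hy =>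
    (sqrtDetMetric_mul_divergence I x hy (hX.c1 _ (hφi y hy))).symm
  set ζ : EuclideanSpace ℝ (Fin p) → ℝ := (fun τ => ψ τ * χ τ) ∘ φ with hζ
  have hd : ∀ y ∈ U, fderiv ℝ ζ y (Y y) =
      sqrtDetMetric I x y * dirDeriv I (fun τ => ψ τ * χ τ) (φ y) (X (φ y)) := fun y hy => by
    rw [dirDeriv_symm I x hy, hY, map_smul, smul_eq_mul]
    rfl
  have hψC : ContDiffOn ℝ 1 (ψ ∘ φ) T :=
    contMDiffOn_iff_contDiffOn.1 ((hψ.of_le (by simp)).comp_contMDiffOn (contMDiffOn_extChartAt_symm x))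
  have hψU : ContDiffOn ℝ 1 (ψ ∘ φ) U := hψC.mono hUT
  have hζL : LocallyLipschitzOn U ζ := by
    intro y hy
    obtain ⟨L1, t1, ht1, hL1⟩ := (hψU.contDiffAt (hUo.mem_nhds hy)).exists_lipschitzOnWith
    obtain ⟨L2, t2, ht2, hL2⟩ := locallyLipschitzOn_comp_symm I hχ x hy
    refine ⟨L1 + L2, t1 ∩ t2, Filter.inter_mem (mem_nhdsWithin_of_mem_nhds ht1) ht2, ?_⟩
    refine LipschitzOnWith.of_dist_le_mul fun z hz z' hz' => ?_
    have h1 := hL1.dist_le_mul z hz.1 z' hz'.1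
    have h2 := hL2.dist_le_mul z hz.2 z' hz'.2
    rw [Real.dist_eq] at h1 h2 ⊢
    have h3 := hχ1 (φ z)
    have h4 := hψ1 (φ z')
    calc |ψ (φ z) * χ (φ z) - ψ (φ z') * χ (φ z')|
        = |χ (φ z) * (ψ (φ z) - ψ (φ z')) + ψ (φ z') * (χ (φ z) - χ (φ z'))| := by ring_nf
      _ ≤ |χ (φ z)| * |ψ (φ z) - ψ (φ z')| + |ψ (φ z')| * |χ (φ z) - χ (φ z')| := by
        rw [← abs_mul, ← abs_mul]; exact abs_add_le _ _
      _ ≤ 1 * (L1 * dist z z') + 1 * (L2 * dist z z') := by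
        gcongr
        · exact h1
        · exact h2
      _ = _ := by push_cast; ring
  have hζ1 : ∀ y, |ζ y| ≤ 1 := fun y => by
    simp only [hζ, Function.comp, abs_mul]
    exact mul_le_one₀ (hψ1 _) (abs_nonneg _) (hχ1 _)
  have hζ0 : ∀ y ∈ U, y ∉ K → ζ y = 0 := fun y hy hyK => by
    simp [hζ, image_eq_zero_of_notMem_tsupport (hφK y (hUT hy) hyK)]
  obtain ⟨N, hN0, hN⟩ : ∃ N : ℝ, 0 ≤ N ∧ ∀ y ∈ K, ‖fderivWithin ℝ (ψ ∘ φ) T y‖ ≤ N := by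
    obtain ⟨N, hN⟩ := hKc.exists_bound_of_continuousOn ((hψC.continuousOn_fderivWithin
      (uniqueDiffOn_extChartAt_target x) le_rfl).mono hKT)
    exact ⟨max N 0, le_max_right _ _, fun y hy => (hN y hy).trans (le_max_left _ _)⟩
  have hN' : ∀ y ∈ U ∩ K, ‖fderiv ℝ (ψ ∘ φ) y‖ ≤ N := fun y hy => by
    rw [← fderivWithin_of_mem_nhds (mem_interior_iff_mem_nhds.1 hy.1)]
    exact hN y hy.2
  have hmeas : Continuous fun θ => ψ θ * χ θ := hψ.continuous.mul (hχ.continuous I)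
  -- integrability of the two sides
  have hI1 : Integrable (fun θ => ψ θ * χ θ * divergence I X θ) (riemannianVolume I) :=
    hX.integrable_divergence.bdd_mul (c := 1) hmeas.aestronglyMeasurable
      (Filter.Eventually.of_forall fun θ => by
        rw [Real.norm_eq_abs, abs_mul]
        exact mul_le_one₀ (hψ1 _) (abs_nonneg _) (hχ1 _))
  have hi1 : IntegrableOn (fun y => ζ y * flatDivergence Y y) U := by
    have h1 := ((integrableOn_source_iff I x _).1 hI1.integrableOn).mono_set hUT
    refine h1.congr_fun (fun y hy => ?_) hUo.measurableSet
    simp only [hdiv y hy, hζ, Function.comp]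
    ring
  have hXi := ((integrableOn_source_iff I x _).1 hX.integrable_norm.integrableOn).mono_set hUT
  have hdχ := ae_differentiableAt_of_locallyLipschitzOn hUo (locallyLipschitzOn_comp_symm I hχ x)
  have hYm : AEStronglyMeasurable Y (volume.restrict U) :=
    hYc.continuousOn.aestronglyMeasurable hUo.measurableSet
  have hi2 : IntegrableOn (fun y => fderiv ℝ ζ y (Y y)) U := by
    refine (hXi.const_mul (C + N * c)).mono' (isBoundedBilinearMap_apply.continuous.comp_aestronglyMeasurable
      ((measurable_fderiv ℝ ζ).stronglyMeasurable.aestronglyMeasurable.prodMk hYm)) ?_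
    rw [ae_restrict_iff' hUo.measurableSet]
    filter_upwards [hdχ] with y hyd hy
    have hsd0 := (sqrtDetMetric_pos I x (hUT hy)).le
    by_cases hyK : y ∈ K
    · have h1 : DifferentiableAt ℝ (ψ ∘ φ) y :=
        (hψU.contDiffAt (hUo.mem_nhds hy)).differentiableAt one_ne_zero
      have h2 := hyd hy
      have h3 : fderiv ℝ ζ y (Y y) = ψ (φ y) * fderiv ℝ (χ ∘ φ) y (Y y) +
          χ (φ y) * fderiv ℝ (ψ ∘ φ) y (Y y) := by
        have : ζ = fun z => (ψ ∘ φ) z * (χ ∘ φ) z := rfl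
        rw [this, fderiv_fun_mul h1 h2]
        rfl
      have h4 : |fderiv ℝ (χ ∘ φ) y (Y y)| ≤ sqrtDetMetric I x y * (C * ‖X (φ y)‖) := by
        have h5 := abs_dirDeriv_le I hχ (hφi y hy) ((mdifferentiableAt_symm_iff I x hy).2 h2) (X (φ y))
        have h6 : fderiv ℝ (χ ∘ φ) y (Y y) = sqrtDetMetric I x y * dirDeriv I χ (φ y) (X (φ y)) := by
          rw [dirDeriv_symm I x hy, hY, map_smul, smul_eq_mul]
          rfl
        rw [h6, abs_mul, abs_of_nonneg hsd0]
        exact mul_le_mul_of_nonneg_left h5 hsd0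
      have h7 : |fderiv ℝ (ψ ∘ φ) y (Y y)| ≤ N * (sqrtDetMetric I x y * (c * ‖X (φ y)‖)) :=
        (ContinuousLinearMap.le_opNorm _ _).trans (mul_le_mul (hN' y ⟨hy, hyK⟩) (hYn y ⟨hy, hyK⟩)
          (norm_nonneg _) ((norm_nonneg _).trans (hN' y ⟨hy, hyK⟩)))
      have h8 := hψ1 (φ y)
      have h9 := hχ1 (φ y)
      rw [h3]
      calc |ψ (φ y) * fderiv ℝ (χ ∘ φ) y (Y y) + χ (φ y) * fderiv ℝ (ψ ∘ φ) y (Y y)|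
          ≤ |ψ (φ y)| * |fderiv ℝ (χ ∘ φ) y (Y y)| + |χ (φ y)| * |fderiv ℝ (ψ ∘ φ) y (Y y)| := by
            rw [← abs_mul, ← abs_mul]; exact abs_add_le _ _
        _ ≤ 1 * (sqrtDetMetric I x y * (C * ‖X (φ y)‖)) + 1 * (N * (sqrtDetMetric I x y * (c * ‖X (φ y)‖))) := by
            gcongr
        _ = _ := by ring
    · have h0 : dirDeriv I (fun τ => ψ τ * χ τ) (φ y) (X (φ y)) = 0 :=
        dirDeriv_eq_zero_of_notMem_tsupport
          (fun h => hφK y (hUT hy) hyK (tsupport_mul_subset_left h)) _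
      rw [hd y hy, h0, mul_zero, norm_zero]
      have hC := C.coe_nonneg
      positivity
  have hI2 : Integrable (fun θ => dirDeriv I (fun τ => ψ τ * χ τ) θ (X θ)) (riemannianVolume I) := by
    rw [← integrableOn_iff_integrable_of_support_subset (s := (extChartAt I x).source)]
    · rw [integrableOn_source_iff]
      change Integrable _ (volume.restrict T)
      rw [← hUae]
      exact hi2.congr_fun hd hUo.measurableSet
    · intro θ hθ
      by_contra h
      exact hθ (dirDeriv_eq_zero_of_notMem_tsupport
          (fun h' => h (hψs (tsupport_mul_subset_left h'))) _)
  refine ⟨hI2, ?_⟩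
  have hmain := integral_mul_flatDivergence hUo hKc hδL (fun y hy => (hδpos y).2
    (interior_mono (extChartAt_target_subset_range x) hy)) (fun y hy h => by
      rw [hU, hT, interior_extChartAt_target]
      exact ⟨hKT hy, (hδpos y).1 h⟩) hA0 (fun t ht0 ht1 => ?_) hYc hζL hζ1 hζ0
      (a := fun y => c * sqrtDetMetric I x y * a (φ y)) (b := fun y => b (φ y)) hD0 (fun y hy => ?_) hD ?_ hi1 hi2
  · have e1 : ∫ θ, ψ θ * χ θ * divergence I X θ ∂(riemannianVolume I) =
        ∫ y in U, ζ y * flatDivergence Y y := by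
      rw [← setIntegral_eq_integral_of_forall_compl_eq_zero (s := (extChartAt I x).source),
        setIntegral_source]
      · change ∫ y, _ ∂(volume.restrict T) = _
        rw [← hUae]
        refine setIntegral_congr_fun hUo.measurableSet fun y hy => ?_
        simp only [hdiv y hy, hζ, Function.comp]
        ring
      · intro θ hθ
        rw [image_eq_zero_of_notMem_tsupport fun h => hθ (hψs h)]
        ring
    have e2 : ∫ θ, dirDeriv I (fun τ => ψ τ * χ τ) θ (X θ) ∂(riemannianVolume I) =
        ∫ y in U, fderiv ℝ ζ y (Y y) := by
      rw [← setIntegral_eq_integral_of_forall_compl_eq_zero (s := (extChartAt I x).source),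
        setIntegral_source]
      · change ∫ y, _ ∂(volume.restrict T) = _
        rw [← hUae]
        exact setIntegral_congr_fun hUo.measurableSet fun y hy => (hd y hy).symm
      · intro θ hθ
        exact dirDeriv_eq_zero_of_notMem_tsupport
          (fun h' => hθ (hψs (tsupport_mul_subset_left h'))) _
    rw [e1, e2, hmain]
  · refine (measureReal_mono ?_ ?_).trans (hA t ht0 ht1)
    · rintro y ⟨⟨hy, hyK⟩, hyt⟩
      exact ⟨⟨interior_mono (extChartAt_target_subset_range x) hy, hR hyK⟩, hyt⟩
    · exact ((measure_mono (inter_subset_left.trans inter_subset_right)).trans_lt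
        (isCompact_closedBall (0 : EuclideanSpace ℝ (Fin p)) R).measure_lt_top).ne
  · have h1 := hab _ (hφi y hy.1)
    have h2 := (sqrtDetMetric_pos I x (hUT hy.1)).le
    calc ‖Y y‖ ≤ sqrtDetMetric I x y * (c * ‖X (φ y)‖) := hYn y hy
      _ ≤ sqrtDetMetric I x y * (c * (a (φ y) * b (φ y))) := by gcongr
      _ = _ := by ring
  · have h1 := ((integrableOn_source_iff I x _).1 ha.integrableOn).mono_set hKT
    have h2 := (h1.continuousOn_mul ((hsd.mono hKT).const_mul (c ^ 2)) hKc).mono_set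
      (inter_subset_right (s := U))
    refine h2.congr_fun (fun y _ => ?_) (hUo.measurableSet.inter hKc.measurableSet)
    ring

end

/-! ### Distance cutoffs and the divergence theorem on a complete manifold -/

section
variable {p : ℕ} {H : Type*} [TopologicalSpace H]
  {I : ModelWithCorners ℝ (EuclideanSpace ℝ (Fin p)) H}
  {M : Type*} [TopologicalSpace M] [ChartedSpace H M] [IsManifold I ∞ M]
  [RiemannianBundle (fun θ : M => TangentSpace I θ)]
  [IsContMDiffRiemannianBundle I ∞ (EuclideanSpace ℝ (Fin p)) (fun θ : M => TangentSpace I θ)]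

variable (I) in
theorem dirDeriv_sum {ι : Type*} (s : Finset ι) {φ : ι → M → ℝ} {θ : M} (hθ : θ ∈ I.interior M)
    (h : ∀ i ∈ s, MDifferentiableAt I 𝓘(ℝ, ℝ) (φ i) θ) (V : TangentSpace I θ) :
    dirDeriv I (fun τ => ∑ i ∈ s, φ i τ) θ V = ∑ i ∈ s, dirDeriv I (φ i) θ V := by
  set y := extChartAt I θ θ with hy
  have hyi : y ∈ interior (extChartAt I θ).target := mem_interior_target_self I hθ
  have hsy : (extChartAt I θ).symm y = θ := extChartAt_to_inv θ
  have key : ∀ χ : M → ℝ, dirDeriv I χ θ V =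
      fderiv ℝ (χ ∘ (extChartAt I θ).symm) y (chartDeriv I θ θ V) := by
    intro χ
    have h1 := fun V' => dirDeriv_symm I (φ := χ) θ hyi V'
    rw [hsy] at h1
    exact h1 V
  rw [key, Finset.sum_congr rfl fun i _ => key (φ i)]
  have hd : ∀ i ∈ s, DifferentiableAt ℝ (φ i ∘ (extChartAt I θ).symm) y := fun i hi =>
    (mdifferentiableAt_symm_iff I θ hyi).1 (by rw [hsy]; exact h i hi)
  have h2 : (fun τ => ∑ i ∈ s, φ i τ) ∘ (extChartAt I θ).symm =
      fun z => ∑ i ∈ s, (φ i ∘ (extChartAt I θ).symm) z := rfl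
  rw [h2, fderiv_fun_sum hd, sum_apply]

variable [T2Space M] [SigmaCompactSpace M] [MeasurableSpace M] [BorelSpace M]

/-- Sum the chart identities over a partition of unity, finite on the support of `χ`. The result is
governed by the slope of `χ` alone. -/
theorem IsStokesField.abs_integral_mul_divergence_le {X : (θ : M) → TangentSpace I θ}
    (hX : IsStokesField I X) {C : ℝ≥0} {χ : M → ℝ} (hχ : IsRiemannianLipschitz (I := I) C χ)
    (hχ1 : ∀ θ, |χ θ| ≤ 1) (hχc : HasCompactSupport χ) :
    |∫ θ, χ θ * divergence I X θ ∂(riemannianVolume I)| ≤ C * ∫ θ, ‖X θ‖ ∂(riemannianVolume I) := by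
  have : LocallyCompactSpace M := locallyCompact_of_finiteDimensional I
  have hexists : ∀ x : M, ∃ K, IsCompact K ∧ x ∈ interior K ∧ K ⊆ (extChartAt I x).source := fun x =>
    exists_compact_subset (isOpen_extChartAt_source x) (mem_extChartAt_source x)
  choose K hKc hKx hKs using hexists
  obtain ⟨f, hf⟩ := SmoothPartitionOfUnity.exists_isSubordinate I isClosed_univ
    (fun x => interior (K x)) (fun x => isOpen_interior) (fun x _ => mem_iUnion.2 ⟨x, hKx x⟩)
  set T := (f.locallyFinite.finite_nonempty_inter_compact hχc).toFinset with hT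
  have hsum : ∀ θ, ∑ i ∈ T, f i θ * χ θ = χ θ := by
    intro θ
    by_cases h0 : χ θ = 0
    · simp [h0]
    · rw [← Finset.sum_mul]
      have h1 : ∑ i ∈ T, f i θ = 1 := by
        rw [← f.sum_eq_one (mem_univ θ)]
        refine (finsum_eq_sum_of_support_subset _ fun i hi => ?_).symm
        rw [hT, Finite.coe_toFinset]
        exact ⟨θ, hi, subset_tsupport _ h0⟩
      rw [h1, one_mul]
  have hts : ∀ i, tsupport (f i) ⊆ K i := fun i => (hf i).trans interior_subset
  have hchart := fun i => hX.integral_mul_divergence_of_chart i hχ hχ1 (ψ := f i) (f i).contMDiff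
    (fun θ => by rw [abs_of_nonneg (f.nonneg i θ)]; exact f.le_one i θ)
    ((hKc i).of_isClosed_subset (isClosed_tsupport _) (hts i)) ((hts i).trans (hKs i))
  have hI1 : ∀ i ∈ T, Integrable (fun θ => f i θ * χ θ * divergence I X θ) (riemannianVolume I) := fun i _ =>
    hX.integrable_divergence.bdd_mul (c := 1)
      ((f i).contMDiff.continuous.mul (hχ.continuous I)).aestronglyMeasurable
      (Filter.Eventually.of_forall fun θ => by
        rw [Real.norm_eq_abs, abs_mul, abs_of_nonneg (f.nonneg i θ)]
        exact mul_le_one₀ (f.le_one i θ) (abs_nonneg _) (hχ1 _))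
  have h1 : ∫ θ, χ θ * divergence I X θ ∂(riemannianVolume I) =
      -∫ θ, ∑ i ∈ T, dirDeriv I (fun τ => f i τ * χ τ) θ (X θ) ∂(riemannianVolume I) := by
    rw [integral_finsetSum _ fun i _ => (hchart i).1, ← Finset.sum_neg_distrib,
      ← Finset.sum_congr rfl fun i _ => (hchart i).2, ← integral_finsetSum _ hI1]
    refine integral_congr_ae (Filter.Eventually.of_forall fun θ => ?_)
    change χ θ * _ = ∑ i ∈ T, f i θ * χ θ * _
    rw [← Finset.sum_mul, hsum θ]
  rw [h1, abs_neg, ← integral_const_mul]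
  refine abs_integral_le_integral_abs.trans (integral_mono_ae ?_ (hX.integrable_norm.const_mul _) ?_)
  · exact (integrable_finsetSum _ fun i _ => (hchart i).1).abs
  · filter_upwards [ae_mem_interior I, ae_mdifferentiableAt I hχ] with θ hθ hd
    -- The functions `f i * χ` add up to `χ`, so the derivatives of the partition functions cancel
    -- and only the derivative of `χ` along `X` remains.
    have h2 := dirDeriv_sum I T hθ (φ := fun i τ => f i τ * χ τ) (fun i _ =>
      (((f i).contMDiff θ).mdifferentiableAt (by simp)).mul hd) (X θ)
    rw [← h2, funext hsum]
    exact abs_dirDeriv_le I hχ hθ hd (X θ)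

/-- Points in different components are at distance `⊤`; there the bound is automatic because `C ≠ 0`
makes the right side `⊤`. -/
theorem isRiemannianLipschitz_of_abs_sub_le {C : ℝ≥0} (hC : C ≠ 0) {χ : M → ℝ}
    (h : ∀ x y, riemannianEDist I x y ≠ ⊤ → |χ x - χ y| ≤ C * (riemannianEDist I x y).toReal) :
    IsRiemannianLipschitz (I := I) C χ := by
  intro x y
  by_cases hxy : riemannianEDist I x y = ⊤
  · rw [hxy, ENNReal.mul_top (by simpa using hC)]
    exact le_top
  · have h1 := ENNReal.ofReal_le_ofReal (h x y hxy)
    rwa [ENNReal.ofReal_mul C.coe_nonneg, ENNReal.ofReal_coe_nnreal, ENNReal.ofReal_toReal hxy] at h1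

/-- The function $2-C\,d(x_0,\cdot)$ clipped to $[0,1]$, set to zero at infinite distance. Its
support is compact because the closed ball of radius $2/C$ is, by completeness. -/
theorem exists_cutoff_ball (hM : IsCompleteRiemannian I M) (x₀ : M) {C : ℝ≥0} (hC : C ≠ 0) :
    ∃ χ : M → ℝ, IsRiemannianLipschitz (I := I) C χ ∧ (∀ x, 0 ≤ χ x) ∧ (∀ x, χ x ≤ 1) ∧
      HasCompactSupport χ ∧
      ∀ x, riemannianEDist I x₀ x ≠ ⊤ → C * (riemannianEDist I x₀ x).toReal ≤ 1 → χ x = 1 := by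
  have hI1 : IsManifold I 1 M := IsManifold.of_le (n := ∞) (by simp)
  have hCpos : (0:ℝ) < C := by positivity
  classical
  set χ : M → ℝ := fun x => if riemannianEDist I x₀ x = ⊤ then 0 else
    max 0 (min 1 (2 - C * (riemannianEDist I x₀ x).toReal)) with hχ
  refine ⟨χ, isRiemannianLipschitz_of_abs_sub_le hC fun x y hxy => ?_, fun x => ?_, fun x => ?_, ?_, fun x hx h => ?_⟩
  · by_cases hx : riemannianEDist I x₀ x = ⊤
    · have hy : riemannianEDist I x₀ y = ⊤ := by
        by_contra hy
        have := riemannianEDist_triangle (I := I) (x := x₀) (y := y) (z := x)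
        rw [hx, riemannianEDist_comm (x := y)] at this
        exact (ENNReal.add_ne_top.2 ⟨hy, hxy⟩) (top_le_iff.1 this)
      simp only [hχ, hx, hy, if_true, sub_zero, abs_zero]
      positivity
    · have hy : riemannianEDist I x₀ y ≠ ⊤ := fun hy => by
        have := riemannianEDist_triangle (I := I) (x := x₀) (y := x) (z := y)
        rw [hy] at this
        exact (ENNReal.add_ne_top.2 ⟨hx, hxy⟩) (top_le_iff.1 this)
      simp only [hχ, hx, hy, if_false]
      have h1 : (riemannianEDist I x₀ y).toReal ≤ (riemannianEDist I x₀ x).toReal + (riemannianEDist I x y).toReal := by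
        rw [← ENNReal.toReal_add hx hxy]
        exact ENNReal.toReal_mono (ENNReal.add_ne_top.2 ⟨hx, hxy⟩) riemannianEDist_triangle
      have h2 : (riemannianEDist I x₀ x).toReal ≤ (riemannianEDist I x₀ y).toReal + (riemannianEDist I x y).toReal := by
        rw [← ENNReal.toReal_add hy hxy, riemannianEDist_comm (x := x) (y := y)]
        refine ENNReal.toReal_mono (ENNReal.add_ne_top.2 ⟨hy, ?_⟩) riemannianEDist_triangle
        rwa [riemannianEDist_comm]
      have h3 := mul_le_mul_of_nonneg_left h1 hCpos.le
      have h4 := mul_le_mul_of_nonneg_left h2 hCpos.le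
      have h5 := mul_nonneg hCpos.le (ENNReal.toReal_nonneg (a := riemannianEDist I x y))
      rw [mul_add] at h3 h4
      rw [abs_le]
      simp only [max_def, min_def]
      constructor <;> split_ifs <;> linarith
  · simp only [hχ]; split_ifs
    · exact le_rfl
    · exact le_max_left _ _
  · simp only [hχ]; split_ifs
    · exact zero_le_one
    · exact max_le zero_le_one (min_le_left _ _)
  · refine HasCompactSupport.intro (hM x₀ (2 / C)) fun x hx => ?_
    by_cases hx' : riemannianEDist I x₀ x = ⊤
    · simp only [hχ, hx', if_true]
    · simp only [hχ, hx', if_false]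
      refine max_eq_left ((min_le_right _ _).trans ?_)
      have h1 : ((2 / C : ℝ≥0) : ℝ≥0∞) < riemannianEDist I x₀ x := not_le.1 hx
      have h2 := (ENNReal.toReal_lt_toReal ENNReal.coe_ne_top hx').2 h1
      rw [ENNReal.coe_toReal, NNReal.coe_div, div_lt_iff₀ hCpos] at h2
      push_cast at h2
      linarith
  · simp only [hχ, hx, if_false]
    rw [min_eq_left (by linarith), max_eq_right zero_le_one]

theorem exists_cutoff_finset (hM : IsCompleteRiemannian I M) (s : Finset M) {C : ℝ≥0} (hC : C ≠ 0) :
    ∃ χ : M → ℝ, IsRiemannianLipschitz (I := I) C χ ∧ (∀ x, 0 ≤ χ x) ∧ (∀ x, χ x ≤ 1) ∧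
      HasCompactSupport χ ∧ ∀ x₀ ∈ s, ∀ x, riemannianEDist I x₀ x ≠ ⊤ →
        C * (riemannianEDist I x₀ x).toReal ≤ 1 → χ x = 1 := by
  classical
  induction s using Finset.induction_on with
  | empty =>
    refine ⟨fun _ => 0, fun x y => by simp, fun _ => le_rfl, fun _ => zero_le_one,
      HasCompactSupport.zero, by simp⟩
  | insert x₁ s _ ih =>
    obtain ⟨χ, h1, h2, h3, h4, h5⟩ := ih
    obtain ⟨χ', h1', h2', h3', h4', h5'⟩ := exists_cutoff_ball hM x₁ hC
    refine ⟨fun x => max (χ x) (χ' x), fun x y => ?_, fun x => le_max_of_le_left (h2 x),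
      fun x => max_le (h3 x) (h3' x), ?_, ?_⟩
    · refine (ENNReal.ofReal_le_ofReal (abs_max_sub_max_le_max _ _ _ _)).trans ?_
      rw [ENNReal.ofReal_max]
      exact max_le (h1 x y) (h1' x y)
    · refine HasCompactSupport.intro (h4.union h4') fun x hx => ?_
      rw [mem_union, not_or] at hx
      simp only [image_eq_zero_of_notMem_tsupport hx.1, image_eq_zero_of_notMem_tsupport hx.2, max_self]
    · intro x₀ hx₀ x hx h
      rcases Finset.mem_insert.1 hx₀ with rfl | hs
      · simp only [h5' x hx h]
        exact max_eq_right (h3 x)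
      · simp only [h5 x₀ hs x hx h]
        exact max_eq_left (h3' x)

/-- On a complete Riemannian manifold the divergence of a Stokes field integrates to zero. -/
theorem IsStokesField.integral_divergence (hM : IsCompleteRiemannian I M)
    {X : (θ : M) → TangentSpace I θ} (hX : IsStokesField I X) :
    ∫ θ, divergence I X θ ∂(riemannianVolume I) = 0 := by
  have hI1 : IsManifold I 1 M := IsManifold.of_le (n := ∞) (by simp)
  rcases isEmpty_or_nonempty M with he | hne
  · simp [Measure.eq_zero_of_isEmpty]
  have := secondCountableTopology_of_model M I
  have : IsContinuousRiemannianBundle (EuclideanSpace ℝ (Fin p)) (fun θ : M => TangentSpace I θ) := by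
    obtain ⟨g, hg, h⟩ := IsContMDiffRiemannianBundle.exists_contMDiff (IB := I) (n := ∞)
      (F := EuclideanSpace ℝ (Fin p)) (E := fun θ : M => TangentSpace I θ)
    exact ⟨g, hg.continuous, h⟩
  classical
  -- The manifold need not be connected, so balls about one centre need not exhaust it. Every point
  -- is at finite distance from some member of a dense sequence, and the `k`-th cutoff uses the
  -- first `k` members as centres, with Lipschitz constant `1 / (k + 1)`.
  set u := TopologicalSpace.denseSeq M with hu
  have hcov : ∀ x, ∃ m, riemannianEDist I (u m) x ≠ ⊤ := by
    intro x
    obtain ⟨_, ⟨m, rfl⟩, hy⟩ := (TopologicalSpace.denseRange_denseSeq M).inter_nhds_nonempty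
      (eventually_riemannianEDist_lt I x (c := 1) one_pos)
    refine ⟨m, ?_⟩
    rw [riemannianEDist_comm]
    exact (lt_trans hy ENNReal.one_lt_top).ne
  set C : ℕ → ℝ≥0 := fun k => 1 / (k + 1) with hCdef
  have hC : ∀ k, C k ≠ 0 := fun k => by simp only [hCdef]; positivity
  choose χ h1 h2 h3 h4 h5 using fun k => exists_cutoff_finset hM ((Finset.range k).image u) (hC k)
  have hC0 : Filter.Tendsto (fun k => (C k : ℝ)) Filter.atTop (nhds 0) := by
    simp only [hCdef]
    push_cast
    exact tendsto_one_div_add_atTop_nhds_zero_nat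
  have hlim : ∀ x, Filter.Tendsto (fun k => χ k x) Filter.atTop (nhds 1) := by
    intro x
    obtain ⟨m, hm⟩ := hcov x
    refine tendsto_const_nhds.congr' ?_
    have hsmall : ∀ᶠ k in Filter.atTop, C k * (riemannianEDist I (u m) x).toReal < 1 := by
      have := hC0.mul_const (riemannianEDist I (u m) x).toReal
      rw [zero_mul] at this
      exact this.eventually (gt_mem_nhds one_pos)
    filter_upwards [Filter.eventually_gt_atTop m, hsmall] with k hk hks
    exact (h5 k (u m) (Finset.mem_image_of_mem u (Finset.mem_range.2 hk)) x hm hks.le).symm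
  have hL1 : Filter.Tendsto (fun k => ∫ θ, χ k θ * divergence I X θ ∂(riemannianVolume I)) Filter.atTop
      (nhds (∫ θ, divergence I X θ ∂(riemannianVolume I))) := by
    refine tendsto_integral_of_dominated_convergence (fun θ => |divergence I X θ|)
      (fun k => ((h1 k).continuous I).aestronglyMeasurable.mul hX.integrable_divergence.aestronglyMeasurable)
      hX.integrable_divergence.abs (fun k => Filter.Eventually.of_forall fun θ => ?_)
      (Filter.Eventually.of_forall fun θ => by simpa using (hlim θ).mul_const (divergence I X θ))
    rw [Real.norm_eq_abs, abs_mul, abs_of_nonneg (h2 k θ)]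
    exact mul_le_of_le_one_left (abs_nonneg _) (h3 k θ)
  have hL2 : Filter.Tendsto (fun k => ∫ θ, χ k θ * divergence I X θ ∂(riemannianVolume I)) Filter.atTop
      (nhds 0) := by
    refine squeeze_zero_norm (fun k => hX.abs_integral_mul_divergence_le (h1 k)
      (fun θ => by rw [abs_of_nonneg (h2 k θ)]; exact h3 k θ) (h4 k)) ?_
    simpa using hC0.mul_const (∫ θ, ‖X θ‖ ∂(riemannianVolume I))
  exact tendsto_nhds_unique hL1 hL2

end

/-! ### Positive-semidefinite forms on tuples -/

section WeightedForm
variable {q : ℕ} {V : Type*} [AddCommGroup V] [Module ℝ V]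

/-- The bilinear form `G_{jk} B(x_j, y_k)` on `q`-tuples. -/
def weightedForm (G : Matrix (Fin q) (Fin q) ℝ) (B : LinearMap.BilinForm ℝ V) :
    LinearMap.BilinForm ℝ (Fin q → V) :=
  LinearMap.mk₂ ℝ (fun x y => ∑ j, ∑ k, G j k * B (x j) (y k))
    (fun x x' y => by simp [mul_add, Finset.sum_add_distrib])
    (fun c x y => by
      simp only [Pi.smul_apply, map_smul, LinearMap.smul_apply, smul_eq_mul, Finset.mul_sum]
      exact Finset.sum_congr rfl fun j _ => Finset.sum_congr rfl fun k _ => by ring)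
    (fun x y y' => by simp [mul_add, Finset.sum_add_distrib])
    (fun c x y => by
      simp only [Pi.smul_apply, map_smul, smul_eq_mul, Finset.mul_sum]
      exact Finset.sum_congr rfl fun j _ => Finset.sum_congr rfl fun k _ => by ring)

theorem weightedForm_apply (G : Matrix (Fin q) (Fin q) ℝ) (B : LinearMap.BilinForm ℝ V)
    (x y : Fin q → V) : weightedForm G B x y = ∑ j, ∑ k, G j k * B (x j) (y k) := rfl

variable {G : Matrix (Fin q) (Fin q) ℝ} {B : LinearMap.BilinForm ℝ V}

theorem weightedForm_comm (hG : G.PosSemidef) (hB : ∀ x y, B x y = B y x) (x y : Fin q → V) :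
    weightedForm G B x y = weightedForm G B y x := by
  rw [weightedForm_apply, weightedForm_apply, Finset.sum_comm]
  refine Finset.sum_congr rfl fun k _ => Finset.sum_congr rfl fun j _ => ?_
  have h1 : G j k = G k j := by
    have := congrFun (congrFun hG.isHermitian k) j
    simpa using this
  rw [h1, hB]

open scoped MatrixOrder in
-- Factor `G = Rᴴ * R`: the form becomes a sum of values of `B` on the diagonal at the combinations
-- with coefficients from the rows of `R`.
theorem weightedForm_nonneg (hG : G.PosSemidef) (hB : ∀ x, 0 ≤ B x x) (x : Fin q → V) :
    0 ≤ weightedForm G B x x := by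
  obtain ⟨R, hR⟩ := CStarAlgebra.nonneg_iff_eq_star_mul_self.mp hG.nonneg
  have hGR : ∀ j k, G j k = ∑ l, R l j * R l k := fun j k => by
    rw [hR]
    simp [Matrix.mul_apply, Matrix.star_apply]
  have h : weightedForm G B x x = ∑ l, B (∑ j, R l j • x j) (∑ k, R l k • x k) := by
    simp only [weightedForm_apply, hGR, map_sum, map_smul, LinearMap.sum_apply, LinearMap.smul_apply,
      smul_eq_mul, Finset.sum_mul, Finset.mul_sum]
    have : ∀ F : Fin q → Fin q → Fin q → ℝ, ∑ j, ∑ k, ∑ l, F j k l = ∑ l, ∑ j, ∑ k, F j k l := fun F => by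
      calc _ = ∑ j, ∑ l, ∑ k, F j k l := Finset.sum_congr rfl fun j _ => Finset.sum_comm
        _ = _ := Finset.sum_comm
    rw [this]
    refine Finset.sum_congr rfl fun l _ => ?_
    rw [Finset.sum_comm]
    exact Finset.sum_congr rfl fun k _ => Finset.sum_congr rfl fun j _ => by ring
  rw [h]
  exact Finset.sum_nonneg fun l _ => hB _

theorem weightedForm_sq_le (hG : G.PosSemidef) (hB : ∀ x, 0 ≤ B x x) (hs : ∀ x y, B x y = B y x) (x y : Fin q → V) :
    weightedForm G B x y ^ 2 ≤ weightedForm G B x x * weightedForm G B y y := by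
  have := LinearMap.BilinForm.apply_mul_apply_le_of_forall_zero_le _ (weightedForm_nonneg hG hB) x y
  rwa [weightedForm_comm hG hs y x, ← sq] at this

theorem abs_weightedForm_le (hG : G.PosSemidef) (hB : ∀ x, 0 ≤ B x x) (hs : ∀ x y, B x y = B y x) (x y : Fin q → V) :
    |weightedForm G B x y| ≤ 1 / 2 * (weightedForm G B x x + weightedForm G B y y) := by
  have h1 := weightedForm_sq_le hG hB hs x y
  have h2 := weightedForm_nonneg hG hB x
  have h3 := weightedForm_nonneg hG hB y
  refine abs_le_of_sq_le_sq (h1.trans ?_) (by positivity)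
  nlinarith [sq_nonneg (weightedForm G B x x - weightedForm G B y y)]

theorem weightedForm_self_smul_add (hG : G.PosSemidef) (hs : ∀ x y, B x y = B y x) (x y : Fin q → V) (a b : ℝ) :
    weightedForm G B (a • x + b • y) (a • x + b • y) =
      a ^ 2 * weightedForm G B x x + 2 * a * b * weightedForm G B x y + b ^ 2 * weightedForm G B y y := by
  have h := weightedForm_comm hG hs x y
  simp only [map_add, map_smul, LinearMap.add_apply, LinearMap.smul_apply, smul_eq_mul, ← h]
  ring

/-- The multiplication of real numbers as a bilinear form. -/
def mulForm : LinearMap.BilinForm ℝ ℝ := LinearMap.mul ℝ ℝ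

theorem mulForm_comm (x y : ℝ) : mulForm x y = mulForm y x := by simp [mulForm, mul_comm]

theorem mulForm_self_nonneg (x : ℝ) : 0 ≤ mulForm x x := by simp [mulForm, mul_self_nonneg]

theorem eq_zero_of_weightedForm_mulForm (hG : G.PosDef) {x : Fin q → ℝ}
    (h : weightedForm G mulForm x x = 0) : x = 0 := by
  by_contra hx
  have := hG.dotProduct_mulVec_pos hx
  simp only [dotProduct, Matrix.mulVec, star_trivial, Pi.star_apply, Finset.mul_sum] at this
  rw [weightedForm_apply] at h
  refine this.ne' (Eq.trans ?_ h)
  exact Finset.sum_congr rfl fun j _ => Finset.sum_congr rfl fun k _ => by simp [mulForm]; ring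

end WeightedForm

section
variable {q : ℕ} {V : Type*} [NormedAddCommGroup V] [InnerProductSpace ℝ V]

/-- The inner product as a bilinear form. -/
def innerForm (V : Type*) [NormedAddCommGroup V] [InnerProductSpace ℝ V] : LinearMap.BilinForm ℝ V :=
  innerₗ V

theorem innerForm_comm (x y : V) : innerForm V x y = innerForm V y x := by
  simp [innerForm, real_inner_comm]

theorem innerForm_self_nonneg (x : V) : 0 ≤ innerForm V x x := by
  simp [innerForm]

/-- A mixed Cauchy-Schwarz inequality, needed to bound the flux by scores times field. With
$t_j=\langle v_j,Z\rangle$ one has $\|Z\|^2=G(t,s)$, so $\|Z\|^4\le G(t,t)\,G(s,s)$, and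
$G(t,t)\le\|Z\|^2G(v,v)$ allows one factor $\|Z\|^2$ to be cancelled. -/
theorem norm_sum_sum_smul_le {G : Matrix (Fin q) (Fin q) ℝ} (hG : G.PosSemidef) (s : Fin q → ℝ)
    (v : Fin q → V) :
    ‖∑ j, (∑ k, G j k * s k) • v j‖ ^ 2 ≤
      weightedForm G mulForm s s * weightedForm G (innerForm V) v v := by
  set Z := ∑ j, (∑ k, G j k * s k) • v j with hZ
  set t : Fin q → ℝ := fun j => inner ℝ (v j) Z with ht
  have h1 : ‖Z‖ ^ 2 = weightedForm G mulForm t s := by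
    rw [← real_inner_self_eq_norm_sq]
    nth_rewrite 1 [hZ]
    rw [sum_inner, weightedForm_apply]
    refine Finset.sum_congr rfl fun j _ => ?_
    rw [real_inner_smul_left, Finset.sum_mul]
    exact Finset.sum_congr rfl fun k _ => by simp [mulForm, ht]; ring
  have h2 := weightedForm_sq_le hG mulForm_self_nonneg mulForm_comm t s
  have h3 : weightedForm G mulForm t t ≤ ‖Z‖ ^ 2 * weightedForm G (innerForm V) v v := by
    -- The form $\|Z\|^2\langle x,y\rangle-\langle Z,x\rangle\langle Z,y\rangle$ is
    -- positive-semidefinite by Cauchy-Schwarz, so its weighted version is nonnegative at `v`.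
    set D : LinearMap.BilinForm ℝ V := ‖Z‖ ^ 2 • innerForm V - mulForm.compl₁₂ (innerₗ V Z) (innerₗ V Z) with hD
    have hDn : ∀ x, 0 ≤ D x x := fun x => by
      simp only [hD, LinearMap.sub_apply, LinearMap.smul_apply, smul_eq_mul, innerForm, LinearMap.compl₁₂_apply,
        mulForm, LinearMap.mul_apply', innerₗ_apply_apply, real_inner_self_eq_norm_sq]
      have := abs_real_inner_le_norm Z x
      have h5 := sq_le_sq' (by linarith [neg_abs_le (inner ℝ Z x), norm_nonneg Z]) ((le_abs_self _).trans this)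
      nlinarith
    have h4 := weightedForm_nonneg hG hDn v
    have h5 : weightedForm G D v v = ‖Z‖ ^ 2 * weightedForm G (innerForm V) v v - weightedForm G mulForm t t := by
      simp only [weightedForm_apply, Finset.mul_sum, ← Finset.sum_sub_distrib]
      refine Finset.sum_congr rfl fun j _ => Finset.sum_congr rfl fun k _ => ?_
      simp only [hD, LinearMap.sub_apply, LinearMap.smul_apply, smul_eq_mul, LinearMap.compl₁₂_apply, ht,
        mulForm, LinearMap.mul_apply', innerₗ_apply_apply, real_inner_comm]
      ring
    linarith
  have h6 := weightedForm_nonneg hG mulForm_self_nonneg s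
  have h7 := weightedForm_nonneg hG innerForm_self_nonneg v
  rw [← h1] at h2
  by_cases hz : ‖Z‖ ^ 2 = 0
  · rw [hz]; positivity
  · have hzp : 0 < ‖Z‖ ^ 2 := lt_of_le_of_ne (by positivity) (Ne.symm hz)
    refine le_of_mul_le_mul_left ?_ hzp
    calc ‖Z‖ ^ 2 * ‖Z‖ ^ 2 = (‖Z‖ ^ 2) ^ 2 := by ring
      _ ≤ weightedForm G mulForm t t * weightedForm G mulForm s s := h2
      _ ≤ ‖Z‖ ^ 2 * weightedForm G (innerForm V) v v * weightedForm G mulForm s s := by gcongr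
      _ = _ := by ring

end

/-! ### Averages, the space of fields and the information form -/

theorem isManifold_one {p : ℕ} {H : Type*} [TopologicalSpace H]
    (I : ModelWithCorners ℝ (EuclideanSpace ℝ (Fin p)) H)
    (M : Type*) [TopologicalSpace M] [ChartedSpace H M] [IsManifold I ∞ M] : IsManifold I 1 M :=
  IsManifold.of_le (n := ∞) (by simp)

namespace BayesProblem

attribute [local instance] isManifold_one

variable {p : ℕ} {H : Type*} [TopologicalSpace H]
  {I : ModelWithCorners ℝ (EuclideanSpace ℝ (Fin p)) H}
  {M : Type*} [TopologicalSpace M] [ChartedSpace H M] [IsManifold I ∞ M]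
  [RiemannianBundle (fun θ : M => TangentSpace I θ)]
  [IsContMDiffRiemannianBundle I ∞ (EuclideanSpace ℝ (Fin p)) (fun θ : M => TangentSpace I θ)]
  [T2Space M] [SigmaCompactSpace M] [MeasurableSpace M] [BorelSpace M]
  {𝓧 : Type*} [MeasurableSpace 𝓧] {q : ℕ} (S : BayesProblem I M 𝓧 q)

section Averages

theorem hasAvg_congr {φ ψ : M → ℝ} (h : ∀ θ ∈ I.interior M, φ θ = ψ θ) : S.HasAvg φ ↔ S.HasAvg ψ := by
  refine integrable_congr ?_
  filter_upwards [ae_mem_interior I] with θ hθ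
  rw [h θ hθ]

theorem avg_congr {φ ψ : M → ℝ} (h : ∀ θ ∈ I.interior M, φ θ = ψ θ) : S.avg φ = S.avg ψ := by
  refine integral_congr_ae ?_
  filter_upwards [ae_mem_interior I] with θ hθ
  rw [h θ hθ]

variable {S} in
theorem HasAvg.const_mul {φ : M → ℝ} (h : S.HasAvg φ) (c : ℝ) : S.HasAvg fun θ => c * φ θ := by
  have := Integrable.const_mul h c
  simpa only [HasAvg, mul_assoc] using this

variable {S} in
theorem HasAvg.add {φ ψ : M → ℝ} (h : S.HasAvg φ) (h' : S.HasAvg ψ) :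
    S.HasAvg fun θ => φ θ + ψ θ := by
  simp only [HasAvg, add_mul]
  exact Integrable.add h h'

theorem avg_const_mul (c : ℝ) (φ : M → ℝ) : S.avg (fun θ => c * φ θ) = c * S.avg φ := by
  simp only [avg, mul_assoc, integral_const_mul]

variable {S} in
theorem HasAvg.avg_add {φ ψ : M → ℝ} (h : S.HasAvg φ) (h' : S.HasAvg ψ) :
    S.avg (fun θ => φ θ + ψ θ) = S.avg φ + S.avg ψ := by
  simp only [avg, add_mul]
  exact integral_add h h'

theorem avg_nonneg {φ : M → ℝ} (h : ∀ θ ∈ I.interior M, 0 ≤ φ θ) : 0 ≤ S.avg φ := by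
  refine integral_nonneg_of_ae ?_
  filter_upwards [ae_mem_interior I] with θ hθ
  exact mul_nonneg (h θ hθ) (S.ρ_nonneg θ)

theorem isOpen_interior (I : ModelWithCorners ℝ (EuclideanSpace ℝ (Fin p)) H) (M : Type*)
    [TopologicalSpace M] [ChartedSpace H M] [IsManifold I ∞ M] : IsOpen (I.interior M) :=
  I.isOpen_interior (n := ∞) (by simp)

theorem aestronglyMeasurable_of_continuousOn {φ : M → ℝ} (h : ContinuousOn φ (I.interior M)) :
    AEStronglyMeasurable φ (riemannianVolume I) := by
  have := secondCountableTopology_of_model M I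
  have h1 := h.aestronglyMeasurable (μ := riemannianVolume I) (isOpen_interior I M).measurableSet
  rwa [Measure.restrict_eq_self_of_ae_mem (ae_mem_interior I)] at h1

variable {S} in
-- Continuity in the interior suffices for measurability, because the boundary is null.
theorem HasAvg.of_abs_le {φ ψ : M → ℝ} (hψ : S.HasAvg ψ) (hc : ContinuousOn φ (I.interior M))
    (h : ∀ θ ∈ I.interior M, |φ θ| ≤ ψ θ) : S.HasAvg φ := by
  refine Integrable.mono' hψ
    ((aestronglyMeasurable_of_continuousOn hc).mul S.ρ_C1.continuous.aestronglyMeasurable) ?_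
  filter_upwards [ae_mem_interior I] with θ hθ
  rw [Real.norm_eq_abs, abs_mul, abs_of_nonneg (S.ρ_nonneg θ)]
  exact mul_le_mul_of_nonneg_right (h θ hθ) (S.ρ_nonneg θ)

variable {S} in
-- The integrand vanishes almost everywhere. Since `ρ` is positive in the interior, `φ` is nonzero
-- only on an open null subset of it, which must be empty.
theorem HasAvg.eq_zero_of_avg_eq_zero {φ : M → ℝ} (hφ : S.HasAvg φ) (hc : ContinuousOn φ (I.interior M))
    (h : ∀ θ ∈ I.interior M, 0 ≤ φ θ) (h0 : S.avg φ = 0) : ∀ θ ∈ I.interior M, φ θ = 0 := by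
  have h1 : (fun θ => φ θ * S.ρ θ) =ᵐ[riemannianVolume I] 0 := by
    refine (integral_eq_zero_iff_of_nonneg_ae ?_ hφ).1 h0
    filter_upwards [ae_mem_interior I] with θ hθ
    exact mul_nonneg (h θ hθ) (S.ρ_nonneg θ)
  have hU : IsOpen (I.interior M ∩ φ ⁻¹' {0}ᶜ) :=
    hc.isOpen_inter_preimage (isOpen_interior I M) isOpen_compl_singleton
  have hempty := eq_empty_of_riemannianVolume_eq_zero I hU inter_subset_left (by
    rw [measure_eq_zero_iff_ae_notMem]
    filter_upwards [h1] with θ hθ hθU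
    rcases mul_eq_zero.1 hθ with h2 | h2
    · exact hθU.2 h2
    · exact (S.ρ_pos θ hθU.1).ne' h2)
  intro θ hθ
  by_contra hne
  exact (hempty ▸ (⟨hθ, hne⟩ : θ ∈ I.interior M ∩ φ ⁻¹' {0}ᶜ) : θ ∈ (∅ : Set M))

end Averages

section Pointwise

theorem γ_inv_posDef (θ : M) : ((S.γ θ)⁻¹).PosDef := (S.γ_posDef θ).inv

theorem continuous_γ_inv (j k : Fin q) : Continuous fun θ => (S.γ θ)⁻¹ j k := by
  have h : (fun θ => (S.γ θ)⁻¹ j k) = fun θ => (S.γ θ).det⁻¹ * (S.γ θ).adjugate j k := by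
    ext θ
    rw [Matrix.inv_def, Matrix.smul_apply, Ring.inverse_eq_inv', smul_eq_mul]
  rw [h]
  exact (S.γ_continuous.matrix_det.inv₀ fun θ => (S.γ_posDef θ).det_pos.ne').mul
    (S.γ_continuous.matrix_adjugate.matrix_elem j k)

theorem dirDeriv_add_vec (φ : M → ℝ) (θ : M) (X Y : TangentSpace I θ) :
    dirDeriv I φ θ (X + Y) = dirDeriv I φ θ X + dirDeriv I φ θ Y :=
  map_add (mfderiv I 𝓘(ℝ, ℝ) φ θ) X Y

theorem dirDeriv_smul_vec (φ : M → ℝ) (θ : M) (c : ℝ) (X : TangentSpace I θ) :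
    dirDeriv I φ θ (c • X) = c * dirDeriv I φ θ X :=
  map_smul (mfderiv I 𝓘(ℝ, ℝ) φ θ) c X

theorem F_add_left {θ : M} (hθ : θ ∈ I.interior M) (X Y Z : TangentSpace I θ) :
    S.F θ (X + Y) Z = S.F θ X Z + S.F θ Y Z := by
  simp only [F, fisherInfo, dirDeriv_add_vec, add_mul]
  exact integral_add (S.fisher_exists θ hθ X Z) (S.fisher_exists θ hθ Y Z)

theorem F_smul_left (θ : M) (c : ℝ) (X Z : TangentSpace I θ) :
    S.F θ (c • X) Z = c * S.F θ X Z := by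
  simp only [F, fisherInfo, dirDeriv_smul_vec, mul_assoc, integral_const_mul]

theorem F_comm (θ : M) (X Y : TangentSpace I θ) : S.F θ X Y = S.F θ Y X := by
  simp only [F, fisherInfo]
  refine integral_congr_ae (Filter.Eventually.of_forall fun x => ?_)
  simp only
  ring

theorem F_self_nonneg {θ : M} (hθ : θ ∈ I.interior M) (X : TangentSpace I θ) : 0 ≤ S.F θ X X :=
  integral_nonneg fun x => mul_nonneg (mul_self_nonneg _) (S.f_nonneg θ hθ x)

/-- The Fisher information at an interior point as a bilinear form. -/
def fisherForm {θ : M} (hθ : θ ∈ I.interior M) : LinearMap.BilinForm ℝ (TangentSpace I θ) :=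
  LinearMap.mk₂ ℝ (S.F θ) (fun X Y Z => S.F_add_left hθ X Y Z) (fun c X Z => S.F_smul_left θ c X Z)
    (fun X Y Z => by rw [F_comm, S.F_add_left hθ, S.F_comm θ Y, S.F_comm θ Z])
    (fun c X Z => by rw [F_comm, F_smul_left, S.F_comm θ Z, smul_eq_mul])

/-- `γ^{jk} v_j^a F_{ab} w_k^b`. -/
def fisherPair (v w : Fin q → (θ : M) → TangentSpace I θ) (θ : M) : ℝ :=
  ∑ j, ∑ k, (S.γ θ)⁻¹ j k * S.F θ (v j θ) (w k θ)

/-- `γ^{jk} [(1/ρ) ∇_a (ρ v_j^a)] [(1/ρ) ∇_b (ρ w_k^b)]`. -/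
def priorPair (v w : Fin q → (θ : M) → TangentSpace I θ) (θ : M) : ℝ :=
  weightedForm (S.γ θ)⁻¹ mulForm (fun j => S.score v j θ) (fun k => S.score w k θ)

/-- `γ^{jk} g_{ab} v_j^a w_k^b`. -/
def normPair (v w : Fin q → (θ : M) → TangentSpace I θ) (θ : M) : ℝ :=
  weightedForm (S.γ θ)⁻¹ (innerForm (TangentSpace I θ)) (fun j => v j θ) (fun k => w k θ)

theorem priorPair_self (v : Fin q → (θ : M) → TangentSpace I θ) : S.priorPair v v = S.priorTerm v := by
  ext θ
  simp only [priorPair, priorTerm, weightedForm_apply, mulForm, LinearMap.mul_apply', mul_assoc]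

theorem isC1Field_smul_ρ {X : (θ : M) → TangentSpace I θ} (hX : IsC1Field I X) :
    IsC1Field I fun θ => S.ρ θ • X θ :=
  ContMDiff.smul_section S.ρ_C1 hX

theorem isC1Field_lin {X Y : (θ : M) → TangentSpace I θ} (hX : IsC1Field I X) (hY : IsC1Field I Y)
    (a b : ℝ) : IsC1Field I fun θ => a • X θ + b • Y θ :=
  ContMDiff.add_section (ContMDiff.const_smul_section (a := a) hX)
    (ContMDiff.const_smul_section (a := b) hY)

theorem continuousOn_score {v : Fin q → (θ : M) → TangentSpace I θ} (hv : ∀ j, IsC1Field I (v j))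
    (j : Fin q) : ContinuousOn (S.score v j) (I.interior M) :=
  (continuousOn_const.div S.ρ_C1.continuous.continuousOn fun θ hθ => (S.ρ_pos θ hθ).ne').mul
    (continuousOn_divergence I fun θ _ => S.isC1Field_smul_ρ (hv j) θ)

theorem score_lin {v w : Fin q → (θ : M) → TangentSpace I θ} (hv : ∀ j, IsC1Field I (v j))
    (hw : ∀ j, IsC1Field I (w j)) (a b : ℝ) (j : Fin q) {θ : M} (hθ : θ ∈ I.interior M) :
    S.score (fun j θ => a • v j θ + b • w j θ) j θ = a * S.score v j θ + b * S.score w j θ := by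
  have h1 : (fun τ => S.ρ τ • (a • v j τ + b • w j τ)) =
      fun τ => a • (S.ρ τ • v j τ) + b • (S.ρ τ • w j τ) := by
    ext1 τ
    rw [smul_add, smul_comm a, smul_comm b]
  have hv' := S.isC1Field_smul_ρ (hv j)
  have hw' := S.isC1Field_smul_ρ (hw j)
  have hc : ∀ (c : ℝ) (X : TangentSpace I θ), dirDeriv I (fun _ : M => c) θ X = 0 := fun c X => by
    rw [dirDeriv, mfderiv_const]; rfl
  simp only [score]
  rw [h1, divergence_add I (X := fun τ => a • (S.ρ τ • v j τ)) (Y := fun τ => b • (S.ρ τ • w j τ)) hθ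
    (ContMDiff.const_smul_section (a := a) hv' θ) (ContMDiff.const_smul_section (a := b) hw' θ),
    divergence_smul I hθ (φ := fun _ => a) mdifferentiableAt_const (hv' θ),
    divergence_smul I hθ (φ := fun _ => b) mdifferentiableAt_const (hw' θ), hc, hc]
  ring

theorem raisedScore_eq (v : Fin q → (θ : M) → TangentSpace I θ) (j : Fin q) (θ : M) :
    S.raisedScore v j θ = ∑ k, (S.γ θ)⁻¹ j k * S.score v k θ := by
  simp only [raisedScore, score]
  exact Finset.sum_congr rfl fun k _ => by ring

theorem raisedScore_lin {v w : Fin q → (θ : M) → TangentSpace I θ} (hv : ∀ j, IsC1Field I (v j))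
    (hw : ∀ j, IsC1Field I (w j)) (a b : ℝ) (j : Fin q) {θ : M} (hθ : θ ∈ I.interior M) :
    S.raisedScore (fun j θ => a • v j θ + b • w j θ) j θ =
      a * S.raisedScore v j θ + b * S.raisedScore w j θ := by
  simp only [raisedScore_eq, S.score_lin hv hw a b _ hθ, Finset.mul_sum, ← Finset.sum_add_distrib]
  exact Finset.sum_congr rfl fun k _ => by ring

theorem isContinuousRiemannianBundle : IsContinuousRiemannianBundle (EuclideanSpace ℝ (Fin p))
    (fun θ : M => TangentSpace I θ) := by
  obtain ⟨g, hg, h⟩ := IsContMDiffRiemannianBundle.exists_contMDiff (IB := I) (n := ∞)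
    (F := EuclideanSpace ℝ (Fin p)) (E := fun θ : M => TangentSpace I θ)
  exact ⟨g, hg.continuous, h⟩

theorem continuousOn_normPair {v w : Fin q → (θ : M) → TangentSpace I θ} (hv : ∀ j, IsC1Field I (v j))
    (hw : ∀ j, IsC1Field I (w j)) : ContinuousOn (S.normPair v w) (I.interior M) := by
  have := isContinuousRiemannianBundle (I := I) (M := M)
  change ContinuousOn (fun θ => ∑ j, ∑ k, (S.γ θ)⁻¹ j k * inner ℝ (v j θ) (w k θ)) _
  refine continuousOn_finsetSum _ fun j _ => continuousOn_finsetSum _ fun k _ => ?_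
  refine (S.continuous_γ_inv j k).continuousOn.mul (Continuous.continuousOn ?_)
  exact Continuous.inner_bundle (hv j).continuous (hw k).continuous

theorem continuousOn_fisherPair {v w : Fin q → (θ : M) → TangentSpace I θ} (hv : ∀ j, IsC1Field I (v j))
    (hw : ∀ j, IsC1Field I (w j)) : ContinuousOn (S.fisherPair v w) (I.interior M) :=
  continuousOn_finsetSum _ fun j _ => continuousOn_finsetSum _ fun k _ =>
    (S.continuous_γ_inv j k).continuousOn.mul (S.fisher_continuous _ _ (hv j) (hw k))

theorem continuousOn_priorPair {v w : Fin q → (θ : M) → TangentSpace I θ} (hv : ∀ j, IsC1Field I (v j))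
    (hw : ∀ j, IsC1Field I (w j)) : ContinuousOn (S.priorPair v w) (I.interior M) := by
  change ContinuousOn (fun θ => ∑ j, ∑ k, (S.γ θ)⁻¹ j k * (S.score v j θ * S.score w k θ)) _
  exact continuousOn_finsetSum _ fun j _ => continuousOn_finsetSum _ fun k _ =>
    (S.continuous_γ_inv j k).continuousOn.mul ((S.continuousOn_score hv j).mul (S.continuousOn_score hw k))

end Pointwise

section Fields
variable {S} {v w : Fin q → (θ : M) → TangentSpace I θ}

theorem IsField.hasAvg_fisherPair (hv : S.IsField v) (hw : S.IsField w) : S.HasAvg (S.fisherPair v w) :=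
  ((hv.fisher.add hw.fisher).const_mul (1 / 2)).of_abs_le (S.continuousOn_fisherPair hv.c1 hw.c1)
    fun _ hθ => abs_weightedForm_le (B := S.fisherForm hθ) (S.γ_inv_posDef _).posSemidef
      (S.F_self_nonneg hθ) (S.F_comm _) _ _

theorem IsField.hasAvg_priorPair (hv : S.IsField v) (hw : S.IsField w) : S.HasAvg (S.priorPair v w) := by
  have h1 := hv.prior
  have h2 := hw.prior
  rw [← priorPair_self] at h1 h2
  exact ((h1.add h2).const_mul (1 / 2)).of_abs_le (S.continuousOn_priorPair hv.c1 hw.c1)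
    fun _ _ => abs_weightedForm_le (S.γ_inv_posDef _).posSemidef mulForm_self_nonneg mulForm_comm _ _

theorem IsField.hasAvg_normPair (hv : S.IsField v) (hw : S.IsField w) : S.HasAvg (S.normPair v w) :=
  ((hv.norm.add hw.norm).const_mul (1 / 2)).of_abs_le (S.continuousOn_normPair hv.c1 hw.c1)
    fun _ _ => abs_weightedForm_le (S.γ_inv_posDef _).posSemidef innerForm_self_nonneg innerForm_comm _ _

theorem fisherPair_lin_self (a b : ℝ) {θ : M} (hθ : θ ∈ I.interior M) :
    S.fisherTerm (fun j θ => a • v j θ + b • w j θ) θ =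
      a ^ 2 * S.fisherTerm v θ + 2 * a * b * S.fisherPair v w θ + b ^ 2 * S.fisherTerm w θ :=
  weightedForm_self_smul_add (B := S.fisherForm hθ) (S.γ_inv_posDef _).posSemidef (S.F_comm _)
    (fun j => v j θ) (fun j => w j θ) a b

theorem normPair_lin_self (a b : ℝ) (θ : M) :
    S.sqNorm (fun j θ => a • v j θ + b • w j θ) θ =
      a ^ 2 * S.sqNorm v θ + 2 * a * b * S.normPair v w θ + b ^ 2 * S.sqNorm w θ :=
  weightedForm_self_smul_add (B := innerForm (TangentSpace I θ)) (S.γ_inv_posDef _).posSemidef innerForm_comm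
    (fun j => v j θ) (fun j => w j θ) a b

theorem priorTerm_lin_self (hv : ∀ j, IsC1Field I (v j)) (hw : ∀ j, IsC1Field I (w j)) (a b : ℝ)
    {θ : M} (hθ : θ ∈ I.interior M) :
    S.priorTerm (fun j θ => a • v j θ + b • w j θ) θ =
      a ^ 2 * S.priorTerm v θ + 2 * a * b * S.priorPair v w θ + b ^ 2 * S.priorTerm w θ := by
  simp only [← priorPair_self]
  have h : (fun j => S.score (fun j θ => a • v j θ + b • w j θ) j θ) =
      a • (fun j => S.score v j θ) + b • (fun j => S.score w j θ) :=
    funext fun j => S.score_lin hv hw a b j hθ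
  rw [priorPair, h]
  exact weightedForm_self_smul_add (S.γ_inv_posDef _).posSemidef mulForm_comm _ _ a b

/-- The three quadratic integrals of a combination involve cross terms, which are integrable because
each is dominated by half the sum of the two diagonal terms. -/
theorem IsField.lin (hv : S.IsField v) (hw : S.IsField w) (a b : ℝ) :
    S.IsField fun j θ => a • v j θ + b • w j θ where
  c1 j := isC1Field_lin (hv.c1 j) (hw.c1 j) a b
  boundary j θ hθ := by
    rw [smul_add, smul_comm _ a, smul_comm _ b, hv.boundary j θ hθ, hw.boundary j θ hθ]
    simp
  norm := (S.hasAvg_congr fun θ _ => normPair_lin_self a b θ).2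
    (((hv.norm.const_mul _).add ((hv.hasAvg_normPair hw).const_mul _)).add (hw.norm.const_mul _))
  fisher := (S.hasAvg_congr fun _ hθ => fisherPair_lin_self a b hθ).2
    (((hv.fisher.const_mul _).add ((hv.hasAvg_fisherPair hw).const_mul _)).add (hw.fisher.const_mul _))
  prior := (S.hasAvg_congr fun _ hθ => priorTerm_lin_self hv.c1 hw.c1 a b hθ).2
    (((hv.prior.const_mul _).add ((hv.hasAvg_priorPair hw).const_mul _)).add (hw.prior.const_mul _))

/-- The bilinear form whose quadratic form is the denominator `n ⟨𝖥⟩ + ⟨𝖯⟩`. -/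
def informationPair (S : BayesProblem I M 𝓧 q) (v w : Fin q → (θ : M) → TangentSpace I θ) : ℝ :=
  S.n * S.avg (S.fisherPair v w) + S.avg (S.priorPair v w)

theorem informationPair_self : S.informationPair v v = S.information v := by
  rw [informationPair, priorPair_self]
  rfl

theorem informationPair_comm : S.informationPair v w = S.informationPair w v := by
  have h1 : S.avg (S.fisherPair v w) = S.avg (S.fisherPair w v) := S.avg_congr fun θ hθ =>
    weightedForm_comm (B := S.fisherForm hθ) (S.γ_inv_posDef _).posSemidef (S.F_comm _) _ _
  have h2 : S.avg (S.priorPair v w) = S.avg (S.priorPair w v) := S.avg_congr fun θ _ =>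
    weightedForm_comm (S.γ_inv_posDef _).posSemidef mulForm_comm _ _
  rw [informationPair, h1, h2, informationPair]

theorem fisherTerm_nonneg {θ : M} (hθ : θ ∈ I.interior M) : 0 ≤ S.fisherTerm v θ :=
  weightedForm_nonneg (B := S.fisherForm hθ) (S.γ_inv_posDef _).posSemidef (S.F_self_nonneg hθ)
    (fun j => v j θ)

theorem priorTerm_nonneg (θ : M) : 0 ≤ S.priorTerm v θ := by
  rw [← priorPair_self]
  exact weightedForm_nonneg (S.γ_inv_posDef _).posSemidef mulForm_self_nonneg _

theorem information_nonneg : 0 ≤ S.information v :=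
  add_nonneg (mul_nonneg (Nat.cast_nonneg _) (S.avg_nonneg fun _ hθ => fisherTerm_nonneg hθ))
    (S.avg_nonneg fun θ _ => priorTerm_nonneg θ)

theorem IsField.information_lin (hv : S.IsField v) (hw : S.IsField w) (a b : ℝ) :
    S.information (fun j θ => a • v j θ + b • w j θ) =
      a ^ 2 * S.information v + 2 * a * b * S.informationPair v w + b ^ 2 * S.information w := by
  have h1 : S.avg (S.fisherTerm (fun j θ => a • v j θ + b • w j θ)) = a ^ 2 * S.avg (S.fisherTerm v) +
      2 * a * b * S.avg (S.fisherPair v w) + b ^ 2 * S.avg (S.fisherTerm w) := by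
    rw [S.avg_congr fun _ hθ => fisherPair_lin_self a b hθ,
      ((hv.fisher.const_mul _).add ((hv.hasAvg_fisherPair hw).const_mul _)).avg_add (hw.fisher.const_mul _),
      (hv.fisher.const_mul _).avg_add ((hv.hasAvg_fisherPair hw).const_mul _), avg_const_mul, avg_const_mul,
      avg_const_mul]
  have h2 : S.avg (S.priorTerm (fun j θ => a • v j θ + b • w j θ)) = a ^ 2 * S.avg (S.priorTerm v) +
      2 * a * b * S.avg (S.priorPair v w) + b ^ 2 * S.avg (S.priorTerm w) := by
    rw [S.avg_congr fun _ hθ => priorTerm_lin_self hv.c1 hw.c1 a b hθ,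
      ((hv.prior.const_mul _).add ((hv.hasAvg_priorPair hw).const_mul _)).avg_add (hw.prior.const_mul _),
      (hv.prior.const_mul _).avg_add ((hv.hasAvg_priorPair hw).const_mul _), avg_const_mul, avg_const_mul,
      avg_const_mul]
  rw [information, h1, h2, information, information, informationPair]
  ring

end Fields
end BayesProblem

/-! ### The flux and the integration by parts for `L` -/

section
variable {p : ℕ} {H : Type*} [TopologicalSpace H]
  (I : ModelWithCorners ℝ (EuclideanSpace ℝ (Fin p)) H)
  {M : Type*} [TopologicalSpace M] [ChartedSpace H M] [IsManifold I ∞ M]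
  [RiemannianBundle (fun θ : M => TangentSpace I θ)]
  [IsContMDiffRiemannianBundle I ∞ (EuclideanSpace ℝ (Fin p)) (fun θ : M => TangentSpace I θ)]

attribute [local instance] isManifold_one

theorem continuousOn_coordField (x : M) {X : (θ : M) → TangentSpace I θ} (hX : IsC1Field I X) :
    ContinuousOn (coordField I x X) (extChartAt I x).target := fun y hy => by
  have := (contDiffWithinAt_coordField I x (s := univ) hy (hX _).contMDiffWithinAt).continuousWithinAt
  rwa [preimage_univ, inter_univ] at this

/-- The field is `C¹` up to the boundary within the model range, and convexity of the range turns
bounded derivatives into Lipschitz bounds there too. -/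
theorem locallyLipschitzOn_coordField (x : M) {X : (θ : M) → TangentSpace I θ} (hX : IsC1Field I X) :
    LocallyLipschitzOn (extChartAt I x).target (coordField I x X) := by
  intro y hy
  have h1 := contDiffWithinAt_coordField I x (s := univ) hy (hX _).contMDiffWithinAt
  rw [preimage_univ, inter_univ] at h1
  obtain ⟨K, t, ht, hK⟩ := (h1.mono_of_mem_nhdsWithin
    (extChartAt_target_mem_nhdsWithin_of_mem hy)).exists_lipschitzOnWith I.convex_range
  exact ⟨K, t, nhdsWithin_mono y (extChartAt_target_subset_range x) ht, hK⟩

theorem divergence_zero {θ : M} (hθ : θ ∈ I.interior M) :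
    divergence I (fun τ : M => (0 : TangentSpace I τ)) θ = 0 := by
  have h0 : ContMDiffAt I I.tangent 1 (fun θ => (⟨θ, 0⟩ : TangentBundle I M)) θ :=
    Bundle.contMDiff_zeroSection ℝ (TangentSpace I) θ
  have h1 := divergence_add I hθ h0 h0
  simp only [add_zero] at h1
  linarith

theorem divergence_sum {ι : Type*} (s : Finset ι) {X : ι → (θ : M) → TangentSpace I θ} {θ : M}
    (hθ : θ ∈ I.interior M)
    (hX : ∀ i ∈ s, ContMDiffAt I I.tangent 1 (fun θ => (⟨θ, X i θ⟩ : TangentBundle I M)) θ) :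
    divergence I (fun τ => ∑ i ∈ s, X i τ) θ = ∑ i ∈ s, divergence I (X i) θ := by
  classical
  induction s using Finset.induction_on with
  | empty => simpa using divergence_zero I hθ
  | insert i s hi ih =>
    simp only [Finset.sum_insert hi]
    rw [divergence_add I hθ (hX i (s.mem_insert_self i))
      (ContMDiffAt.sum_section fun j hj => hX j (Finset.mem_insert_of_mem hj)),
      ih fun j hj => hX j (Finset.mem_insert_of_mem hj)]

end

namespace BayesProblem
variable {p : ℕ} {H : Type*} [TopologicalSpace H]
  {I : ModelWithCorners ℝ (EuclideanSpace ℝ (Fin p)) H}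
  {M : Type*} [TopologicalSpace M] [ChartedSpace H M] [IsManifold I ∞ M]
  [RiemannianBundle (fun θ : M => TangentSpace I θ)]
  [IsContMDiffRiemannianBundle I ∞ (EuclideanSpace ℝ (Fin p)) (fun θ : M => TangentSpace I θ)]
  [T2Space M] [SigmaCompactSpace M] [MeasurableSpace M] [BorelSpace M]
  {𝓧 : Type*} [MeasurableSpace 𝓧] {q : ℕ} {S : BayesProblem I M 𝓧 q}

attribute [local instance] isManifold_one

theorem sqNorm_nonneg (v : Fin q → (θ : M) → TangentSpace I θ) (θ : M) : 0 ≤ S.sqNorm v θ :=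
  weightedForm_nonneg (B := innerForm (TangentSpace I θ)) (S.γ_inv_posDef _).posSemidef
    innerForm_self_nonneg (fun j => v j θ)

/-- In coordinates $\rho\,\gamma^{jk}g_{ab}v_j^av_k^b=\gamma^{jk}g_{ab}(\rho v_j^a)v_k^b$. Keeping
$\rho$ with one of the two factors leaves coefficients bounded on compact sets times $\sum_j\|\rho
v_j\|$, which is Lipschitz and zero on the boundary. -/
theorem IsField.hasBoundaryDecay {v : Fin q → (θ : M) → TangentSpace I θ} (hv : S.IsField v) :
    HasBoundaryDecay (I := I) fun θ => Real.sqrt (S.ρ θ * S.sqNorm v θ) := by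
  intro x C hC hCT
  set φ := (extChartAt I x).symm with hφ
  set Z : Fin q → EuclideanSpace ℝ (Fin p) → EuclideanSpace ℝ (Fin p) :=
    fun j => coordField I x fun θ => S.ρ θ • v j θ with hZ
  set c : EuclideanSpace ℝ (Fin p) → ℝ := fun y => ∑ j, ∑ k, ∑ a, ∑ b,
    |(S.γ (φ y))⁻¹ j k| * |gram I x y a b| * |coordField I x (v k) y b| with hc
  have hcc : ContinuousOn c C := by
    refine continuousOn_finsetSum _ fun j _ => continuousOn_finsetSum _ fun k _ =>
      continuousOn_finsetSum _ fun a _ => continuousOn_finsetSum _ fun b _ => ?_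
    refine ((ContinuousOn.abs ?_).mul (ContinuousOn.abs ?_)).mul (ContinuousOn.abs ?_)
    · exact (S.continuous_γ_inv j k).comp_continuousOn ((continuousOn_extChartAt_symm x).mono hCT)
    · exact (contDiffOn_gram I x a b).continuousOn.mono hCT
    · have := (continuousOn_coordField I x (hv.c1 k)).mono hCT
      exact (EuclideanSpace.proj b : EuclideanSpace ℝ (Fin p) →L[ℝ] ℝ).continuous.comp_continuousOn this
  obtain ⟨A, hA⟩ := hC.exists_bound_of_continuousOn hcc
  have hLip : ∀ j, ∃ L, LipschitzOnWith L (Z j) C := fun j =>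
    ((locallyLipschitzOn_coordField I x (S.isC1Field_smul_ρ (hv.c1 j))).mono hCT).exists_lipschitzOnWith_of_compact hC
  choose L hL using hLip
  have hA0 : 0 ≤ max A 0 := le_max_right _ _
  refine ⟨(max A 0).toNNReal * ∑ j, L j, fun y => max A 0 * ∑ j, ‖Z j y‖, ?_, fun y hy => ?_, fun y hy hyi => ?_⟩
  · refine LipschitzOnWith.of_dist_le_mul fun y hy z hz => ?_
    rw [Real.dist_eq, ← mul_sub, ← Finset.sum_sub_distrib, abs_mul, abs_of_nonneg hA0, NNReal.coe_mul,
      Real.coe_toNNReal _ hA0, mul_assoc, NNReal.coe_sum, Finset.sum_mul]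
    refine mul_le_mul_of_nonneg_left ((Finset.abs_sum_le_sum_abs _ _).trans ?_) hA0
    refine Finset.sum_le_sum fun j _ => (abs_norm_sub_norm_le _ _).trans ?_
    rw [← dist_eq_norm]
    exact (hL j).dist_le_mul y hy z hz
  · have hyT := hCT hy
    rw [Real.sq_sqrt (mul_nonneg (S.ρ_nonneg _) (sqNorm_nonneg v _))]
    have h1 : S.ρ (φ y) * S.sqNorm v (φ y) = ∑ j, ∑ k, ∑ a, ∑ b,
        (S.γ (φ y))⁻¹ j k * (gram I x y a b * Z j y a * coordField I x (v k) y b) := by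
      simp only [sqNorm, Finset.mul_sum]
      refine Finset.sum_congr rfl fun j _ => Finset.sum_congr rfl fun k _ => ?_
      have h2 := inner_eq_sum_gram I x (fun θ => S.ρ θ • v j θ) (v k) hyT
      simp only [real_inner_smul_left, coordComp_eq] at h2
      rw [mul_left_comm, h2, Finset.mul_sum]
      refine Finset.sum_congr rfl fun a _ => ?_
      rw [Finset.mul_sum]
      rfl
    rw [h1]
    calc _ ≤ ∑ j, ∑ k, ∑ a, ∑ b, |(S.γ (φ y))⁻¹ j k| * |gram I x y a b| * |coordField I x (v k) y b| * ∑ i, ‖Z i y‖ := by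
          refine Finset.sum_le_sum fun j _ => Finset.sum_le_sum fun k _ => Finset.sum_le_sum fun a _ =>
            Finset.sum_le_sum fun b _ => (le_abs_self _).trans ?_
          have h3 : |Z j y a| ≤ ∑ i, ‖Z i y‖ := (PiLp.norm_apply_le (Z j y) a).trans
            (Finset.single_le_sum (f := fun i => ‖Z i y‖) (fun i _ => norm_nonneg _) (Finset.mem_univ j))
          rw [abs_mul, abs_mul, abs_mul]
          calc _ = |(S.γ (φ y))⁻¹ j k| * |gram I x y a b| * |coordField I x (v k) y b| * |Z j y a| := by ring
            _ ≤ _ := mul_le_mul_of_nonneg_left h3 (by positivity)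
      _ = c y * ∑ i, ‖Z i y‖ := by simp only [hc, Finset.sum_mul]
      _ ≤ max A 0 * ∑ i, ‖Z i y‖ := by
          refine mul_le_mul_of_nonneg_right ?_ (Finset.sum_nonneg fun i _ => norm_nonneg _)
          exact ((le_abs_self _).trans (hA y hy)).trans (le_max_left _ _)
  · have hyT := hCT hy
    have hb : φ y ∈ I.boundary M := by
      rw [← I.compl_interior]
      exact fun h => hyi ((mem_interior_target_iff I x hyT).2 h)
    have h0 : ∀ j, Z j y = 0 := fun j => by
      have h1 : chartDeriv I x (φ y) (S.ρ (φ y) • v j (φ y)) = 0 := by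
        rw [hv.boundary j _ hb, map_zero]
      exact h1
    simp [h0]

theorem InDomain.contMDiffAt_raisedScore {w : Fin q → (θ : M) → TangentSpace I θ} (hw : S.InDomain w)
    (j : Fin q) {θ : M} (hθ : θ ∈ I.interior M) : ContMDiffAt I 𝓘(ℝ, ℝ) 1 (S.raisedScore w j) θ :=
  (hw.c1 j).contMDiffAt ((isOpen_interior I M).mem_nhds hθ)

/-- The vector field `γ^{jk} (1/ρ) ∇_b (ρ w_k^b) ρ v_j`, whose divergence is the difference between
the two sides of the integration by parts. -/
def flux (S : BayesProblem I M 𝓧 q) (v w : Fin q → (θ : M) → TangentSpace I θ) (θ : M) : TangentSpace I θ :=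
  ∑ j, S.raisedScore w j θ • (S.ρ θ • v j θ)

variable {v w : Fin q → (θ : M) → TangentSpace I θ}

theorem contMDiffAt_flux (hv : S.IsField v) (hw : S.InDomain w) {θ : M} (hθ : θ ∈ I.interior M) :
    ContMDiffAt I I.tangent 1 (fun θ => (⟨θ, S.flux v w θ⟩ : TangentBundle I M)) θ :=
  ContMDiffAt.sum_section (t := fun j θ => S.raisedScore w j θ • (S.ρ θ • v j θ)) fun j _ =>
    ContMDiffAt.smul_section (hw.contMDiffAt_raisedScore j hθ) (S.isC1Field_smul_ρ (hv.c1 j) θ)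

/-- The product rule: $\nabla_a(s^j\rho v_j^a)=s^j\nabla_a(\rho v_j^a)+\rho v_j^a\partial_as^j$ with
$s^j$ the raised score of `w`. The first term is the prior pairing times $\rho$; the second is the
differential part of `L`, to which the Fisher term is added and subtracted. -/
theorem divergence_flux (hv : S.IsField v) (hw : S.InDomain w) {θ : M} (hθ : θ ∈ I.interior M) :
    divergence I (S.flux v w) θ =
      (S.n * S.fisherPair v w θ + S.priorPair v w θ - contract v (S.L w) θ) * S.ρ θ := by
  have hρ := (S.ρ_pos θ hθ).ne'
  have h1 : divergence I (S.flux v w) θ = ∑ j, (S.raisedScore w j θ * divergence I (fun τ => S.ρ τ • v j τ) θ +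
      dirDeriv I (S.raisedScore w j) θ (S.ρ θ • v j θ)) := by
    unfold flux
    rw [divergence_sum I (X := fun j θ => S.raisedScore w j θ • (S.ρ θ • v j θ)) _ hθ fun j _ => ContMDiffAt.smul_section (hw.contMDiffAt_raisedScore j hθ)
      (S.isC1Field_smul_ρ (hv.c1 j) θ)]
    exact Finset.sum_congr rfl fun j _ => divergence_smul I hθ
      ((hw.contMDiffAt_raisedScore j hθ).mdifferentiableAt one_ne_zero) (S.isC1Field_smul_ρ (hv.c1 j) θ)
  have h2 : ∀ j, divergence I (fun τ => S.ρ τ • v j τ) θ = S.ρ θ * S.score v j θ := fun j => by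
    simp only [score]
    field_simp
  rw [h1]
  simp only [h2, dirDeriv_smul_vec, contract, L, fisherPair, priorPair, weightedForm_apply, mulForm,
    LinearMap.mul_apply', raisedScore_eq]
  rw [Finset.mul_sum, ← Finset.sum_add_distrib, ← Finset.sum_sub_distrib, Finset.sum_mul]
  refine Finset.sum_congr rfl fun j _ => ?_
  have h3 : ∑ k, (S.γ θ)⁻¹ j k * (S.score v j θ * S.score w k θ) =
      S.score v j θ * ∑ k, (S.γ θ)⁻¹ j k * S.score w k θ := by
    rw [Finset.mul_sum]
    exact Finset.sum_congr rfl fun k _ => by ring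
  have h4 : S.raisedScore w j = fun θ => ∑ k, (S.γ θ)⁻¹ j k * S.score w k θ := funext fun θ => S.raisedScore_eq w j θ
  rw [h3, h4]
  ring

/-- One factor $\rho^{1/2}$ goes to the scores of `w`, making them square integrable, and the other
to `v`, making it decay at the boundary. This is the factorization that `IsStokesField` asks for. -/
theorem norm_flux_le (θ : M) :
    ‖S.flux v w θ‖ ≤ Real.sqrt (S.priorTerm w θ * S.ρ θ) * Real.sqrt (S.ρ θ * S.sqNorm v θ) := by
  have hρ := S.ρ_nonneg θ
  have h1 : S.flux v w θ = S.ρ θ • ∑ j, (∑ k, (S.γ θ)⁻¹ j k * S.score w k θ) • v j θ := by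
    rw [flux, Finset.smul_sum]
    refine Finset.sum_congr rfl fun j _ => ?_
    rw [raisedScore_eq, smul_comm]
  have h2 := norm_sum_sum_smul_le (S.γ_inv_posDef θ).posSemidef (fun k => S.score w k θ) (fun j => v j θ)
  have h3 : weightedForm (S.γ θ)⁻¹ mulForm (fun k => S.score w k θ) (fun k => S.score w k θ) = S.priorTerm w θ := by
    rw [← priorPair_self]; rfl
  have h4 : weightedForm (S.γ θ)⁻¹ (innerForm (TangentSpace I θ)) (fun j => v j θ) (fun j => v j θ) = S.sqNorm v θ := rfl
  rw [h3, h4] at h2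
  rw [h1, norm_smul, Real.norm_of_nonneg hρ,
    ← Real.sqrt_mul (mul_nonneg (priorTerm_nonneg θ) hρ)]
  refine Real.le_sqrt_of_sq_le ?_
  calc _ = S.ρ θ ^ 2 * ‖∑ j, (∑ k, (S.γ θ)⁻¹ j k * S.score w k θ) • v j θ‖ ^ 2 := by ring
    _ ≤ S.ρ θ ^ 2 * (S.priorTerm w θ * S.sqNorm v θ) := by gcongr
    _ = _ := by ring

/-- The finite norm of `v` and the finite prior term of `w` make the flux integrable, which controls
the contribution from infinity. Its divergence is integrable because the Fisher and prior pairings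
are and the pairing with `L w` is assumed to be. -/
theorem isStokesField_flux (hv : S.IsField v) (hw : S.InDomain w)
    (hi : S.HasAvg (contract v (S.L w))) : IsStokesField I (S.flux v w) where
  c1 θ hθ := contMDiffAt_flux hv hw hθ
  integrable_norm := by
    have := isContinuousRiemannianBundle (I := I) (M := M)
    have hc : ContinuousOn (fun θ => ‖S.flux v w θ‖) (I.interior M) := by
      have h1 : ContinuousOn (fun θ => (⟨θ, S.flux v w θ⟩ : TangentBundle I M)) (I.interior M) :=
        fun θ hθ => (contMDiffAt_flux hv hw hθ).continuousAt.continuousWithinAt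
      have h2 : ContinuousOn (fun θ => inner ℝ (S.flux v w θ) (S.flux v w θ)) (I.interior M) :=
        h1.inner_bundle h1
      simp only [norm_eq_sqrt_real_inner]
      exact h2.sqrt
    refine (((hv.norm.add hw.field.prior).const_mul (1 / 2))).mono' (aestronglyMeasurable_of_continuousOn hc)
      (Filter.Eventually.of_forall fun θ => ?_)
    rw [norm_norm]
    refine norm_flux_le θ |>.trans ?_
    have hρ := S.ρ_nonneg θ
    have h1 := Real.sq_sqrt (mul_nonneg (priorTerm_nonneg (S := S) (v := w) θ) hρ)
    have h2 := Real.sq_sqrt (mul_nonneg hρ (sqNorm_nonneg (S := S) v θ))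
    nlinarith [sq_nonneg (Real.sqrt (S.priorTerm w θ * S.ρ θ) - Real.sqrt (S.ρ θ * S.sqNorm v θ))]
  integrable_divergence := by
    have h1 := ((((hv.hasAvg_fisherPair hw.field).const_mul S.n).add (hv.hasAvg_priorPair hw.field)).add
      (hi.const_mul (-1)))
    refine Integrable.congr h1 ?_
    filter_upwards [ae_mem_interior I] with θ hθ
    rw [divergence_flux hv hw hθ]
    ring
  exists_le := ⟨fun θ => Real.sqrt (S.priorTerm w θ * S.ρ θ), fun θ => Real.sqrt (S.ρ θ * S.sqNorm v θ),
    fun θ _ => norm_flux_le θ, by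
      have : (fun θ => Real.sqrt (S.priorTerm w θ * S.ρ θ) ^ 2) = fun θ => S.priorTerm w θ * S.ρ θ :=
        funext fun θ => Real.sq_sqrt (mul_nonneg (priorTerm_nonneg θ) (S.ρ_nonneg θ))
      rw [this]
      exact hw.field.prior, hv.hasBoundaryDecay⟩

/-- Only `w` has to lie in the domain of `L`. Hence $\langle v,u\rangle_\rho$ can be computed for
every competing field `v`, once $Lw=u$. -/
theorem pairing_L_eq (hM : IsCompleteRiemannian I M) (hv : S.IsField v) (hw : S.InDomain w)
    (hi : S.HasAvg (contract v (S.L w))) : S.pairing v (S.L w) = S.informationPair v w := by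
  have h0 := (isStokesField_flux hv hw hi).integral_divergence hM
  have h1 : ∫ θ, divergence I (S.flux v w) θ ∂(riemannianVolume I) =
      S.avg (fun θ => (S.n * S.fisherPair v w θ + S.priorPair v w θ) + (-1) * contract v (S.L w) θ) := by
    refine integral_congr_ae ?_
    filter_upwards [ae_mem_interior I] with θ hθ
    rw [divergence_flux hv hw hθ]
    ring
  have hF := (hv.hasAvg_fisherPair hw.field).const_mul S.n
  have hP := hv.hasAvg_priorPair hw.field
  rw [h1, (hF.add hP).avg_add (hi.const_mul (-1)), hF.avg_add hP, avg_const_mul, avg_const_mul] at h0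
  rw [pairing, informationPair]
  linarith

end BayesProblem

/-! ### Properties of `L` and the optimization -/

section
variable {p : ℕ} {H : Type*} [TopologicalSpace H]
  (I : ModelWithCorners ℝ (EuclideanSpace ℝ (Fin p)) H)
  {M : Type*} [TopologicalSpace M] [ChartedSpace H M] [IsManifold I ∞ M]

theorem dirDeriv_lin {φ χ : M → ℝ} {θ : M} (hφ : MDifferentiableAt I 𝓘(ℝ, ℝ) φ θ)
    (hχ : MDifferentiableAt I 𝓘(ℝ, ℝ) χ θ) (a b : ℝ) (X : TangentSpace I θ) :
    dirDeriv I (fun τ => a * φ τ + b * χ τ) θ X = a * dirDeriv I φ θ X + b * dirDeriv I χ θ X := by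
  have h := (hφ.hasMFDerivAt.const_smul a).add (hχ.hasMFDerivAt.const_smul b)
  rw [dirDeriv, HasMFDerivAt.mfderiv (f := fun τ => a * φ τ + b * χ τ) h]
  rfl

end

namespace BayesProblem
variable {p : ℕ} {H : Type*} [TopologicalSpace H]
  {I : ModelWithCorners ℝ (EuclideanSpace ℝ (Fin p)) H}
  {M : Type*} [TopologicalSpace M] [ChartedSpace H M] [IsManifold I ∞ M]
  [RiemannianBundle (fun θ : M => TangentSpace I θ)]
  [IsContMDiffRiemannianBundle I ∞ (EuclideanSpace ℝ (Fin p)) (fun θ : M => TangentSpace I θ)]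
  [T2Space M] [SigmaCompactSpace M] [MeasurableSpace M] [BorelSpace M]
  {𝓧 : Type*} [MeasurableSpace 𝓧] {q : ℕ} {S : BayesProblem I M 𝓧 q}
  {v w w' : Fin q → (θ : M) → TangentSpace I θ}

attribute [local instance] isManifold_one

theorem InDomain.lin (hv : S.InDomain v) (hw : S.InDomain w) (a b : ℝ) :
    S.InDomain fun j θ => a • v j θ + b • w j θ where
  field := hv.field.lin hw.field a b
  c1 j := by
    have h : ContMDiffOn I 𝓘(ℝ, ℝ) 1 (fun θ => a * S.raisedScore v j θ + b * S.raisedScore w j θ)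
        (I.interior M) := (contMDiffOn_const.mul (hv.c1 j)).add (contMDiffOn_const.mul (hw.c1 j))
    exact h.congr fun θ hθ => S.raisedScore_lin hv.field.c1 hw.field.c1 a b j hθ

theorem F_lin_right {θ : M} (hθ : θ ∈ I.interior M) (a b : ℝ) (X Y Z : TangentSpace I θ) :
    S.F θ X (a • Y + b • Z) = a * S.F θ X Y + b * S.F θ X Z := by
  rw [F_comm, S.F_add_left hθ, F_smul_left, F_smul_left, S.F_comm θ Y X, S.F_comm θ Z X]

theorem L_lin (hv : S.InDomain v) (hw : S.InDomain w) (a b : ℝ) (j : Fin q) {θ : M}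
    (hθ : θ ∈ I.interior M) (X : TangentSpace I θ) :
    S.L (fun j θ => a • v j θ + b • w j θ) j θ X = a * S.L v j θ X + b * S.L w j θ X := by
  have h1 : S.raisedScore (fun j θ => a • v j θ + b • w j θ) j =ᶠ[nhds θ]
      fun τ => a * S.raisedScore v j τ + b * S.raisedScore w j τ := by
    filter_upwards [(isOpen_interior I M).mem_nhds hθ] with τ hτ
    exact S.raisedScore_lin hv.field.c1 hw.field.c1 a b j hτ
  have h2 : dirDeriv I (S.raisedScore (fun j θ => a • v j θ + b • w j θ) j) θ X =
      a * dirDeriv I (S.raisedScore v j) θ X + b * dirDeriv I (S.raisedScore w j) θ X := by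
    rw [← dirDeriv_lin I ((hv.contMDiffAt_raisedScore j hθ).mdifferentiableAt one_ne_zero)
      ((hw.contMDiffAt_raisedScore j hθ).mdifferentiableAt one_ne_zero), dirDeriv, dirDeriv, h1.mfderiv_eq]
    rfl
  simp only [L, h2, F_lin_right hθ, mul_add, Finset.sum_add_distrib]
  have h4 : ∀ (c : ℝ) (g : Fin q → ℝ), ∑ k, (S.γ θ)⁻¹ j k * (c * g k) = c * ∑ k, (S.γ θ)⁻¹ j k * g k :=
    fun c g => by
      rw [Finset.mul_sum]
      exact Finset.sum_congr rfl fun k _ => by ring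
  rw [h4, h4]
  ring

theorem pairing_L_comm (hM : IsCompleteRiemannian I M) (hv : S.InDomain v) (hw : S.InDomain w)
    (h1 : S.HasAvg (contract v (S.L w))) (h2 : S.HasAvg (contract w (S.L v))) :
    S.pairing v (S.L w) = S.pairing w (S.L v) := by
  rw [pairing_L_eq hM hv.field hw h1, pairing_L_eq hM hw.field hv h2, informationPair_comm]

theorem pairing_L_self_nonneg (hM : IsCompleteRiemannian I M) (hv : S.InDomain v) :
    0 ≤ S.pairing v (S.L v) := by
  by_cases h : S.HasAvg (contract v (S.L v))
  · rw [pairing_L_eq hM hv.field hv h, informationPair_self]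
    exact information_nonneg
  -- An integral that does not exist is zero by convention.
  · exact (integral_undef h).ge

theorem IsInverse.contract_eq (hw : S.IsInverse w) (v : Fin q → (θ : M) → TangentSpace I θ) :
    ∀ θ ∈ I.interior M, contract v (S.L w) θ = contract v S.u θ := fun θ hθ => by
  simp only [contract, hw.eq _ θ hθ]

theorem IsInverse.pairing_eq (hM : IsCompleteRiemannian I M) (hw : S.IsInverse w) (hv : S.IsField v)
    (h : S.HasAvg (contract v S.u)) : S.pairing v S.u = S.informationPair v w := by
  rw [← pairing_L_eq hM hv hw.domain ((S.hasAvg_congr (hw.contract_eq v)).2 h)]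
  exact (S.avg_congr (hw.contract_eq v)).symm

theorem IsInverse.pairing_self (hM : IsCompleteRiemannian I M) (hw : S.IsInverse w) :
    S.pairing w S.u = S.information w := by
  rw [hw.pairing_eq hM hw.domain.field hw.pairing, informationPair_self]

/-- Both sides equal $Q(w,w')$: each of `w`, `w'` may play the role of the value of $L^{-1}u$
against the other. -/
theorem IsInverse.pairing_unique (hM : IsCompleteRiemannian I M) (hw : S.IsInverse w)
    (hw' : S.IsInverse w') : S.pairing w S.u = S.pairing w' S.u := by
  rw [hw'.pairing_eq hM hw.domain.field hw.pairing, informationPair_comm,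
    ← hw.pairing_eq hM hw'.domain.field hw'.pairing]

/-- A field on which the information vanishes is annihilated by both terms of `L`. -/
theorem IsField.eq_zero_of_information (hv : S.IsField v) (h : S.information v = 0) {θ : M}
    (hθ : θ ∈ I.interior M) : (∀ j, S.raisedScore v j θ = 0) ∧
      ∀ j (X : TangentSpace I θ), S.n * ∑ k, (S.γ θ)⁻¹ j k * S.F θ X (v k θ) = 0 := by
  have hF : 0 ≤ S.n * S.avg (S.fisherTerm v) :=
    mul_nonneg (Nat.cast_nonneg _) (S.avg_nonneg fun _ hθ => fisherTerm_nonneg hθ)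
  have hP : 0 ≤ S.avg (S.priorTerm v) := S.avg_nonneg fun θ _ => priorTerm_nonneg θ
  have hF0 : S.n * S.avg (S.fisherTerm v) = 0 := by rw [information] at h; linarith
  have hP0 : S.avg (S.priorTerm v) = 0 := by rw [information] at h; linarith
  constructor
  · have hc := S.continuousOn_priorPair hv.c1 hv.c1
    rw [priorPair_self] at hc
    have h1 := hv.prior.eq_zero_of_avg_eq_zero hc (fun θ _ => priorTerm_nonneg θ) hP0 θ hθ
    rw [← priorPair_self] at h1
    have h2 := eq_zero_of_weightedForm_mulForm (S.γ_inv_posDef θ) h1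
    intro j
    rw [raisedScore_eq]
    exact Finset.sum_eq_zero fun k _ => by rw [congrFun h2 k]; simp
  · intro j X
    rcases mul_eq_zero.1 hF0 with hn | hA
    · rw [hn, zero_mul]
    · have h1 := hv.fisher.eq_zero_of_avg_eq_zero (S.continuousOn_fisherPair hv.c1 hv.c1)
        (fun _ hθ => fisherTerm_nonneg hθ) hA θ hθ
      -- Cauchy-Schwarz against the tuple with single entry `X` in position `j`: a null vector of a
      -- semidefinite form lies in its kernel.
      have h2 := weightedForm_sq_le (B := S.fisherForm hθ) (S.γ_inv_posDef θ).posSemidef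
        (S.F_self_nonneg hθ) (S.F_comm θ) (Pi.single j X) (fun k => v k θ)
      have h3 : weightedForm (S.γ θ)⁻¹ (S.fisherForm hθ) (fun k => v k θ) (fun k => v k θ) = 0 := h1
      rw [h3, mul_zero] at h2
      have h4 := pow_eq_zero_iff two_ne_zero |>.1 (le_antisymm h2 (sq_nonneg _))
      have h5 : weightedForm (S.γ θ)⁻¹ (S.fisherForm hθ) (Pi.single j X) (fun k => v k θ) =
          ∑ k, (S.γ θ)⁻¹ j k * S.F θ X (v k θ) := by
        rw [weightedForm_apply, Finset.sum_eq_single j]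
        · simp only [Pi.single_eq_same]
          rfl
        · intro i _ hij
          simp [Pi.single_eq_of_ne hij]
        · simp
      rw [← h5, h4, mul_zero]

/-- Otherwise both parts of $Lw$ vanish throughout the interior, in contradiction to $u\ne0$. -/
theorem IsInverse.information_pos (hw : S.IsInverse w)
    (hu : ∃ θ ∈ I.interior M, ∃ j, S.u j θ ≠ 0) : 0 < S.information w := by
  refine lt_of_le_of_ne information_nonneg fun h => ?_
  obtain ⟨θ, hθ, j, hj⟩ := hu
  refine hj (funext fun X => ?_)
  rw [← hw.eq j θ hθ]
  have h1 := fun {τ : M} (hτ : τ ∈ I.interior M) => hw.domain.field.eq_zero_of_information h.symm hτ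
  have h2 : S.raisedScore w j =ᶠ[nhds θ] fun _ => 0 := by
    filter_upwards [(isOpen_interior I M).mem_nhds hθ] with τ hτ using (h1 hτ).1 j
  have h3 : dirDeriv I (S.raisedScore w j) θ X = 0 := by
    rw [dirDeriv, h2.mfderiv_eq, mfderiv_const]
    rfl
  rw [L, (h1 hθ).2 j X, h3, sub_zero]
  rfl

theorem IsField.informationPair_sq_le (hv : S.IsField v) (hw : S.IsField w) (hpos : 0 < S.information w) :
    S.informationPair v w ^ 2 ≤ S.information w * S.information v := by
  -- Positivity of $Q$ at $Q(w,w)\,v-Q(v,w)\,w$, where it equals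
  -- $Q(w,w)\bigl(Q(w,w)Q(v,v)-Q(v,w)^2\bigr)$.
  have h := information_nonneg (S := S) (v := fun j θ => S.information w • v j θ + (-S.informationPair v w) • w j θ)
  rw [hv.information_lin hw] at h
  have h1 : 0 ≤ S.information w * (S.information w * S.information v - S.informationPair v w ^ 2) := by
    nlinarith
  nlinarith [nonneg_of_mul_nonneg_right h1 hpos]

/-- A field whose difference from a value of `L⁻¹ u` carries no information is itself one. -/
theorem IsInverse.of_information_sub (hw : S.IsInverse w) (hv : S.IsField v)
    (hvu : S.HasAvg (contract v S.u))
    (h : S.information (fun j θ => (1 : ℝ) • v j θ + (-1 : ℝ) • w j θ) = 0) : S.IsInverse v := by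
  have hz := fun {τ : M} (hτ : τ ∈ I.interior M) =>
    (hv.lin hw.domain.field 1 (-1)).eq_zero_of_information h hτ
  have hs : ∀ j, ∀ τ ∈ I.interior M, S.raisedScore v j τ = S.raisedScore w j τ := fun j τ hτ => by
    have h1 := (hz hτ).1 j
    rw [S.raisedScore_lin hv.c1 hw.domain.field.c1 1 (-1) j hτ] at h1
    linarith
  refine ⟨⟨hv, fun j => (hw.domain.c1 j).congr (hs j)⟩, fun j θ hθ => ?_, hvu⟩
  rw [← hw.eq j θ hθ]
  ext X
  have he : S.raisedScore v j =ᶠ[nhds θ] S.raisedScore w j := by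
    filter_upwards [(isOpen_interior I M).mem_nhds hθ] with τ hτ using hs j τ hτ
  have h1 := (hz hθ).2 j X
  have h2 : ∑ k, (S.γ θ)⁻¹ j k * S.F θ X ((1 : ℝ) • v k θ + (-1 : ℝ) • w k θ) =
      (∑ k, (S.γ θ)⁻¹ j k * S.F θ X (v k θ)) - ∑ k, (S.γ θ)⁻¹ j k * S.F θ X (w k θ) := by
    rw [← Finset.sum_sub_distrib]
    refine Finset.sum_congr rfl fun k _ => ?_
    rw [F_lin_right hθ]
    ring
  rw [h2, mul_sub] at h1
  have h3 : dirDeriv I (S.raisedScore v j) θ X = dirDeriv I (S.raisedScore w j) θ X := by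
    rw [dirDeriv, dirDeriv, he.mfderiv_eq]
    rfl
  rw [L, L, h3]
  linarith

theorem IsField.smul (hv : S.IsField v) (c : ℝ) : S.IsField fun j θ => c • v j θ := by
  have h := hv.lin hv c 0
  simpa only [zero_smul, add_zero] using h

theorem IsField.information_smul (hv : S.IsField v) (c : ℝ) :
    S.information (fun j θ => c • v j θ) = c ^ 2 * S.information v := by
  have h := hv.information_lin hv c 0
  simpa using h

theorem contract_u_smul (c : ℝ) (θ : M) : contract (fun j θ => c • v j θ) S.u θ = c * contract v S.u θ := by
  simp only [contract, u, dirDeriv_smul_vec, Finset.mul_sum]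

theorem hasAvg_contract_u_smul (h : S.HasAvg (contract v S.u)) (c : ℝ) :
    S.HasAvg (contract (fun j θ => c • v j θ) S.u) :=
  (S.hasAvg_congr fun θ _ => contract_u_smul c θ).2 (h.const_mul c)

theorem pairing_u_smul (c : ℝ) : S.pairing (fun j θ => c • v j θ) S.u = c * S.pairing v S.u := by
  rw [pairing, pairing, ← avg_const_mul]
  exact S.avg_congr fun θ _ => contract_u_smul c θ

theorem IsInverse.bound_smul (hM : IsCompleteRiemannian I M) (hw : S.IsInverse w)
    (hpos : 0 < S.information w) {c : ℝ} (hc : c ≠ 0) :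
    S.IsAdmissible (fun j θ => c • w j θ) ∧ S.bound (fun j θ => c • w j θ) = S.pairing w S.u := by
  have hI := hw.domain.field.information_smul c
  refine ⟨⟨hw.domain.field.smul c, hasAvg_contract_u_smul hw.pairing c, ?_⟩, ?_⟩
  · rw [hI]; positivity
  · rw [bound, hI, pairing_u_smul, hw.pairing_self hM]
    field_simp

theorem IsInverse.bound_le (hM : IsCompleteRiemannian I M) (hw : S.IsInverse w)
    (hpos : 0 < S.information w) (hv : S.IsAdmissible v) : S.bound v ≤ S.pairing w S.u := by
  rw [bound, div_le_iff₀ hv.information, hw.pairing_eq hM hv.field hv.pairing, hw.pairing_self hM]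
  exact hv.field.informationPair_sq_le hw.domain.field hpos

theorem IsInverse.exists_smul_of_bound_eq (hM : IsCompleteRiemannian I M) (hw : S.IsInverse w)
    (hpos : 0 < S.information w) (hv : S.IsAdmissible v) (h : S.bound v = S.pairing w S.u) :
    ∃ c : ℝ, c ≠ 0 ∧ ∃ w', S.IsInverse w' ∧ v = fun j θ => c • w' j θ := by
  rw [bound, div_eq_iff hv.information.ne', hw.pairing_eq hM hv.field hv.pairing, hw.pairing_self hM] at h
  -- The coefficient of the $Q$-orthogonal projection of `v` on `w`. Equality in Cauchy-Schwarz says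
  -- that $v-tw$, and so $t^{-1}v-w$, carries no information, whence $t^{-1}v$ is again a value of
  -- $L^{-1}u$.
  set t := S.informationPair v w / S.information w with ht
  have hvw : S.informationPair v w ≠ 0 := fun h0 => by
    rw [h0] at h
    have := mul_pos hpos hv.information
    nlinarith
  have ht0 : t ≠ 0 := div_ne_zero hvw hpos.ne'
  refine ⟨t, ht0, fun j θ => t⁻¹ • v j θ, ?_, ?_⟩
  · refine hw.of_information_sub (hv.field.smul _) (hasAvg_contract_u_smul hv.pairing _) ?_
    have h1 : (fun j θ => (1 : ℝ) • t⁻¹ • v j θ + (-1 : ℝ) • w j θ) =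
        fun j θ => t⁻¹ • v j θ + (-1 : ℝ) • w j θ := by simp only [one_smul]
    have h2 : S.information v = S.informationPair v w ^ 2 / S.information w := by
      rw [h, mul_div_cancel_left₀ _ hpos.ne']
    rw [h1, hv.field.information_lin hw.domain.field, ht, h2]
    field_simp
    ring
  · ext j θ
    rw [smul_smul, mul_inv_cancel₀ ht0, one_smul]

end BayesProblem

end GillLevit

end

/-! ### The theorem -/

theorem theorem3 {p q : ℕ} {H : Type*} [TopologicalSpace H]
    (I : ModelWithCorners ℝ (EuclideanSpace ℝ (Fin p)) H)
    {M : Type*} [TopologicalSpace M] [T2Space M] [SigmaCompactSpace M]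
    [ChartedSpace H M] [IsManifold I ∞ M]
    [RiemannianBundle (fun θ : M => TangentSpace I θ)]
    [IsContMDiffRiemannianBundle I ∞ (EuclideanSpace ℝ (Fin p)) (fun θ : M => TangentSpace I θ)]
    [MeasurableSpace M] [BorelSpace M] {𝓧 : Type*} [MeasurableSpace 𝓧]
    (hM : GillLevit.IsCompleteRiemannian I M) (S : GillLevit.BayesProblem I M 𝓧 q) :
    -- `L` is linear
    (∀ (v w : Fin q → (θ : M) → TangentSpace I θ) (a b : ℝ), S.InDomain v → S.InDomain w →
      S.InDomain (fun j θ => a • v j θ + b • w j θ) ∧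
      ∀ j, ∀ θ ∈ I.interior M, ∀ X : TangentSpace I θ,
        S.L (fun j θ => a • v j θ + b • w j θ) j θ X = a * S.L v j θ X + b * S.L w j θ X) ∧
    -- `L` is self-adjoint
    (∀ v w : Fin q → (θ : M) → TangentSpace I θ, S.InDomain v → S.InDomain w →
      S.HasAvg (GillLevit.BayesProblem.contract v (S.L w)) →
      S.HasAvg (GillLevit.BayesProblem.contract w (S.L v)) →
      S.pairing v (S.L w) = S.pairing w (S.L v)) ∧
    -- `L` is positive-semidefinite
    (∀ v : Fin q → (θ : M) → TangentSpace I θ, S.InDomain v → 0 ≤ S.pairing v (S.L v)) ∧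
    -- if `u` is nonzero and in the range of `L`: the maximum and the fields that attain it
    ((∃ θ ∈ I.interior M, ∃ j, S.u j θ ≠ 0) →
      ∀ w : Fin q → (θ : M) → TangentSpace I θ, S.IsInverse w →
        IsGreatest {b : ℝ | ∃ v, S.IsAdmissible v ∧ b = S.bound v} (S.pairing w S.u) ∧
        ∀ v : Fin q → (θ : M) → TangentSpace I θ,
          (S.IsAdmissible v ∧ S.bound v = S.pairing w S.u) ↔
            ∃ c : ℝ, c ≠ 0 ∧ ∃ w', S.IsInverse w' ∧ v = fun j θ => c • w' j θ) := by
  refine ⟨fun v w a b hv hw => ⟨hv.lin hw a b, fun j θ hθ X =>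
      GillLevit.BayesProblem.L_lin hv hw a b j hθ X⟩,
    fun v w hv hw h1 h2 => GillLevit.BayesProblem.pairing_L_comm hM hv hw h1 h2,
    fun v hv => GillLevit.BayesProblem.pairing_L_self_nonneg hM hv, fun hu w hw => ?_⟩
  have hpos := hw.information_pos hu
  refine ⟨⟨⟨w, ⟨hw.domain.field, hw.pairing, hpos⟩, ?_⟩, ?_⟩, fun v => ⟨fun h => ?_, ?_⟩⟩
  · rw [GillLevit.BayesProblem.bound, hw.pairing_self hM, sq, mul_div_assoc, div_self hpos.ne', mul_one]
  · rintro b ⟨v, hv, rfl⟩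
    exact hw.bound_le hM hpos hv
  · exact hw.exists_smul_of_bound_eq hM hpos h.1 h.2
  · rintro ⟨c, hc, w', hw', rfl⟩
    -- The field is a multiple of `w'`, which may differ from `w` by an element of the kernel of
    -- `L`; the maximum is therefore first expressed through `w'`.
    rw [hw.pairing_unique hM hw']
    exact hw'.bound_smul hM (hw'.information_pos hu) hc
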